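/- **Setting.** Let $G=(V,E)$ be an infinite, connected, locally finite simple graph, bipartite, with its vertices properly coloured black and white. Let $\mathcal A_c$ be the group of automorphisms of $G$ that preserve the colours. A *fundamental domain* is a finite set $W\subseteq V$ such that every $v\in V$ has $\alpha v\in W$ for some $\alpha\in\mathcal A_c$. Assume that the coloured graph $G$ is quasi-transitive, that is, that a fundamental domain exists. *Local transformations.* A *gadget* $\phi$ is a finite connected simple graph with three distinct outer vertices $w_1,w_2,w_3$, such that some group of automorphisms of the graph preserves the set $\{w_1,w_2,w_3\}$ and acts transitively on it. Applying $\phi$ at a vertex $v$ of degree $3$ means replacing $v$ by a copy of the gadget and attaching the three edges at $v$ to the three outer vertices of the copy, one edge to each, in any order (the order may depend on $v$). Put $g_\phi(x)=\sum_\pi x^{|\pi|}$, where $\pi$ runs over the self-avoiding walks (SAWs) of the gadget from $w_1$ to $w_2$ and $|\pi|$ is the number of vertices of $\pi$ (so $\pi$ is regarded as running from the midpoint of the edge attached at $w_1$ to the midpoint of the edge attached at $w_2$); by symmetry any other pair of outer vertices gives the same function. *Connective constant.* The connective constant of a graph $H$ is the number $\mu(H)$ with $\sigma_n(v)^{1/n}\to\mu(H)$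 for every vertex $v$, where $\sigma_n(v)$ is the number of $n$-step SAWs from $v$. *Exponents.* Let $H$ be a graph with connective constant $\mu$ and let $W$ be a finite set of vertices of $H$. A mid-edge SAW starts and ends at midpoints of edges and visits no vertex and no midpoint of an edge more than once; its length $|\pi|$ is the number of vertices visited, and $\|\pi\|$ is the distance between its endpoints, all edges having length $1$. Let $X$ be the set of edges incident to $W$, $\Sigma$ the set of mid-edge SAWs starting in $X$, $\Sigma_n$ the set of those of length $n$, and $\sigma_n=|\Sigma_n|$. - $\gamma(H)\in[-\infty,\infty]$ is such that $Y(y)=\sum_{\pi\in\Sigma}\mu^{-|\pi|}/|\pi|^{y}$ (denominator $1$ if $|\pi|=0$) is infinite for real $y<\gamma$ and finite for real $y>\gamma$. - $\nu(H)\in[-\infty,\infty]$ is such that $V(z)=\sum_{n\ge1}n^{-(2z+1)}\,\sigma_n^{-1}\sum_{\pi\in\Sigma_n}\|\pi\|^2$ is infinite for real $z<\nu$ and finite for real $z>\nu$. - Let $\mathcal T$ be a collection of translates of $W$, and for $T\in\mathcal T$ let $Z_T(x)=\sum x^{|\pi|}$ over the $\pi\in\Sigma$ that end at an edge incident to $T$.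 A number $\eta(H)\in[-\infty,\infty]$ is an exponent with respect to $\mathcal T$ if for every sequence $(T_k)$ in $\mathcal T$ with $d_H(W,T_k)\to\infty$ and every real $s$, $Z_{T_k}(\mu^{-1})\,d_H(W,T_k)^{s}$ tends to $0$ if $s<\eta$ and to $\infty$ if $s>\eta$. - $H$ *has regular growth* with $\gamma\in\mathbb R$ and $L$ if there are $C_1,C_2\in(0,\infty)$ with $C_1L(n)n^{\gamma-1}\mu^n\le\sigma_n\le C_2L(n)n^{\gamma-1}\mu^n$ for all $n\ge1$. A function $L$ is *slowly varying* if it is measurable and positive on $(0,\infty)$ and $L(tx)/L(x)\to1$ as $x\to\infty$ for every $t>0$. **Theorem.** Consider either of the following two cases. 1. Every black vertex has degree $3$, and $\widetilde G$ is obtained from $G$ by applying a gadget $\phi$ at every black vertex. Put $h(x)=x\,g_\phi(x)$. 2. Every vertex has degree $3$, and $\widetilde G$ is obtained by applying a gadget $\phi_1$ at every black vertex and a gadget $\phi_2$ at every white vertex. Put $h(x)=g_{\phi_1}(x)\,g_{\phi_2}(x)$. In both cases the following holds. (a) The connective constants $\mu$ of $G$ and $\tilde\mu$ of $\widetilde G$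 exist, are positive, and satisfy $\mu^{-2}=h(\tilde\mu^{-1})$. (b) Let $W$ be any fundamental domain of $G$, and for $T\subseteq V$ let $\widetilde T$ be the set of the vertices of $\widetilde G$ that lie over $T$ (the vertices of the gadgets replacing vertices of $T$, and the vertices of $T$ that are not replaced). The exponents of $G$ are taken with respect to $W$, and $\eta(G)$ with respect to the translates $\alpha W$, $\alpha\in\mathcal A_c$; those of $\widetilde G$ are taken with respect to $\widetilde W$. - $\gamma(G)$ and $\gamma(\widetilde G)$ exist, are unique, and are equal (in $[-\infty,\infty]$, in particular when $|\gamma(G)|<\infty$). - If $\eta(\widetilde G)$ exists with respect to the sets $\widetilde{\alpha W}$, $\alpha\in\mathcal A_c$, then it is unique, and $\eta(G)$ exists, is unique, and equals $\eta(\widetilde G)$. The same holds for $\eta(\widetilde G)$ taken with respect to the translates of $\widetilde W$ under all automorphisms of $\widetilde G$, provided that every $\alpha\in\mathcal A_c$ is induced by an automorphism of $\widetilde G$, that is, by one that maps the vertices over $v$ to vertices over $\alpha v$, for every $v\in V$. - If $\gamma=\gamma(G)$ is finite, and $G$ and $\widetilde G$ have regular growth (with $\mu$ and $\tilde\mu$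 respectively) with this $\gamma$ and a common slowly varying function $L$, then $\nu(G)$ and $\nu(\widetilde G)$ exist, are unique, and are equal. -/

import Mathlib

open Filter Topology Set
open scoped ENNReal

universe u w

/-! ### Self-avoiding walks and the connective constant -/

/-- The number `σ_n(v)` of `n`-step self-avoiding walks starting at the vertex `v`. -/
noncomputable def sawCount {V : Type u} (G : SimpleGraph V) (v : V) (n : ℕ) : ℕ :=
  Nat.card {p : Σ t : V, G.Walk v t // p.2.IsPath ∧ p.2.length = n}

/-- `μ` is the connective constant of `G`: `σ_n(v)^{1/n} → μ` for every vertex `v`. -/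
def IsConnectiveConstant {V : Type u} (G : SimpleGraph V) (μ : ℝ) : Prop :=
  ∀ v : V, Tendsto (fun n : ℕ => (sawCount G v n : ℝ) ^ (1 / (n : ℝ))) atTop (𝓝 μ)

/-- A self-avoiding walk between mid-edges that visits `n` vertices: it runs through
`edge 0, vert 0, edge 1, vert 1, …, vert (n-1), edge n`, every vertex lying on the edge before
and on the edge after it, and no vertex and no mid-edge is visited twice. Its length is `n`. -/
@[ext] structure MidSAW {V : Type u} (G : SimpleGraph V) (n : ℕ) where
  edge : Fin (n + 1) → Sym2 V
  vert : Fin n → V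
  edge_mem : ∀ i, edge i ∈ G.edgeSet
  mem_before : ∀ i, vert i ∈ edge i.castSucc
  mem_after : ∀ i, vert i ∈ edge i.succ
  edge_injective : Function.Injective edge
  vert_injective : Function.Injective vert

/-- The initial mid-edge. -/
def MidSAW.first {V : Type u} {G : SimpleGraph V} {n : ℕ} (π : MidSAW G n) : Sym2 V := π.edge 0

/-- The final mid-edge. -/
def MidSAW.last {V : Type u} {G : SimpleGraph V} {n : ℕ} (π : MidSAW G n) : Sym2 V :=
  π.edge (Fin.last n)

/-- The set `X` of edges incident to the vertices in `W`. -/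
def incidentEdges {V : Type u} (G : SimpleGraph V) (W : Set V) : Set (Sym2 V) :=
  {e | e ∈ G.edgeSet ∧ ∃ v ∈ W, v ∈ e}

/-- The number `σ_n` of `n`-step mid-edge SAWs that start at an edge incident to `W`. -/
noncomputable def midSawCount {V : Type u} (G : SimpleGraph V) (W : Set V) (n : ℕ) : ℕ :=
  Nat.card {π : MidSAW G n // π.first ∈ incidentEdges G W}

/-! ### Critical exponents

In these definitions `W` plays the role of the fundamental domain and `μ` that of the connective
constant. -/

/-- `c ∈ [-∞, ∞]` separates the real arguments where `F` is infinite (below `c`) from those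
where `F` is finite (above `c`). -/
def IsThreshold (F : ℝ → ℝ≥0∞) (c : EReal) : Prop :=
  (∀ y : ℝ, (y : EReal) < c → F y = ⊤) ∧ (∀ y : ℝ, c < (y : EReal) → F y < ⊤)

/-- `Y(x, y) = ∑ x^{|π|} / |π|^y` over the mid-edge SAWs `π` starting at an edge incident to `W`;
the denominator is `1` when `|π| = 0`. -/
noncomputable def seriesY {V : Type u} (G : SimpleGraph V) (W : Set V) (x y : ℝ) : ℝ≥0∞ :=
  ∑' π : {π : Σ n : ℕ, MidSAW G n // π.2.first ∈ incidentEdges G W},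
    ENNReal.ofReal (x ^ π.1.1 / (if π.1.1 = 0 then 1 else (π.1.1 : ℝ) ^ y))

/-- `γ` is the exponent of the susceptibility. -/
def IsGamma {V : Type u} (G : SimpleGraph V) (W : Set V) (μ : ℝ) (γ : EReal) : Prop :=
  IsThreshold (fun y => seriesY G W μ⁻¹ y) γ

/-- The distance in `G` between two mid-edges, each regarded as the midpoint of an edge of unit
length. -/
noncomputable def midDist {V : Type u} (G : SimpleGraph V) (e f : Sym2 V) : ℕ :=
  open Classical in
  if e = f then 0 else 1 + sInf {d : ℕ | ∃ a ∈ e, ∃ b ∈ f, d = G.dist a b}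

/-- The mean of `‖π‖²` for the uniform measure on the `n`-step mid-edge SAWs starting at an edge
incident to `W`, where `‖π‖` is the distance between the endpoints of `π`. -/
noncomputable def meanSqDist {V : Type u} (G : SimpleGraph V) (W : Set V) (n : ℕ) : ℝ≥0∞ :=
  (∑' π : {π : MidSAW G n // π.first ∈ incidentEdges G W},
    ((midDist G π.1.first π.1.last : ℝ≥0∞)) ^ 2) / (midSawCount G W n : ℝ≥0∞)

/-- `V(z) = ∑_{n ≥ 1} n^{-(2z+1)} ⟨‖π‖²⟩_n`. -/
noncomputable def seriesV {V : Type u} (G : SimpleGraph V) (W : Set V) (z : ℝ) : ℝ≥0∞ :=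
  ∑' n : ℕ, ENNReal.ofReal (1 / ((n + 1 : ℕ) : ℝ) ^ (2 * z + 1)) * meanSqDist G W (n + 1)

/-- `ν` is the exponent of the mean square displacement. -/
def IsNu {V : Type u} (G : SimpleGraph V) (W : Set V) (ν : EReal) : Prop :=
  IsThreshold (fun z => seriesV G W z) ν

/-- `∑ x^{|π|}` over the mid-edge SAWs `π` from an edge incident to `W` to an edge incident
to `T`. -/
noncomputable def seriesZ {V : Type u} (G : SimpleGraph V) (W T : Set V) (x : ℝ) : ℝ≥0∞ :=
  ∑' π : {π : Σ n : ℕ, MidSAW G n //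
      π.2.first ∈ incidentEdges G W ∧ π.2.last ∈ incidentEdges G T},
    ENNReal.ofReal (x ^ π.1.1)

/-- The distance `d_G(W, T)` between two sets of vertices. -/
noncomputable def setDist {V : Type u} (G : SimpleGraph V) (W T : Set V) : ℕ :=
  sInf {d : ℕ | ∃ a ∈ W, ∃ b ∈ T, d = G.dist a b}

/-- `η` is the exponent of the two-point function, where `𝒯` is the collection of the
translates `αW` of the fundamental domain under the automorphisms `α` considered: for every
sequence of translates `T` whose distance to `W` tends to infinity, `Z_T(μ⁻¹) d(W, T)^s` tends
to `0` if `s < η` and to `∞` if `s > η`. -/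
def IsEta {V : Type u} (G : SimpleGraph V) (W : Set V) (𝒯 : Set (Set V)) (μ : ℝ)
    (η : EReal) : Prop :=
  ∀ T : ℕ → Set V, (∀ k, T k ∈ 𝒯) → Tendsto (fun k => setDist G W (T k)) atTop atTop →
    ∀ s : ℝ,
      ((s : EReal) < η → Tendsto (fun k =>
        seriesZ G W (T k) μ⁻¹ * ENNReal.ofReal ((setDist G W (T k) : ℝ) ^ s)) atTop (𝓝 0)) ∧
      (η < (s : EReal) → Tendsto (fun k =>
        seriesZ G W (T k) μ⁻¹ * ENNReal.ofReal ((setDist G W (T k) : ℝ) ^ s)) atTop (𝓝 ⊤))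

/-- A slowly varying function (on the positive half-line; its values elsewhere play no role). -/
def SlowlyVarying (L : ℝ → ℝ) : Prop :=
  Measurable L ∧ (∀ x, 0 < x → 0 < L x) ∧
    ∀ t, 0 < t → Tendsto (fun x => L (t * x) / L x) atTop (𝓝 1)

/-- `C₁ L(n) n^{γ-1} μ^n ≤ σ_n ≤ C₂ L(n) n^{γ-1} μ^n` for all `n ≥ 1`, with positive constants. -/
def HasRegularGrowth {V : Type u} (G : SimpleGraph V) (W : Set V) (μ γ : ℝ) (L : ℝ → ℝ) : Prop :=
  ∃ C₁ C₂ : ℝ, 0 < C₁ ∧ 0 < C₂ ∧ ∀ n : ℕ, 1 ≤ n →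
    C₁ * L n * (n : ℝ) ^ (γ - 1) * μ ^ n ≤ (midSawCount G W n : ℝ) ∧
    (midSawCount G W n : ℝ) ≤ C₂ * L n * (n : ℝ) ^ (γ - 1) * μ ^ n

/-- Both defining properties `P` and `Q` of an exponent determine exactly one value, and the two
values coincide. -/
def SameExponent (P Q : EReal → Prop) : Prop :=
  ∃ c : EReal, (∀ d, P d ↔ d = c) ∧ (∀ d, Q d ↔ d = c)

/-! ### Coloured graphs -/

/-- `α` preserves the colouring `χ`. -/
def PreservesColour {V : Type u} {G : SimpleGraph V} (χ : G.Coloring Bool) (α : G ≃g G) : Prop :=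
  ∀ v, χ (α v) = χ v

/-- `W` is a fundamental domain of the coloured graph: a finite set that meets every orbit of the
group of colour-preserving automorphisms. -/
def IsFundamentalDomain {V : Type u} {G : SimpleGraph V} (χ : G.Coloring Bool) (W : Set V) :
    Prop :=
  W.Finite ∧ ∀ v, ∃ α : G ≃g G, PreservesColour χ α ∧ α v ∈ W

/-- The coloured graph is quasi-transitive. -/
def ColourQuasiTransitive {V : Type u} {G : SimpleGraph V} (χ : G.Coloring Bool) : Prop :=
  ∃ W : Set V, IsFundamentalDomain χ W

/-- The translates of `W` under the colour-preserving automorphisms. -/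
def colourTranslates {V : Type u} {G : SimpleGraph V} (χ : G.Coloring Bool) (W : Set V) :
    Set (Set V) :=
  {T | ∃ α : G ≃g G, PreservesColour χ α ∧ T = α '' W}

/-- The translates of `W` under all automorphisms. -/
def autTranslates {V : Type u} (G : SimpleGraph V) (W : Set V) : Set (Set V) :=
  {T | ∃ α : G ≃g G, T = α '' W}

/-! ### Gadgets and local transformations -/

/-- A graph with three labelled vertices, the outer vertices. -/
structure PortedGraph (U : Type w) where
  graph : SimpleGraph U
  port : Fin 3 → U

/-- The conditions on the gadget of a local transformation: a finite connected graph with three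
distinct outer vertices, such that some group of automorphisms preserves the set of the outer
vertices and acts transitively on it. -/
structure PortedGraph.IsGadget {U : Type w} (φ : PortedGraph U) : Prop where
  finite : Finite U
  connected : φ.graph.Connected
  port_injective : Function.Injective φ.port
  symmetric : ∃ S : Subgroup (φ.graph ≃g φ.graph),
    (∀ α ∈ S, α '' range φ.port = range φ.port) ∧ ∀ i j, ∃ α ∈ S, α (φ.port i) = φ.port j

/-- The one-vertex graph that replaces an untransformed vertex. -/
def PortedGraph.trivial : PortedGraph PUnit.{w + 1} where
  graph := ⊥
  port := fun _ => PUnit.unit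

/-- The generating function `g_φ(x) = ∑ x^{|π|}` of the SAWs `π` that enter the gadget through one
prescribed outer vertex, leave it through another one, and stay in the gadget in between; `|π|` is
the number of vertices of `π`. -/
noncomputable def PortedGraph.gen {U : Type w} (φ : PortedGraph U) (x : ℝ) : ℝ :=
  ∑ᶠ p : φ.graph.Path (φ.port 0) (φ.port 1), x ^ (p.1.length + 1)

/-- The vertex set of the graph put in place of a vertex: `U₁` for a black vertex (colour `true`),
`U₂` for a white one (colour `false`). -/
def Fiber (U₁ U₂ : Type w) : Bool → Type w
  | true => U₁
  | false => U₂

/-- The graph put in place of a vertex of the given colour. -/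
def fiberGraph {U₁ U₂ : Type w} (φ₁ : PortedGraph U₁) (φ₂ : PortedGraph U₂) :
    (c : Bool) → SimpleGraph (Fiber U₁ U₂ c)
  | true => φ₁.graph
  | false => φ₂.graph

/-- The outer vertices of the graph put in place of a vertex of the given colour. -/
def fiberPort {U₁ U₂ : Type w} (φ₁ : PortedGraph U₁) (φ₂ : PortedGraph U₂) :
    (c : Bool) → Fin 3 → Fiber U₁ U₂ c
  | true => φ₁.port
  | false => φ₂.port

/-- The vertices of the transformed graph. -/
abbrev TVertex {V : Type u} {G : SimpleGraph V} (χ : G.Coloring Bool) (U₁ U₂ : Type w) :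
    Type (max u w) :=
  Σ v : V, Fiber U₁ U₂ (χ v)

/-- The graph obtained from `G` by replacing every black vertex by a copy of `φ₁` and every white
vertex by a copy of `φ₂`. The edge of `G` between `v` and `v'` is attached to the outer vertex
with label `att v v'` of the copy at `v` and to the one with label `att v' v` of the copy
at `v'`. -/
def transform {V : Type u} {G : SimpleGraph V} (χ : G.Coloring Bool) {U₁ U₂ : Type w}
    (φ₁ : PortedGraph U₁) (φ₂ : PortedGraph U₂) (att : (v : V) → G.neighborSet v → Fin 3) :
    SimpleGraph (TVertex χ U₁ U₂) where
  Adj p q :=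
    (∃ (v : V) (a b : Fiber U₁ U₂ (χ v)),
      p = ⟨v, a⟩ ∧ q = ⟨v, b⟩ ∧ (fiberGraph φ₁ φ₂ (χ v)).Adj a b) ∨
    (∃ h : G.Adj p.1 q.1,
      p.2 = fiberPort φ₁ φ₂ (χ p.1) (att p.1 ⟨q.1, h⟩) ∧
      q.2 = fiberPort φ₁ φ₂ (χ q.1) (att q.1 ⟨p.1, h.symm⟩))
  symm := ⟨by
    rintro p q (⟨v, a, b, rfl, rfl, h⟩ | ⟨h, h₁, h₂⟩)
    · exact Or.inl ⟨v, b, a, rfl, rfl, h.symm⟩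
    · exact Or.inr ⟨h.symm, h₂, h₁⟩⟩
  loopless := ⟨by
    rintro p (⟨v, a, b, rfl, h', h⟩ | ⟨h, _⟩)
    · obtain rfl : a = b := by simpa using h'
      exact h.ne rfl
    · exact h.ne rfl⟩

/-- The set of the vertices of the transformed graph that lie over the vertices in `W`. -/
def liftSet {V : Type u} {G : SimpleGraph V} (χ : G.Coloring Bool) (U₁ U₂ : Type w) (W : Set V) :
    Set (TVertex χ U₁ U₂) :=
  {p | p.1 ∈ W}

/-- The sets over the translates of `W` under the colour-preserving automorphisms of `G`, that is,
the translates of the set over `W` under the induced action on the copies of the gadgets. -/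
def inducedTranslates {V : Type u} {G : SimpleGraph V} (χ : G.Coloring Bool) (U₁ U₂ : Type w)
    (W : Set V) : Set (Set (TVertex χ U₁ U₂)) :=
  {T | ∃ α : G ≃g G, PreservesColour χ α ∧ T = liftSet χ U₁ U₂ (α '' W)}

/-- Every colour-preserving automorphism of `G` is induced by an automorphism of the transformed
graph. -/
def AutomorphismsLift {V : Type u} {G : SimpleGraph V} (χ : G.Coloring Bool) {U₁ U₂ : Type w}
    (H : SimpleGraph (TVertex χ U₁ U₂)) : Prop :=
  ∀ α : G ≃g G, PreservesColour χ α → ∃ β : H ≃g H, ∀ p, (β p).1 = α p.1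

/-! A mid-edge SAW of `G` lifts to the transformed graph: every visited vertex is replaced by a SAW
of its gadget between the two ports where the walk enters and leaves. The choices at different
vertices are independent, and the symmetry of a gadget makes the generating function of its
traversals independent of the ports. So the lifts of one walk have as total weight a product of
factors given by the colours of its vertices (`sum_lifts`). Colours alternate, hence for a walk with
`n` vertices this product is `y ^ n` up to a bounded factor, where `y ^ 2 = h(x)` (`weight_bounds`).

Conversely, a mid-edge SAW of the transformed graph that does not stay in one gadget is such a lift,
up to a piece in the gadget at either end (`exists_lift_of_isMid`). The point is that its projection
is again self-avoiding: a traversal uses two ports, so two disjoint traversals of a gadget with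
three ports are impossible. The end pieces have at most `K` vertices and so take boundedly many
values. Sums over the walks of the two graphs are therefore comparable up to constants, the walks
inside single gadgets aside (`midSum_ge`, `tsum_not_inFiber_le`).

The critical point `x₀` is a solution of `h(x₀) = μ⁻¹ ^ 2`. For `G`, the connective constant comes
from Fekete's lemma and a transfer of growth between nearby vertices (`exists_growth`). The
transformed graph need not be quasi-transitive, as the edges are attached in arbitrary order; that
`x₀⁻¹` is its connective constant follows from an upper bound uniform in the starting point
(`Decoration.upperGrowth`) and a lower bound obtained by lifting (`Decoration.lowerGrowth`).

For the exponents, sums with an additional weight depending on the length are compared at the two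
critical points (`Critical.compare`). The lengths of a walk and of its lift agree up to a bounded
factor, and so do the relevant distances, so it suffices that the weight varies slowly enough:
powers do, and so do slowly varying functions (`SlowlyVarying.regularSeq`). Finiteness of the series
for `γ` and `ν`, and the size of the two-point function, then carry over. Regular growth serves to
replace `σ_n⁻¹` in the series for `ν` by an explicit weight common to both graphs.

Both cases of the theorem are instances of one structure, `Decoration`: a vertex that is not
replaced carries a one-vertex gadget with generating function `x`. -/

/-! ### Walks as lists of vertices -/

section Lists

variable {V : Type u}

/-- The list of the edges between consecutive entries of a list of vertices. -/
def edgeList (q : List V) : List (Sym2 V) := List.zipWith (fun a b => s(a, b)) q q.tail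

@[simp] lemma edgeList_nil : edgeList ([] : List V) = [] := rfl

@[simp] lemma edgeList_singleton (a : V) : edgeList [a] = [] := rfl

@[simp] lemma edgeList_cons_cons (a b : V) (t : List V) :
    edgeList (a :: b :: t) = s(a, b) :: edgeList (b :: t) := rfl

lemma length_edgeList (q : List V) : (edgeList q).length = q.length - 1 := by
  simp [edgeList]

lemma getElem_edgeList (q : List V) (i : ℕ) (h : i < (edgeList q).length) :
    (edgeList q)[i] = s(q[i]'(by rw [length_edgeList] at h; omega),
      q[i + 1]'(by rw [length_edgeList] at h; omega)) := by
  simp [edgeList]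

lemma edgeList_append {a b : V} : ∀ {P Q : List V}, P.getLast? = some a → Q.head? = some b →
    edgeList (P ++ Q) = edgeList P ++ s(a, b) :: edgeList Q
  | [], _, h, _ => by simp at h
  | [x], [], _, h' => by simp at h'
  | [x], y :: t, h, h' => by simp_all
  | x :: y :: P, Q, h, h' => by
    have := edgeList_append (P := y :: P) (Q := Q) (a := a) (b := b) (by simpa using h) h'
    simp only [List.cons_append] at this ⊢
    simp [this]

lemma mem_of_mem_edgeList {e : Sym2 V} {a : V} : ∀ {q : List V}, e ∈ edgeList q → a ∈ e → a ∈ q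
  | [], h, _ => by simp at h
  | [x], h, _ => by simp at h
  | x :: y :: t, h, h' => by
    rw [edgeList_cons_cons, List.mem_cons] at h
    rcases h with rfl | h
    · rw [Sym2.mem_iff] at h'
      rcases h' with rfl | rfl <;> simp
    · exact List.mem_cons_of_mem _ (mem_of_mem_edgeList h h')

lemma nodup_edgeList : ∀ {q : List V}, q.Nodup → (edgeList q).Nodup
  | [], _ => by simp
  | [x], _ => by simp
  | x :: y :: t, h => by
    rw [List.nodup_cons] at h
    rw [edgeList_cons_cons, List.nodup_cons]
    exact ⟨fun h' => h.1 (mem_of_mem_edgeList h' (by simp)), nodup_edgeList h.2⟩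

lemma edgeList_subset_edgeSet {H : SimpleGraph V} : ∀ {q : List V}, q.IsChain H.Adj →
    ∀ e ∈ edgeList q, e ∈ H.edgeSet
  | [], _ => by simp
  | [x], _ => by simp
  | x :: y :: t, h => by
    rw [List.isChain_cons_cons] at h
    intro e he
    rw [edgeList_cons_cons, List.mem_cons] at he
    rcases he with rfl | he
    · exact h.1
    · exact edgeList_subset_edgeSet h.2 e he

/-- The vertex list of a mid-edge self-avoiding walk, the far ends of the first and of the last
edge included. -/
structure IsMid (H : SimpleGraph V) (q : List V) : Prop where
  two_le : 2 ≤ q.length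
  chain : q.IsChain H.Adj
  edges : (edgeList q).Nodup
  inner : q.tail.dropLast.Nodup

/-- Distinctness of all entries is more than `IsMid` demands, since the two far ends are not visited
and may recur in the list. Through this lemma an `n`-step SAW with `n ≥ 1` counts as a mid-edge walk
of length `n - 1`. -/
lemma IsMid.of_nodup {H : SimpleGraph V} {q : List V} (h : 2 ≤ q.length) (hc : q.IsChain H.Adj)
    (hn : q.Nodup) : IsMid H q :=
  ⟨h, hc, nodup_edgeList hn, hn.tail.sublist (List.dropLast_sublist _)⟩

/-- The first edge of a walk starts in `W`. -/
def StartsAt (W : Set V) (q : List V) : Prop := ∃ v ∈ W, v ∈ q.take 2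

/-- The last edge of a walk is incident to `T`. -/
def EndsAt (T : Set V) (q : List V) : Prop := ∃ v ∈ T, v ∈ q.drop (q.length - 2)

lemma IsMid.getElem_inner {H : SimpleGraph V} {q : List V} (h : IsMid H q) {i j : ℕ}
    (hi : i < q.length - 2) (hj : j < q.length - 2) (hij : q[i + 1] = q[j + 1]) : i = j := by
  have := List.nodup_iff_injective_getElem.1 h.inner
  have h1 : i < q.tail.dropLast.length := by simp; omega
  have h2 : j < q.tail.dropLast.length := by simp; omega
  have := @this ⟨i, h1⟩ ⟨j, h2⟩ (by simpa using hij)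
  simpa using this

/-- The mid-edge self-avoiding walk with a given vertex list. -/
def IsMid.toMidSAW {H : SimpleGraph V} {q : List V} (h : IsMid H q) : MidSAW H (q.length - 2) where
  edge i := s(q[i.1]'(by have := h.two_le; omega), q[i.1 + 1]'(by have := h.two_le; omega))
  vert i := q[i.1 + 1]
  edge_mem i := by
    have := List.isChain_iff_getElem.1 h.chain i.1 (by have := h.two_le; omega)
    exact this
  mem_before i := by simp
  mem_after i := by simp
  edge_injective i j hij := by
    have := h.two_le
    have h1 : i.1 < (edgeList q).length := by rw [length_edgeList]; omega
    have h2 : j.1 < (edgeList q).length := by rw [length_edgeList]; omega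
    have := List.nodup_iff_injective_getElem.1 h.edges (a₁ := ⟨i, h1⟩) (a₂ := ⟨j, h2⟩) (by
      simp only [getElem_edgeList]; exact hij)
    ext; simpa using this
  vert_injective i j hij := by
    ext; exact h.getElem_inner i.2 j.2 hij

lemma mem_take_two_iff {q : List V} (h : 2 ≤ q.length) (v : V) :
    v ∈ q.take 2 ↔ v ∈ s(q[0], q[1]) := by
  match q, h with
  | a :: b :: t, _ => simp

lemma mem_drop_two_iff {q : List V} (h : 2 ≤ q.length) (v : V) :
    v ∈ q.drop (q.length - 2) ↔ v ∈ s(q[q.length - 2], q[q.length - 2 + 1]) := by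
  have : q.drop (q.length - 2) = [q[q.length - 2], q[q.length - 2 + 1]] := by
    rw [List.drop_eq_getElem_cons (by omega), List.drop_eq_getElem_cons (by omega),
      List.drop_of_length_le (by omega)]
  rw [this]; simp

lemma IsMid.first_mem_iff {H : SimpleGraph V} {q : List V} (h : IsMid H q) (W : Set V) :
    h.toMidSAW.first ∈ incidentEdges H W ↔ StartsAt W q := by
  have h1 := h.toMidSAW.edge_mem 0
  have : h.toMidSAW.first ∈ incidentEdges H W ↔ ∃ v ∈ W, v ∈ h.toMidSAW.first :=
    ⟨fun h => h.2, fun h => ⟨h1, h⟩⟩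
  rw [this]
  unfold StartsAt
  simp_rw [mem_take_two_iff h.two_le]
  rfl

lemma IsMid.last_mem_iff {H : SimpleGraph V} {q : List V} (h : IsMid H q) (W : Set V) :
    h.toMidSAW.last ∈ incidentEdges H W ↔ EndsAt W q := by
  have h1 := h.toMidSAW.edge_mem (Fin.last _)
  have : h.toMidSAW.last ∈ incidentEdges H W ↔ ∃ v ∈ W, v ∈ h.toMidSAW.last :=
    ⟨fun h => h.2, fun h => ⟨h1, h⟩⟩
  rw [this]
  unfold EndsAt
  simp_rw [mem_drop_two_iff h.two_le]
  rfl

end Lists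

/-! ### Sums over mid-edge walks as sums over vertex lists -/

section MidSAWLists

variable {V : Type u} {H : SimpleGraph V}

lemma Sym2.eq_mk_of_mem {a b : V} {e : Sym2 V} (hab : a ≠ b) (ha : a ∈ e) (hb : b ∈ e) :
    e = s(a, b) := (Sym2.mem_and_mem_iff hab).1 ⟨ha, hb⟩

/-- Every mid-edge self-avoiding walk has a vertex list. -/
lemma exists_isMid (n : ℕ) (π : MidSAW H n) :
    ∃ (q : List V) (h : IsMid H q),
      (⟨n, π⟩ : Σ n, MidSAW H n) = ⟨q.length - 2, h.toMidSAW⟩ := by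
  -- The list is `c 0, …, c (n + 1)`: the visited vertices, flanked by the far ends of the first and
  -- the last edge. Consecutive visited vertices are distinct and both lie on the edge between them,
  -- which determines that edge. For `n = 0` the order of the two ends is an arbitrary choice.
  obtain ⟨c, hc, hv⟩ : ∃ c : ℕ → V, (∀ i : Fin (n + 1), π.edge i = s(c i, c (i + 1))) ∧
      ∀ i : Fin n, π.vert i = c (i + 1) := by
    rcases Nat.eq_zero_or_pos n with rfl | hn
    · obtain ⟨a, b, hab⟩ : ∃ a b, π.edge 0 = s(a, b) := by
        induction h : π.edge 0 using Sym2.ind with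
        | _ a b => exact ⟨a, b, rfl⟩
      refine ⟨fun i => if i = 0 then a else b, fun i => ?_, fun i => i.elim0⟩
      obtain rfl : i = 0 := by ext; simp
      simpa using hab
    · obtain ⟨a, ha⟩ := Sym2.mem_iff_exists.1 (π.mem_before ⟨0, hn⟩)
      obtain ⟨b, hb⟩ := Sym2.mem_iff_exists.1 (π.mem_after ⟨n - 1, by omega⟩)
      refine ⟨fun i => if i = 0 then a else if h : i - 1 < n then π.vert ⟨i - 1, h⟩ else b,
        fun i => ?_, fun i => ?_⟩
      · obtain ⟨i, hi⟩ := i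
        rcases Nat.eq_zero_or_pos i with rfl | hi0
        · simp only [↓reduceIte, Nat.add_one_ne_zero, hn, dite_true, zero_add, Nat.sub_self]
          rw [Sym2.eq_swap]
          exact ha
        · rcases Nat.lt_or_ge i n with hin | hin
          · have e1 := π.mem_after ⟨i - 1, by omega⟩
            have e2 := π.mem_before ⟨i, hin⟩
            have h1 : (⟨i - 1, by omega⟩ : Fin n).succ = ⟨i, hi⟩ := by
              ext; simp; omega
            rw [h1] at e1
            have hne : π.vert ⟨i - 1, by omega⟩ ≠ π.vert ⟨i, hin⟩ := fun h => by
              have := π.vert_injective h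
              simp at this; omega
            simp only [Nat.add_one_ne_zero, if_false, Nat.add_sub_cancel, hin, dite_true,
              hi0.ne', show i - 1 < n by omega]
            exact Sym2.eq_mk_of_mem hne e1 e2
          · obtain rfl : i = n := by omega
            have h1 : (⟨i - 1, by omega⟩ : Fin i).succ = ⟨i, hi⟩ := by
              ext; simp; omega
            rw [h1] at hb
            simp only [Nat.add_one_ne_zero, if_false, Nat.add_sub_cancel, 
              hi0.ne', show i - 1 < i by omega, dite_true, lt_irrefl, dite_false]
            exact hb
      · simp
  have hlen : ((List.range (n + 2)).map c).length = n + 2 := by simp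
  refine ⟨(List.range (n + 2)).map c, ⟨by simp, ?_, ?_, ?_⟩, ?_⟩
  · rw [List.isChain_iff_getElem]
    intro i hi
    have := π.edge_mem ⟨i, by simp at hi; omega⟩
    rw [hc] at this
    simpa using this
  · rw [List.nodup_iff_injective_getElem]
    rintro ⟨i, hi⟩ ⟨j, hj⟩ hij
    simp only [getElem_edgeList] at hij
    rw [length_edgeList, hlen] at hi hj
    have := π.edge_injective (a₁ := ⟨i, by omega⟩) (a₂ := ⟨j, by omega⟩) (by
      rw [hc, hc]; simpa using hij)
    simpa using this
  · rw [List.nodup_iff_injective_getElem]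
    rintro ⟨i, hi⟩ ⟨j, hj⟩ hij
    simp at hi hj
    have := π.vert_injective (a₁ := ⟨i, by omega⟩) (a₂ := ⟨j, by omega⟩) (by
      rw [hv, hv]; simpa using hij)
    simpa using this
  · have key : ∀ m (hm : m = n) (π' : MidSAW H m),
        (∀ i, π'.edge i = s(c i, c (i + 1))) → (∀ i, π'.vert i = c (i + 1)) →
        (⟨n, π⟩ : Σ n, MidSAW H n) = ⟨m, π'⟩ := by
      rintro m rfl π' h1 h2
      congr 1
      ext i : 2
      · rw [h1, hc]
      · rw [h2, hv]
    refine key _ (by simp) _ (fun i => ?_) (fun i => ?_) <;> simp [IsMid.toMidSAW]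

/-- A mid-edge walk together with its first vertex determines the vertex list. -/
lemma IsMid.ext_of_head {q q' : List V} (h : IsMid H q) (h' : IsMid H q')
    (he : (⟨q.length - 2, h.toMidSAW⟩ : Σ n, MidSAW H n) = ⟨q'.length - 2, h'.toMidSAW⟩)
    (h0 : q.head? = q'.head?) : q = q' := by
  have key : ∀ p p' : Σ n, MidSAW H n, p = p' → p.1 = p'.1 ∧ ∀ i (hi : i < p.1 + 1)
      (hi' : i < p'.1 + 1), p.2.edge ⟨i, hi⟩ = p'.2.edge ⟨i, hi'⟩ := by
    rintro p _ rfl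
    exact ⟨rfl, fun _ _ _ => rfl⟩
  obtain ⟨h1, h2⟩ := key _ _ he
  have h3 := h.two_le
  have h4 := h'.two_le
  simp only at h1
  have hlen : q.length = q'.length := by omega
  refine List.ext_getElem hlen fun i hi hi' => ?_
  induction i with
  | zero =>
    rw [List.head?_eq_getElem?, List.head?_eq_getElem?, List.getElem?_eq_getElem hi,
      List.getElem?_eq_getElem hi'] at h0
    simpa using h0
  | succ i ih =>
    have h5 := h2 i (by simp only; omega) (by simp only; omega)
    simp only [IsMid.toMidSAW] at h5
    rw [ih (by omega) (by omega)] at h5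
    exact Sym2.congr_right.1 h5

/-- The first component of `i` is at most `card ι`-to-one, the second one labels the preimages. All
bounded multiplicities below enter in this form: the direction of a list, and the pieces at the ends
of a walk. -/
lemma tsum_le_mul_of_injective {α β : Type*} {ι : Type*} [Fintype ι] {f : α → ℝ≥0∞} {g : β → ℝ≥0∞}
    (i : α → β × ι) (hi : Function.Injective i) (h : ∀ a, f a ≤ g (i a).1) :
    ∑' a, f a ≤ Fintype.card ι * ∑' b, g b := by
  calc ∑' a, f a ≤ ∑' a, g (i a).1 := ENNReal.tsum_le_tsum h
    _ ≤ ∑' p : β × ι, g p.1 := ENNReal.tsum_comp_le_tsum_of_injective hi (fun p : β × ι => g p.1)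
    _ = ∑' b, ∑' _ : ι, g b := ENNReal.tsum_prod (f := fun b (_ : ι) => g b)
    _ = ∑' b, Fintype.card ι * g b := by simp [tsum_fintype, Finset.sum_const]
    _ = _ := ENNReal.tsum_mul_left

/-- The sum of `F` over the vertex lists of mid-edge walks. -/
noncomputable def midSum (H : SimpleGraph V) (F : List V → ℝ≥0∞) : ℝ≥0∞ :=
  ∑' q : {q : List V // IsMid H q}, F q.1

/-- A list determines its walk, so choosing one list for each walk is injective. -/
lemma tsum_midSAW_le_midSum (F : (Σ n, MidSAW H n) → ℝ≥0∞) (F' : List V → ℝ≥0∞)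
    (h : ∀ q (hq : IsMid H q), F ⟨_, hq.toMidSAW⟩ ≤ F' q) :
    ∑' π, F π ≤ midSum H F' := by
  choose q hq hqe using fun π : Σ n, MidSAW H n => exists_isMid π.1 π.2
  have hinj : Function.Injective fun π => (⟨q π, hq π⟩ : {q : List V // IsMid H q}) := by
    intro π π' h
    have h1 : π = _ := hqe π
    have h2 : π' = _ := hqe π'
    rw [h1, h2]
    simp only [Subtype.mk.injEq] at h
    generalize_proofs a b
    revert a b
    rw [h]
    intros; rfl
  calc ∑' π, F π ≤ ∑' π, F' (q π) := by
        refine ENNReal.tsum_le_tsum fun π => ?_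
        have h1 : π = _ := hqe π
        calc F π = F ⟨_, (hq π).toMidSAW⟩ := congrArg F h1
          _ ≤ _ := h _ _
    _ ≤ _ := ENNReal.tsum_comp_le_tsum_of_injective hinj
      (fun p : {q : List V // IsMid H q} => F' p.1)

/-- The factor `2` pays for the walks without vertices, whose single edge can be listed in two
orders. The label in `Bool` records whether the list begins at a chosen end of the first edge; by
`IsMid.ext_of_head` nothing else is lost. -/
lemma midSum_le_tsum_midSAW (F : (Σ n, MidSAW H n) → ℝ≥0∞) (F' : List V → ℝ≥0∞)
    (h : ∀ q (hq : IsMid H q), F' q ≤ F ⟨_, hq.toMidSAW⟩) :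
    midSum H F' ≤ 2 * ∑' π, F π := by
  classical
  have := tsum_le_mul_of_injective (f := fun q : {q : List V // IsMid H q} => F' q.1)
    (g := F) (ι := Bool) (fun q => (⟨_, q.2.toMidSAW⟩,
      decide (q.1.head? = some ((q.2.toMidSAW.first).out.1)))) ?_ (fun q => h _ q.2)
  · simpa [midSum] using this
  · rintro ⟨q, hq⟩ ⟨q', hq'⟩ he
    simp only [Prod.mk.injEq, decide_eq_decide] at he
    obtain ⟨h1, h2⟩ := he
    have key : ∀ p p' : Σ n, MidSAW H n, p = p' → p.2.first = p'.2.first := by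
      rintro p _ rfl; rfl
    have h3 := key _ _ h1
    simp only at h3
    rw [h3] at h2
    refine Subtype.ext (hq.ext_of_head hq' h1 ?_)
    have m1 : ∀ {q : List V} (hq : IsMid H q), ∃ a, q.head? = some a ∧ a ∈ hq.toMidSAW.first := by
      intro q hq
      have := hq.two_le
      refine ⟨q[0], ?_, ?_⟩
      · rw [List.head?_eq_getElem?, List.getElem?_eq_getElem]
      · simp [MidSAW.first, IsMid.toMidSAW]
    obtain ⟨a, ha, ha'⟩ := m1 hq
    obtain ⟨b, hb, hb'⟩ := m1 hq'
    rw [h3] at ha'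
    have ho : hq'.toMidSAW.first = s(hq'.toMidSAW.first.out.1, hq'.toMidSAW.first.out.2) := by
      exact (Quot.out_eq hq'.toMidSAW.first).symm
    rw [ho, Sym2.mem_iff] at ha' hb'
    generalize (Quot.out hq'.toMidSAW.first).1 = x, (Quot.out hq'.toMidSAW.first).2 = y at *
    rw [ha, hb] at h2 ⊢
    simp only [Option.some.injEq] at h2 ⊢
    grind

end MidSAWLists

/-! ### Self-avoiding walks as vertex lists -/

section SawLists

variable {V : Type u}

/-- The vertex lists of the `n`-step self-avoiding walks from `v`. -/
def sawLists (H : SimpleGraph V) (v : V) (n : ℕ) : Set (List V) :=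
  {l | l.Nodup ∧ l.IsChain H.Adj ∧ l.head? = some v ∧ l.length = n + 1}

lemma sawCount_eq_ncard (H : SimpleGraph V) (v : V) (n : ℕ) :
    sawCount H v n = (sawLists H v n).ncard := by
  rw [sawCount, ← Nat.card_coe_set_eq]
  refine Nat.card_congr (Equiv.ofBijective (fun p => ⟨p.1.2.support, ?_, ?_, ?_, ?_⟩) ⟨?_, ?_⟩)
  · exact p.2.1.support_nodup
  · exact p.1.2.isChain_adj_support
  · rw [← SimpleGraph.Walk.cons_tail_support]; rfl
  · rw [SimpleGraph.Walk.length_support, p.2.2]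
  · rintro ⟨⟨t, p⟩, hp⟩ ⟨⟨t', p'⟩, hp'⟩ h
    replace h : p.support = p'.support := congrArg Subtype.val h
    have ht : t = t' := by
      have h1 := p.getLast_support
      have h2 := p'.getLast_support
      rw [← h1, ← h2]
      congr 1
    subst ht
    have := SimpleGraph.Walk.ext_support h
    subst this
    rfl
  · rintro ⟨l, h1, h2, h3, h4⟩
    have hne : l ≠ [] := by rintro rfl; simp at h4
    have hv : l.head hne = v := by
      rw [List.head?_eq_some_head hne] at h3; simpa using h3
    subst hv
    refine ⟨⟨⟨_, SimpleGraph.Walk.ofSupport l hne h2⟩, ?_, ?_⟩, ?_⟩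
    · rw [SimpleGraph.Walk.isPath_def, SimpleGraph.Walk.support_ofSupport]; exact h1
    · rw [SimpleGraph.Walk.length_ofSupport, h4]; rfl
    · simp [SimpleGraph.Walk.support_ofSupport]

end SawLists

/-! ### Growth of the numbers of self-avoiding walks -/

section Growth

variable {V : Type u}

lemma sawLists_finite {H : SimpleGraph V} (hf : ∀ v, (H.neighborSet v).Finite) (v : V) (n : ℕ) :
    (sawLists H v n).Finite := by
  induction n generalizing v with
  | zero =>
    refine (Set.finite_singleton [v]).subset ?_
    rintro l ⟨_, _, h3, h4⟩
    match l, h3, h4 with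
    | [a], h3, _ => simpa using h3
  | succ n ih =>
    refine ((hf v).biUnion fun w _ => (ih w).image (List.cons v)).subset ?_
    rintro l ⟨h1, h2, h3, h4⟩
    match l, h1, h2, h3, h4 with
    | a :: b :: t, h1, h2, h3, h4 =>
      obtain rfl : a = v := by simpa using h3
      rw [List.isChain_cons_cons] at h2
      rw [List.nodup_cons] at h1
      simp only [Set.mem_iUnion]
      exact ⟨b, h2.1, b :: t, ⟨h1.2, h2.2, rfl, by simpa using h4⟩, rfl⟩

/-- Cut a walk after `m` steps. The second piece starts wherever the first one ends, hence the bound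
`B` over all starting points. -/
lemma sawCount_add_le {H : SimpleGraph V} (hf : ∀ v, (H.neighborSet v).Finite) (v : V) (m n : ℕ)
    (B : ℝ) (hB : ∀ u, (sawCount H u n : ℝ) ≤ B) :
    (sawCount H v (m + n) : ℝ) ≤ sawCount H v m * B := by
  classical
  set F : V → ℕ → Finset (List V) := fun v n => (sawLists_finite hf v n).toFinset with hF
  have hcard : ∀ v n, sawCount H v n = (F v n).card := fun v n => by
    rw [sawCount_eq_ncard, Set.ncard_eq_toFinset_card _ (sawLists_finite hf v n)]
  have hsub : F v (m + n) ⊆ (F v m).biUnion fun p => (F (p.getLastD v) n).image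
      fun l => p ++ l.tail := by
    intro l hl
    rw [hF, Set.Finite.mem_toFinset] at hl
    obtain ⟨h1, h2, h3, h4⟩ := hl
    have hlast : (l.take (m + 1)).getLastD v = l[m] := by
      rw [List.getLastD_eq_getLast?, List.getLast?_eq_getElem?]
      simp [h4, show m + 1 ≤ m + n + 1 by omega]
    simp only [Finset.mem_biUnion, Finset.mem_image, hF, Set.Finite.mem_toFinset]
    refine ⟨l.take (m + 1), ⟨h1.sublist (List.take_sublist _ _), h2.take _, ?_, ?_⟩,
      l.drop m, ⟨h1.sublist (List.drop_sublist _ _), h2.drop _, ?_, ?_⟩, ?_⟩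
    · simpa [List.head?_take] using h3
    · simp; omega
    · rw [hlast, List.head?_drop, List.getElem?_eq_getElem]
    · simp; omega
    · rw [List.tail_drop, List.take_append_drop]
  have h1 : (sawCount H v (m + n) : ℝ) ≤
      ∑ p ∈ F v m, ((F (p.getLastD v) n).image fun l => p ++ l.tail).card := by
    rw [hcard]
    exact_mod_cast (Finset.card_le_card hsub).trans Finset.card_biUnion_le
  refine h1.trans ?_
  push_cast
  calc _ ≤ ∑ p ∈ F v m, B := Finset.sum_le_sum fun p _ => by
        refine le_trans ?_ (hB (p.getLastD v))
        rw [hcard]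
        exact_mod_cast Finset.card_image_le
    _ = _ := by rw [Finset.sum_const, hcard, nsmul_eq_mul]

/-- A walk from `u` that avoids `v` can be prolonged backwards by the step from `v` to `u`. One that
meets `v` at time `k` splits there into two walks from `v`, the first of them reversed. -/
lemma sawCount_le_of_adj {H : SimpleGraph V} (hf : ∀ v, (H.neighborSet v).Finite) {u v : V}
    (huv : H.Adj u v) (N : ℕ) :
    sawCount H u N ≤ sawCount H v (N + 1) +
      ∑ k ∈ Finset.range (N + 1), sawCount H v k * sawCount H v (N - k) := by
  classical
  set F : V → ℕ → Finset (List V) := fun v n => (sawLists_finite hf v n).toFinset with hF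
  have hcard : ∀ v n, sawCount H v n = (F v n).card := fun v n => by
    rw [sawCount_eq_ncard, Set.ncard_eq_toFinset_card _ (sawLists_finite hf v n)]
  have hsub : F u N ⊆ (F v (N + 1)).image List.tail ∪ (Finset.range (N + 1)).biUnion fun k =>
      (F v k ×ˢ F v (N - k)).image fun p => p.1.reverse ++ p.2.tail := by
    intro l hl
    rw [hF, Set.Finite.mem_toFinset] at hl
    obtain ⟨h1, h2, h3, h4⟩ := hl
    simp only [Finset.mem_union, Finset.mem_biUnion, Finset.mem_image, hF,
      Set.Finite.mem_toFinset, Finset.mem_product]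
    by_cases hv : v ∈ l
    · right
      obtain ⟨k, hk, rfl⟩ := List.getElem_of_mem hv
      refine ⟨k, by simp; omega, ((l.take (k + 1)).reverse, l.drop k), ⟨⟨?_, ?_, ?_, ?_⟩,
        h1.sublist (List.drop_sublist _ _), h2.drop _, ?_, ?_⟩, ?_⟩
      · exact List.nodup_reverse.2 (h1.sublist (List.take_sublist _ _))
      · rw [List.isChain_reverse]
        exact (h2.take _).imp fun a b h => h.symm
      · rw [List.head?_reverse, List.getLast?_eq_getElem?]
        simp [show min (k + 1) l.length = k + 1 by omega]
      · simp; omega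
      · rw [List.head?_drop, List.getElem?_eq_getElem]
      · simp; omega
      · simp only [List.reverse_reverse]
        rw [List.tail_drop, List.take_append_drop]
    · left
      refine ⟨v :: l, ⟨List.nodup_cons.2 ⟨hv, h1⟩, ?_, rfl, by simp [h4]⟩, rfl⟩
      match l, h2, h3 with
      | a :: t, h2, h3 =>
        obtain rfl : a = u := by simpa using h3
        exact List.isChain_cons_cons.2 ⟨huv.symm, h2⟩
  calc sawCount H u N ≤ _ := by rw [hcard]; exact Finset.card_le_card hsub
    _ ≤ _ := Finset.card_union_le _ _
    _ ≤ _ := by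
      refine add_le_add ?_ (Finset.card_biUnion_le.trans (Finset.sum_le_sum fun k _ => ?_))
      · rw [hcard]; exact Finset.card_image_le
      · rw [hcard, hcard, ← Finset.card_product]; exact Finset.card_image_le

/-- An upper bound, uniform in the starting point, for the exponential growth of walks. -/
def UpperGrowth (H : SimpleGraph V) (μ : ℝ) : Prop :=
  ∀ l, μ < l → ∃ C, 0 < C ∧ ∀ v n, (sawCount H v n : ℝ) ≤ C * l ^ n

/-- A lower bound for the exponential growth of a sequence. -/
def LowerGrowth (a : ℕ → ℕ) (μ : ℝ) : Prop :=
  ∀ l, 0 < l → l < μ → ∃ c, 0 < c ∧ ∀ n, c * l ^ n ≤ (a n : ℝ)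

lemma tendsto_const_rpow_inv {c : ℝ} (hc : 0 < c) :
    Tendsto (fun n : ℕ => c ^ (1 / (n : ℝ))) atTop (𝓝 1) := by
  have := (Real.continuousAt_const_rpow (a := c) (b := 0) hc.ne').tendsto
  rw [Real.rpow_zero] at this
  exact this.comp tendsto_one_div_atTop_nhds_zero_nat

lemma tendsto_root_of_growth {a : ℕ → ℕ} {μ : ℝ} (hμ : 0 < μ)
    (hu : ∀ l, μ < l → ∃ C, 0 < C ∧ ∀ n, (a n : ℝ) ≤ C * l ^ n) (hl : LowerGrowth a μ) :
    Tendsto (fun n : ℕ => (a n : ℝ) ^ (1 / (n : ℝ))) atTop (𝓝 μ) := by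
  have key : ∀ C l : ℝ, 0 < C → 0 < l → ∀ n : ℕ, n ≠ 0 →
      (C * l ^ n) ^ (1 / (n : ℝ)) = C ^ (1 / (n : ℝ)) * l := by
    intro C l hC hl n hn
    rw [Real.mul_rpow hC.le (by positivity), one_div, Real.pow_rpow_inv_natCast hl.le hn]
  have lim : ∀ C l : ℝ, 0 < C → Tendsto (fun n : ℕ => C ^ (1 / (n : ℝ)) * l) atTop (𝓝 l) := by
    intro C l hC
    simpa using (tendsto_const_rpow_inv hC).mul_const l
  rw [tendsto_order]
  refine ⟨fun b hb => ?_, fun b hb => ?_⟩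
  · obtain ⟨l, hl1, hl2⟩ := exists_between (max_lt hb hμ)
    have hl0 : 0 < l := (le_max_right _ _).trans_lt hl1
    obtain ⟨c, hc, h⟩ := hl l hl0 hl2
    filter_upwards [(tendsto_order.1 (lim c l hc)).1 b ((le_max_left _ _).trans_lt hl1),
      eventually_ne_atTop 0] with n hn hn0
    rw [← key c l hc hl0 n hn0] at hn
    exact hn.trans_le (Real.rpow_le_rpow (by positivity) (h n) (by positivity))
  · obtain ⟨l, hl1, hl2⟩ := exists_between hb
    have hl0 : 0 < l := hμ.trans hl1
    obtain ⟨c, hc, h⟩ := hu l hl1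
    filter_upwards [(tendsto_order.1 (lim c l hc)).2 b hl2, eventually_ne_atTop 0] with n hn hn0
    rw [← key c l hc hl0 n hn0] at hn
    exact (Real.rpow_le_rpow (by positivity) (h n) (by positivity)).trans_lt hn

lemma exists_mul_pow_gt {l μ : ℝ} (h : l < μ) (K : ℕ) :
    ∃ t, 0 < t ∧ t < 1 ∧ l < μ * t ^ K := by
  have h1 : Tendsto (fun t : ℝ => μ * t ^ K) (𝓝[<] 1) (𝓝 μ) := by
    have : ContinuousAt (fun t : ℝ => μ * t ^ K) 1 := by fun_prop
    have := this.tendsto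
    simp only [one_pow, mul_one] at this
    exact this.mono_left nhdsWithin_le_nhds
  obtain ⟨t, ht1, ht2⟩ := (((tendsto_order.1 h1).1 l h).and
    (Ioo_mem_nhdsLT (show (0 : ℝ) < 1 by norm_num))).exists
  exact ⟨t, ht2.1, ht2.2, ht1⟩

/-- A lower bound along a sequence of indices with bounded ratios suffices. -/
lemma lowerGrowth_of_frequent {H : SimpleGraph V} (hf : ∀ v, (H.neighborSet v).Finite) {μ : ℝ}
    (hμ : 0 < μ) (hu : UpperGrowth H μ) (v : V) (K : ℕ)
    (h : ∀ l, 0 < l → l < μ → ∃ c, 0 < c ∧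
      ∀ m, ∃ N, m ≤ N ∧ N ≤ K * (m + 1) ∧ c * l ^ N ≤ (sawCount H v N : ℝ)) :
    LowerGrowth (sawCount H v) μ := by
  intro l hl hlμ
  -- By submultiplicativity the lower bound at `N` passes down to `m ≤ N`. With growth rates `μ * t`
  -- below and `μ / t` above, the loss is at most `t ^ (2 * N)`; as `N ≤ K * (m + 1)`, it fits in
  -- the gap between `l` and `μ * t ^ (2 * K)`.
  obtain ⟨t, ht0, ht1, ht⟩ := exists_mul_pow_gt hlμ (2 * K)
  obtain ⟨C, hC, hC'⟩ := hu (μ / t) (by rw [lt_div_iff₀ ht0]; nlinarith)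
  obtain ⟨c, hc, hc'⟩ := h (μ * t) (by positivity) (by nlinarith)
  refine ⟨c * t ^ (2 * K) / C, by positivity, fun m => ?_⟩
  obtain ⟨N, hN1, hN2, hN⟩ := hc' m
  obtain ⟨r, rfl⟩ := Nat.exists_eq_add_of_le hN1
  have h1 := sawCount_add_le hf v m r _ fun u => hC' u r
  have h2 : c * (μ * t) ^ (m + r) ≤ sawCount H v m * (C * (μ / t) ^ r) := hN.trans h1
  have h3 : c * t ^ (2 * (m + r)) * μ ^ m ≤ sawCount H v m * C := by
    have hpos : 0 < (μ / t) ^ r := by positivity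
    rw [← mul_le_mul_iff_left₀ hpos]
    have e : c * t ^ (2 * (m + r)) * μ ^ m * (μ / t) ^ r = c * (μ * t) ^ (m + r) * t ^ m := by
      rw [div_pow, pow_mul, pow_add, pow_add, mul_pow, mul_pow, ← pow_mul, ← pow_mul]
      field_simp
      ring
    rw [e]
    have : t ^ m ≤ 1 := pow_le_one₀ ht0.le ht1.le
    calc _ ≤ c * (μ * t) ^ (m + r) * 1 := by gcongr
      _ ≤ _ := by rw [mul_one]; linarith
  have h4 : c * t ^ (2 * (K * (m + 1))) * μ ^ m ≤ sawCount H v m * C := by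
    refine le_trans ?_ h3
    gcongr c * ?_ * _
    exact pow_le_pow_of_le_one ht0.le ht1.le (by omega)
  rw [div_mul_eq_mul_div, div_le_iff₀ hC]
  refine le_trans ?_ h4
  have : l ^ m ≤ (μ * t ^ (2 * K)) ^ m := by gcongr
  calc c * t ^ (2 * K) * l ^ m ≤ c * t ^ (2 * K) * (μ * t ^ (2 * K)) ^ m := by gcongr
    _ = _ := by ring

/-- Bernoulli's inequality. The factor `2 * m + 2` is the number of terms in `sawCount_le_of_adj`
for `N = 2 * m`. -/
lemma exists_mul_le_pow {r : ℝ} (hr : 1 < r) : ∃ c, 0 < c ∧ ∀ m : ℕ, c * (2 * m + 2) ≤ r ^ m := by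
  refine ⟨min 1 (r - 1) / 2, by have := sub_pos.2 hr; positivity, fun m => ?_⟩
  have h1 := one_add_mul_le_pow (a := r - 1) (by linarith) m
  have h2 := min_le_left 1 (r - 1)
  have h3 := min_le_right 1 (r - 1)
  have : (0 : ℝ) ≤ m := by positivity
  have e : 1 + (r - 1) = r := by ring
  rw [e] at h1
  nlinarith

/-- In every term of `sawCount_le_of_adj` for `N = 2 * m`, one of the walks from `v` has at least
`m` steps. Its first `m` steps give the factor `sawCount H v m`, and what remains is bounded by the
uniform growth. -/
lemma sawCount_two_mul_le {H : SimpleGraph V} (hf : ∀ v, (H.neighborSet v).Finite) {C l : ℝ}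
    (hC : 1 ≤ C) (hl : 1 ≤ l) (h : ∀ v n, (sawCount H v n : ℝ) ≤ C * l ^ n) {u v : V}
    (huv : u = v ∨ H.Adj u v) (m : ℕ) :
    (sawCount H u (2 * m) : ℝ) ≤ sawCount H v m * (C ^ 2 * l * l ^ m) * (2 * m + 2) := by
  have hσ : (0 : ℝ) ≤ sawCount H v m := by positivity
  have hle : ∀ n, m ≤ n → (sawCount H v n : ℝ) ≤ sawCount H v m * (C * l ^ (n - m)) := by
    intro n hn
    obtain ⟨r, rfl⟩ := Nat.exists_eq_add_of_le hn
    simpa using sawCount_add_le hf v m r _ fun u => h u r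
  have hCC : C ≤ C ^ 2 := by nlinarith
  have hlp : 1 ≤ l ^ m := one_le_pow₀ hl
  rcases huv with rfl | huv
  · refine (hle (2 * m) (by omega)).trans ?_
    rw [show 2 * m - m = m by omega, mul_assoc (sawCount H u m : ℝ)]
    gcongr ?_ * ?_
    calc C * l ^ m ≤ C ^ 2 * l ^ m := by gcongr
      _ ≤ C ^ 2 * l * l ^ m * 1 := by
        rw [mul_one, mul_assoc, mul_comm l, ← mul_assoc]
        exact le_mul_of_one_le_right (by positivity) hl
      _ ≤ _ := by gcongr; have : (0 : ℝ) ≤ m := by positivity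
                  linarith
  · have h1 : (sawCount H u (2 * m) : ℝ) ≤ sawCount H v (2 * m + 1) +
        ∑ k ∈ Finset.range (2 * m + 1), sawCount H v k * sawCount H v (2 * m - k) := by
      exact_mod_cast sawCount_le_of_adj hf huv (2 * m)
    have h2 : (sawCount H v (2 * m + 1) : ℝ) ≤ sawCount H v m * (C ^ 2 * l * l ^ m) := by
      refine (hle _ (by omega)).trans ?_
      rw [show 2 * m + 1 - m = m + 1 by omega, pow_succ, mul_assoc (C ^ 2), mul_comm l]
      gcongr
    have h3 : ∀ k ∈ Finset.range (2 * m + 1), (sawCount H v k * sawCount H v (2 * m - k) : ℝ) ≤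
        sawCount H v m * (C ^ 2 * l * l ^ m) := by
      intro k hk
      have hk' : k ≤ 2 * m := by simpa [Nat.lt_succ_iff] using hk
      have key : ∀ i j, i + j = 2 * m → m ≤ i → (sawCount H v i * sawCount H v j : ℝ) ≤
          sawCount H v m * (C ^ 2 * l * l ^ m) := by
        intro i j hij hi
        calc (sawCount H v i * sawCount H v j : ℝ)
            ≤ sawCount H v m * (C * l ^ (i - m)) * (C * l ^ j) :=
              mul_le_mul (hle i hi) (h v j) (by positivity) (by positivity)
          _ = sawCount H v m * (C ^ 2 * (l ^ (i - m) * l ^ j)) := by ring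
          _ = sawCount H v m * (C ^ 2 * l ^ m) := by
              rw [← pow_add, show i - m + j = m by omega]
          _ ≤ sawCount H v m * (C ^ 2 * l * l ^ m) := by
              gcongr
              exact le_mul_of_one_le_right (by positivity) hl
      rcases le_total m k with hmk | hmk
      · exact key _ _ (by omega) hmk
      · rw [mul_comm (sawCount H v k : ℝ)]
        exact key _ _ (by omega) (by omega)
    have h4 := Finset.sum_le_sum h3
    rw [Finset.sum_const, Finset.card_range, nsmul_eq_mul] at h4
    push_cast at h1 h4
    nlinarith

section QuasiTransitive

variable {G : SimpleGraph V}

lemma sawCount_iso {V' : Type*} {G' : SimpleGraph V'} (α : G ≃g G') (v : V) (n : ℕ) :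
    sawCount G' (α v) n = sawCount G v n := by
  rw [sawCount_eq_ncard, sawCount_eq_ncard]
  have : sawLists G' (α v) n = List.map α '' sawLists G v n := by
    ext l
    constructor
    · rintro ⟨h1, h2, h3, h4⟩
      refine ⟨l.map α.symm, ⟨h1.map α.symm.injective, ?_, ?_, by simpa using h4⟩, ?_⟩
      · rw [List.isChain_map]
        exact h2.imp fun a b h => α.symm.map_adj_iff.2 h
      · simp [List.head?_map, h3]
      · simp [List.map_map, Function.comp_def]
    · rintro ⟨l, ⟨h1, h2, h3, h4⟩, rfl⟩
      refine ⟨h1.map α.injective, ?_, by simp [List.head?_map, h3], by simpa using h4⟩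
      rw [List.isChain_map]
      exact h2.imp fun a b h => α.map_adj_iff.2 h
  rw [this, Set.ncard_image_of_injective]
  exact List.map_injective_iff.2 α.injective

lemma exists_sawList_of_walk {u v : V} (hc : G.Connected) :
    ∃ l ∈ sawLists G u (G.dist u v), l.getLast? = some v := by
  obtain ⟨p, hp, hl⟩ := hc.exists_path_of_dist u v
  refine ⟨p.support, ⟨hp.support_nodup, p.isChain_adj_support, ?_, ?_⟩, ?_⟩
  · rw [← SimpleGraph.Walk.cons_tail_support]; rfl
  · rw [SimpleGraph.Walk.length_support, hl]
  · rw [List.getLast?_eq_some_getLast p.support_ne_nil, p.getLast_support]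

lemma finite_ball (hf : ∀ v, (G.neighborSet v).Finite) (hc : G.Connected) (v : V) (n : ℕ) :
    {w | G.dist v w ≤ n}.Finite := by
  have : {w | G.dist v w ≤ n} ⊆
      ⋃ k ∈ Finset.range (n + 1), (fun l : List V => l.getLastD v) '' sawLists G v k := by
    intro w hw
    obtain ⟨l, hl, hlw⟩ := exists_sawList_of_walk (u := v) (v := w) hc
    simp only [Set.mem_iUnion]
    refine ⟨_, by simpa [Nat.lt_succ_iff] using hw, l, hl, ?_⟩
    simp [List.getLastD_eq_getLast?, hlw]
  exact (Set.Finite.biUnion (Finset.finite_toSet _) fun k _ =>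
    (sawLists_finite hf v k).image _).subset this

lemma exists_dist_gt [Infinite V] (hf : ∀ v, (G.neighborSet v).Finite) (hc : G.Connected) (v : V)
    (n : ℕ) : ∃ w, n < G.dist v w := by
  by_contra! h
  exact Set.infinite_univ ((finite_ball hf hc v n).subset fun w _ => h w)

lemma one_le_sawCount [Infinite V] (hf : ∀ v, (G.neighborSet v).Finite) (hc : G.Connected) (v : V)
    (n : ℕ) : 1 ≤ sawCount G v n := by
  obtain ⟨w, hw⟩ := exists_dist_gt hf hc v n
  obtain ⟨l, ⟨h1, h2, h3, h4⟩, -⟩ := exists_sawList_of_walk (u := v) (v := w) hc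
  rw [sawCount_eq_ncard, Nat.one_le_iff_ne_zero]
  refine Set.ncard_ne_zero_of_mem (a := l.take (n + 1)) ?_ (sawLists_finite hf v n)
  exact ⟨h1.sublist (List.take_sublist _ _), h2.take _,
      by simpa [List.head?_take] using h3, by simp; omega⟩

/-- A vertex that is within bounded distance of a near-maximizer at every length has itself
the maximal growth. -/
lemma lowerGrowth_of_near (hf : ∀ v, (G.neighborSet v).Finite) (hconn : G.Connected) {μ : ℝ}
    (hμ1 : 1 ≤ μ) (hup : UpperGrowth G μ) (v : V) (D : ℕ)
    (hD : ∀ m, ∃ u, G.dist u v ≤ D ∧ μ ^ m ≤ (sawCount G u m : ℝ)) :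
    LowerGrowth (sawCount G v) μ := by
  have hμ0 : 0 < μ := by linarith
  -- The near-maximizer, which may depend on `m`, is moved towards `v` one edge at a time. Every
  -- move halves the length, since a bound at `2 * m` is turned into one at `m`, but keeps the
  -- exponential rate up to an arbitrarily small loss.
  have main : ∀ j ≤ D, ∀ l, 0 < l → l < μ → ∃ c, 0 < c ∧ ∀ m, ∃ u, G.dist u v ≤ D - j ∧
      c * l ^ m ≤ (sawCount G u m : ℝ) := by
    intro j
    induction j with
    | zero =>
      intro _ l hl hlμ
      refine ⟨1, one_pos, fun m => ?_⟩
      obtain ⟨u, hu, h⟩ := hD m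
      refine ⟨u, hu, ?_⟩
      rw [one_mul]
      exact (pow_le_pow_left₀ hl.le hlμ.le m).trans h
    | succ j ih =>
      intro hj l hl hlμ
      -- The exponent `3` comes from `(μ * t) ^ 2 / (μ / t) = μ * t ^ 3`: the rate at `2 * m`
      -- divided by the uniform upper rate. The ratio of `μ * t ^ 3` to `l` then absorbs the factor
      -- `2 * m + 2`.
      obtain ⟨t, ht0, ht1, ht⟩ := exists_mul_pow_gt hlμ 3
      obtain ⟨C, hC, hC'⟩ := hup (μ / t) (by rw [lt_div_iff₀ ht0]; nlinarith)
      obtain ⟨c, hc, hc'⟩ := ih (by omega) (μ * t) (by positivity) (by nlinarith)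
      have hl1 : 1 ≤ μ / t := by rw [one_le_div ht0]; linarith
      have hCu : ∀ v n, (sawCount G v n : ℝ) ≤ max C 1 * (μ / t) ^ n := fun v n =>
        (hC' v n).trans (by gcongr; exact le_max_left _ _)
      obtain ⟨d, hd, hd'⟩ := exists_mul_le_pow (r := μ * t ^ 3 / l) (by rwa [one_lt_div hl])
      have hCm : (0 : ℝ) < max C 1 := by positivity
      refine ⟨c * d / (max C 1 ^ 2 * (μ / t)), by positivity, fun m => ?_⟩
      obtain ⟨u, hu, hcu⟩ := hc' (2 * m)
      obtain ⟨u', hu', hu''⟩ : ∃ u', G.dist u' v ≤ D - (j + 1) ∧ (u = u' ∨ G.Adj u u') := by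
        obtain ⟨p, hp⟩ := hconn.exists_walk_length_eq_dist u v
        cases p with
        | nil => exact ⟨v, by simp, Or.inl rfl⟩
        | cons h q =>
          refine ⟨_, ?_, Or.inr h⟩
          have := G.dist_le q
          simp only [SimpleGraph.Walk.length_cons] at hp
          omega
      refine ⟨u', hu', ?_⟩
      have h1 := sawCount_two_mul_le hf (le_max_right C 1) hl1 hCu hu'' m
      have h2 := hcu.trans h1
      have h3 := hd' m
      rw [div_mul_eq_mul_div, div_le_iff₀ (by positivity)]
      have hp : 0 < (μ / t) ^ m * (2 * m + 2) := by positivity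
      rw [← mul_le_mul_iff_left₀ hp]
      calc c * d * l ^ m * ((μ / t) ^ m * (2 * m + 2))
          = c * ((d * (2 * m + 2)) * (l ^ m * (μ / t) ^ m)) := by ring
        _ ≤ c * ((μ * t ^ 3 / l) ^ m * (l ^ m * (μ / t) ^ m)) := by gcongr
        _ = c * (μ * t) ^ (2 * m) := by
            rw [← mul_pow, ← mul_pow, pow_mul]
            congr 2
            field_simp
        _ ≤ _ := h2
        _ = _ := by ring
  intro l hl hlμ
  obtain ⟨c, hc, h⟩ := main D le_rfl l hl hlμ
  refine ⟨c, hc, fun m => ?_⟩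
  obtain ⟨u, hu, h'⟩ := h m
  rw [Nat.sub_self, Nat.le_zero, hconn.dist_eq_zero_iff] at hu
  exact hu ▸ h'

lemma exists_le_mul_pow {M : ℕ → ℕ} {l : ℝ} (hl0 : 0 < l)
    (h : ∀ᶠ n : ℕ in atTop, (M n : ℝ) ≤ l ^ n) : ∃ C, 0 < C ∧ ∀ n, (M n : ℝ) ≤ C * l ^ n := by
  obtain ⟨N, hN⟩ := eventually_atTop.1 h
  refine ⟨1 + ∑ k ∈ Finset.range N, M k / l ^ k, by positivity, fun n => ?_⟩
  rw [add_mul, one_mul]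
  rcases lt_or_ge n N with hnN | hnN
  · have : (M n : ℝ) / l ^ n ≤ ∑ k ∈ Finset.range N, M k / l ^ k :=
      Finset.single_le_sum (f := fun k => (M k : ℝ) / l ^ k) (fun k _ => by positivity)
        (Finset.mem_range.2 hnN)
    have h3 : (M n : ℝ) = M n / l ^ n * l ^ n := by field_simp
    have h4 : 0 < l ^ n := by positivity
    nlinarith
  · have h3 := hN n hnN
    have : 0 ≤ (∑ k ∈ Finset.range N, M k / l ^ k) * l ^ n := by positivity
    linarith

/-- Hammersley's theorem for quasi-transitive graphs. -/
theorem exists_growth [Infinite V] (hf : ∀ v, (G.neighborSet v).Finite) (hc : G.Connected)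
    {W : Set V} (hW : W.Finite) (hWα : ∀ v, ∃ α : G ≃g G, α v ∈ W) :
    ∃ μ : ℝ, 1 ≤ μ ∧ UpperGrowth G μ ∧ ∀ v, LowerGrowth (sawCount G v) μ := by
  classical
  -- A maximum over the finite set `W`, which by the automorphisms is the maximum over all vertices.
  -- This makes `log M` subadditive, and Fekete's lemma applies.
  set M : ℕ → ℕ := fun n => hW.toFinset.sup fun v => sawCount G v n with hM
  have hle : ∀ v n, sawCount G v n ≤ M n := by
    intro v n
    obtain ⟨α, hα⟩ := hWα v
    rw [← sawCount_iso α]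
    exact Finset.le_sup (f := fun v => sawCount G v n) (hW.mem_toFinset.2 hα)
  have hne : hW.toFinset.Nonempty := by
    obtain ⟨α, hα⟩ := hWα hc.nonempty.some
    exact ⟨_, hW.mem_toFinset.2 hα⟩
  have hex : ∀ n, ∃ v ∈ W, M n = sawCount G v n := by
    intro n
    obtain ⟨v, hv, h⟩ := Finset.exists_mem_eq_sup _ hne fun v => sawCount G v n
    exact ⟨v, hW.mem_toFinset.1 hv, h⟩
  have hM1 : ∀ n, 1 ≤ M n := fun n => (one_le_sawCount hf hc hne.choose n).trans (hle _ _)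
  have hMpos : ∀ n, (0 : ℝ) < M n := fun n => by exact_mod_cast hM1 n
  have hsub : Subadditive fun n => Real.log (M n) := by
    intro m n
    rw [← Real.log_mul (hMpos m).ne' (hMpos n).ne']
    refine Real.log_le_log (hMpos _) ?_
    obtain ⟨v, -, hv⟩ := hex (m + n)
    rw [hv]
    refine (sawCount_add_le hf v m n (M n) fun u => by exact_mod_cast hle u n).trans ?_
    gcongr
    exact hle v m
  have hnn : ∀ n, 0 ≤ Real.log (M n) := fun n => Real.log_nonneg (by exact_mod_cast hM1 n)
  have hbdd : BddBelow (range fun n : ℕ => Real.log (M n) / n) :=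
    ⟨0, by rintro _ ⟨n, rfl⟩; exact div_nonneg (hnn n) (by positivity)⟩
  have hlim := hsub.tendsto_lim hbdd
  have hL0 : 0 ≤ hsub.lim := ge_of_tendsto' hlim fun n => div_nonneg (hnn n) (by positivity)
  have hMge : ∀ n, Real.exp hsub.lim ^ n ≤ M n := by
    intro n
    rcases Nat.eq_zero_or_pos n with rfl | hn
    · simpa using hM1 0
    · have := hsub.lim_le_div hbdd hn.ne'
      rw [le_div_iff₀ (by positivity)] at this
      rw [← Real.exp_nat_mul, ← Real.le_log_iff_exp_le (hMpos n)]
      linarith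
  have hup : UpperGrowth G (Real.exp hsub.lim) := by
    intro l hl
    have hl0 : 0 < l := (Real.exp_pos _).trans hl
    have h1 : ∀ᶠ n : ℕ in atTop, (M n : ℝ) ≤ l ^ n := by
      filter_upwards [(tendsto_order.1 hlim).2 (Real.log l)
        ((Real.lt_log_iff_exp_lt hl0).2 hl), eventually_gt_atTop 0] with n hn hn0
      rw [div_lt_iff₀ (by positivity)] at hn
      rw [← Real.log_le_log_iff (hMpos n) (by positivity), Real.log_pow]
      linarith
    obtain ⟨C, hC, h2⟩ := exists_le_mul_pow hl0 h1
    exact ⟨C, hC, fun v n => le_trans (by exact_mod_cast hle v n) (h2 n)⟩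
  have hμ1 : 1 ≤ Real.exp hsub.lim := Real.one_le_exp hL0
  refine ⟨Real.exp hsub.lim, hμ1, hup, fun v => ?_⟩
  -- For every length some maximizer lies in `W`, hence within a fixed distance of `v`.
  refine lowerGrowth_of_near hf hc hμ1 hup v (hW.toFinset.sup fun w => G.dist w v) fun m => ?_
  obtain ⟨u, hu, h⟩ := hex m
  exact ⟨u, Finset.le_sup (f := fun w => G.dist w v) (hW.mem_toFinset.2 hu), h ▸ hMge m⟩

lemma isConnectiveConstant_of_growth {μ : ℝ} (hμ : 0 < μ) (hu : UpperGrowth G μ)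
    (hl : ∀ v, LowerGrowth (sawCount G v) μ) : IsConnectiveConstant G μ := fun v =>
  tendsto_root_of_growth hμ (fun l h => by
    obtain ⟨C, hC, h⟩ := hu l h
    exact ⟨C, hC, h v⟩) (hl v)

end QuasiTransitive

end Growth

/-! ### Replacing the vertices of a graph by finite connected graphs -/

/-- `H` is obtained from `G` by replacing every vertex `v` by a connected graph on at most `K`
vertices, the fiber of `v`; the edge from `v` to `w` is attached to the vertex `port v w` of the
fiber of `v`. No two disjoint walks traverse the same fiber. -/
structure Decoration {V T : Type*} (G : SimpleGraph V) (χ : V → Bool) (H : SimpleGraph T)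
    (K : ℕ) where
  pr : T → V
  port : V → V → T
  code : T → Fin K
  color : ∀ {v w}, G.Adj v w → χ w = !χ v
  pr_port : ∀ v w, pr (port v w) = v
  code_inj : ∀ {p q}, pr p = pr q → code p = code q → p = q
  adj_port : ∀ {v w}, G.Adj v w → H.Adj (port v w) (port w v)
  cross : ∀ {p q}, H.Adj p q → pr p ≠ pr q →
    G.Adj (pr p) (pr q) ∧ p = port (pr p) (pr q) ∧ q = port (pr q) (pr p)
  conn : ∀ p q, pr p = pr q → ∃ P : List T, P.Nodup ∧ P.IsChain H.Adj ∧
    (∀ x ∈ P, pr x = pr p) ∧ P.head? = some p ∧ P.getLast? = some q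
  meet : ∀ {v a b c d}, G.Adj v a → G.Adj v b → G.Adj v c → G.Adj v d → a ≠ b → c ≠ d →
    port v a = port v c ∨ port v a = port v d ∨ port v b = port v c ∨ port v b = port v d

namespace Decoration

variable {V T : Type*} {G : SimpleGraph V} {χ : V → Bool} {H : SimpleGraph T} {K : ℕ}
  (D : Decoration G χ H K)

/-- Walks inside a fiber are recorded as words over `Fin K`, the same alphabet for all fibers. This
keeps the counts of such walks uniform over the graph. -/
lemma map_code_injOn (v : V) : Set.InjOn (List.map D.code) {P | ∀ p ∈ P, D.pr p = v} := by
  intro P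
  induction P with
  | nil => intro _ Q _ h; simpa [eq_comm] using h
  | cons p P ih =>
    intro hP Q hQ h
    match Q, hQ, h with
    | q :: Q, hQ, h =>
      simp only [Set.mem_ofPred_eq, List.mem_cons, forall_eq_or_imp] at hP hQ
      simp only [List.map_cons, List.cons.injEq] at h
      rw [D.code_inj (hP.1.trans hQ.1.symm) h.1, ih hP.2 hQ.2 h.2]

lemma length_le_of_nodup {v : V} {P : List T} (hP : ∀ p ∈ P, D.pr p = v) (hn : P.Nodup) :
    P.length ≤ K := by
  have : (P.map D.code).Nodup := hn.map_on fun p hp q hq h =>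
    D.code_inj ((hP p hp).trans (hP q hq).symm) h
  simpa using this.length_le_card

lemma finite_fiberLists (v : V) (n : ℕ) :
    {P : List T | (∀ p ∈ P, D.pr p = v) ∧ P.length ≤ n}.Finite := by
  refine Set.Finite.of_finite_image ((List.finite_length_le (Fin K) n).subset ?_)
    ((D.map_code_injOn v).mono fun P hP => hP.1)
  rintro _ ⟨P, hP, rfl⟩
  simpa using hP.2

/-- The self-avoiding walks that traverse the fiber of `v`, from the port of `a` to that
of `b`. -/
def segSet (v a b : V) : Set (List T) :=
  {P | P.Nodup ∧ P.IsChain H.Adj ∧ (∀ p ∈ P, D.pr p = v) ∧ P.head? = some (D.port v a) ∧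
    P.getLast? = some (D.port v b)}

lemma finite_segSet (v a b : V) : (D.segSet v a b).Finite :=
  (D.finite_fiberLists v K).subset fun _ hP => ⟨hP.2.2.1, D.length_le_of_nodup hP.2.2.1 hP.1⟩

/-- The walks of `segSet`, as a finset. -/
noncomputable def seg (v a b : V) : Finset (List T) := (D.finite_segSet v a b).toFinset

lemma mem_seg {v a b : V} {P : List T} : P ∈ D.seg v a b ↔ P ∈ D.segSet v a b :=
  Set.Finite.mem_toFinset _

lemma port_mem_left {v a b : V} {P : List T} (h : P ∈ D.seg v a b) : D.port v a ∈ P :=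
  List.mem_of_head? (D.mem_seg.1 h).2.2.2.1

lemma port_mem_right {v a b : V} {P : List T} (h : P ∈ D.seg v a b) : D.port v b ∈ P :=
  List.mem_of_getLast? (D.mem_seg.1 h).2.2.2.2

open Classical in
/-- The walks of `H` over the walk `t` of `G` that are entered from the vertex `u`, traverse all
fibers but the last one, and stop upon entering the last one. -/
noncomputable def lifts : V → List V → Finset (List T)
  | _, [] => ∅
  | u, [z] => {[D.port z u]}
  | u, v :: w :: t => (D.seg v u w ×ˢ lifts v (w :: t)).image fun p => p.1 ++ p.2

lemma mem_lifts_singleton {u z : V} {L : List T} : L ∈ D.lifts u [z] ↔ L = [D.port z u] := by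
  simp [lifts]

lemma mem_lifts_cons {u v w : V} {t : List V} {L : List T} : L ∈ D.lifts u (v :: w :: t) ↔
    ∃ P ∈ D.seg v u w, ∃ S ∈ D.lifts v (w :: t), L = P ++ S := by
  simp only [lifts, Finset.mem_image, Finset.mem_product, Prod.exists]
  grind

lemma head_of_mem_lifts {u v : V} {t : List V} {L : List T} (h : L ∈ D.lifts u (v :: t)) :
    L.head? = some (D.port v u) := by
  match t with
  | [] => rw [mem_lifts_singleton] at h; simp [h]
  | w :: t =>
    obtain ⟨P, hP, S, hS, rfl⟩ := D.mem_lifts_cons.1 h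
    rw [List.head?_append, (D.mem_seg.1 hP).2.2.2.1]
    rfl

lemma ne_nil_of_mem_lifts {u : V} {t : List V} {L : List T} (h : L ∈ D.lifts u t) : L ≠ [] := by
  rintro rfl
  match t with
  | [] => simp [lifts] at h
  | v :: t => have := D.head_of_mem_lifts h; simp at this

lemma pr_mem_of_mem_lifts {u : V} {t : List V} {L : List T} (h : L ∈ D.lifts u t) :
    ∀ p ∈ L, D.pr p ∈ t := by
  induction t generalizing u L with
  | nil => simp [lifts] at h
  | cons v t ih =>
    match t with
    | [] => rw [mem_lifts_singleton] at h; simp [h, D.pr_port]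
    | w :: t =>
      obtain ⟨P, hP, S, hS, rfl⟩ := D.mem_lifts_cons.1 h
      intro p hp
      rcases List.mem_append.1 hp with hp | hp
      · simp [(D.mem_seg.1 hP).2.2.1 p hp]
      · exact List.mem_cons_of_mem _ (ih hS p hp)

lemma pr_mem_dropLast_of_mem_lifts {u : V} {t : List V} {L : List T} (h : L ∈ D.lifts u t) :
    ∀ p ∈ L.dropLast, D.pr p ∈ t.dropLast := by
  induction t generalizing u L with
  | nil => simp [lifts] at h
  | cons v t ih =>
    match t with
    | [] => rw [mem_lifts_singleton] at h; simp [h]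
    | w :: t =>
      obtain ⟨P, hP, S, hS, rfl⟩ := D.mem_lifts_cons.1 h
      intro p hp
      rw [List.dropLast_append_of_ne_nil (D.ne_nil_of_mem_lifts hS)] at hp
      rw [List.dropLast_cons_of_ne_nil (by simp)]
      rcases List.mem_append.1 hp with hp | hp
      · simp [(D.mem_seg.1 hP).2.2.1 p hp]
      · exact List.mem_cons_of_mem _ (ih hS p hp)

lemma chain_of_mem_lifts {u : V} {t : List V} {L : List T} (hc : (u :: t).IsChain G.Adj)
    (h : L ∈ D.lifts u t) : L.IsChain H.Adj := by
  induction t generalizing u L with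
  | nil => simp [lifts] at h
  | cons v t ih =>
    match t with
    | [] => rw [mem_lifts_singleton] at h; simp [h]
    | w :: t =>
      obtain ⟨P, hP, S, hS, rfl⟩ := D.mem_lifts_cons.1 h
      rw [List.isChain_cons_cons] at hc
      rw [List.isChain_append]
      have := D.mem_seg.1 hP
      refine ⟨this.2.1, ih hc.2 hS, ?_⟩
      rw [this.2.2.2.2, D.head_of_mem_lifts hS]
      simpa using D.adj_port (List.isChain_cons_cons.1 hc.2).1

lemma chain_cons_of_mem_lifts {u v : V} {t : List V} {L : List T}
    (hc : (u :: v :: t).IsChain G.Adj) (h : L ∈ D.lifts u (v :: t)) :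
    (D.port u v :: L).IsChain H.Adj := by
  have h1 := D.head_of_mem_lifts h
  have h2 := D.chain_of_mem_lifts hc h
  match L, h1, h2 with
  | p :: L, h1, h2 =>
    simp only [List.head?_cons, Option.some.injEq] at h1
    subst h1
    exact List.isChain_cons_cons.2 ⟨D.adj_port (List.isChain_cons_cons.1 hc).1, h2⟩

lemma nodup_dropLast_of_mem_lifts {u : V} {t : List V} {L : List T} (hn : t.dropLast.Nodup)
    (h : L ∈ D.lifts u t) : L.dropLast.Nodup := by
  induction t generalizing u L with
  | nil => simp [lifts] at h
  | cons v t ih =>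
    match t with
    | [] => rw [mem_lifts_singleton] at h; simp [h]
    | w :: t =>
      obtain ⟨P, hP, S, hS, rfl⟩ := D.mem_lifts_cons.1 h
      rw [List.dropLast_append_of_ne_nil (D.ne_nil_of_mem_lifts hS)]
      rw [List.dropLast_cons_of_ne_nil (by simp), List.nodup_cons] at hn
      refine (D.mem_seg.1 hP).1.append (ih hn.2 hS) fun p hp hp' => hn.1 ?_
      rw [← (D.mem_seg.1 hP).2.2.1 p hp]
      exact D.pr_mem_dropLast_of_mem_lifts hS p hp'

lemma nodup_of_mem_lifts {u : V} {t : List V} {L : List T} (hn : t.Nodup)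
    (h : L ∈ D.lifts u t) : L.Nodup := by
  induction t generalizing u L with
  | nil => simp [lifts] at h
  | cons v t ih =>
    match t with
    | [] => rw [mem_lifts_singleton] at h; simp [h]
    | w :: t =>
      obtain ⟨P, hP, S, hS, rfl⟩ := D.mem_lifts_cons.1 h
      rw [List.nodup_cons] at hn
      refine (D.mem_seg.1 hP).1.append (ih hn.2 hS) fun p hp hp' => hn.1 ?_
      rw [← (D.mem_seg.1 hP).2.2.1 p hp]
      exact D.pr_mem_of_mem_lifts hS p hp'

lemma edgeList_append_lifts {u v w : V} {t : List V} {P S : List T} (hP : P ∈ D.seg v u w)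
    (hS : S ∈ D.lifts v (w :: t)) :
    edgeList (P ++ S) = edgeList P ++ edgeList (D.port v w :: S) := by
  have h := D.head_of_mem_lifts hS
  rw [edgeList_append (D.mem_seg.1 hP).2.2.2.2 h]
  match S, h with
  | p :: S, h =>
    simp only [List.head?_cons, Option.some.injEq] at h
    rw [edgeList_cons_cons, h]

lemma edgeList_cons_lifts {u v : V} {t : List V} {L : List T} (h : L ∈ D.lifts u (v :: t)) :
    edgeList (D.port u v :: L) = s(D.port u v, D.port v u) :: edgeList L := by
  have h := D.head_of_mem_lifts h
  match L, h with
  | p :: L, h =>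
    simp only [List.head?_cons, Option.some.injEq] at h
    rw [edgeList_cons_cons, h]

/-- Edges inside a fiber project to the diagonal, which contains no edge of `G`; this tells them
apart from the edges between fibers. -/
lemma map_pr_edge {v : V} {P : List T} (hP : ∀ p ∈ P, D.pr p = v) {e : Sym2 T}
    (he : e ∈ edgeList P) : e.map D.pr = s(v, v) := by
  induction e using Sym2.ind with
  | _ a b =>
    rw [Sym2.map_mk, hP a (mem_of_mem_edgeList he (by simp)),
      hP b (mem_of_mem_edgeList he (by simp))]

lemma edge_of_mem_lifts {u v : V} {t : List V} {L : List T} (h : L ∈ D.lifts u (v :: t))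
    {e : Sym2 T} (he : e ∈ edgeList (D.port u v :: L)) :
    e.map D.pr ∈ edgeList (u :: v :: t) ∨ ∃ z ∈ (v :: t).dropLast, e.map D.pr = s(z, z) := by
  induction t generalizing u v L with
  | nil =>
    rw [mem_lifts_singleton] at h
    subst h
    simp only [edgeList_cons_cons, edgeList_singleton, List.mem_singleton] at he
    simp [he, D.pr_port]
  | cons w t ih =>
    rw [D.edgeList_cons_lifts h, List.mem_cons] at he
    rcases he with rfl | he
    · simp [D.pr_port]
    · obtain ⟨P, hP, S, hS, rfl⟩ := D.mem_lifts_cons.1 h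
      rw [D.edgeList_append_lifts hP hS, List.mem_append] at he
      rw [List.dropLast_cons_of_ne_nil (by simp)]
      rcases he with he | he
      · exact Or.inr ⟨v, by simp, D.map_pr_edge (D.mem_seg.1 hP).2.2.1 he⟩
      · rcases ih hS he with h | ⟨z, hz, h⟩
        · exact Or.inl (List.mem_cons_of_mem _ h)
        · exact Or.inr ⟨z, List.mem_cons_of_mem _ hz, h⟩

lemma not_diag_mem_edgeList {q : List V} (hc : q.IsChain G.Adj) (z : V) :
    s(z, z) ∉ edgeList q := fun h =>
  G.irrefl (edgeList_subset_edgeSet hc _ h : G.Adj z z)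

/-- A repeated edge of a lift would show in the projection. Crossing edges project to the distinct
edges of the walk of `G`, and edges in fibers to diagonal elements that differ from one visited
vertex to the next; within a single fiber the traversal repeats no vertex. -/
lemma nodup_edgeList_of_mem_lifts {u v : V} {t : List V} {L : List T}
    (hc : (u :: v :: t).IsChain G.Adj) (hn : (v :: t).dropLast.Nodup)
    (he : (edgeList (u :: v :: t)).Nodup) (h : L ∈ D.lifts u (v :: t)) :
    (edgeList (D.port u v :: L)).Nodup := by
  induction t generalizing u v L with
  | nil => rw [mem_lifts_singleton] at h; simp [h]
  | cons w t ih =>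
    rw [D.edgeList_cons_lifts h]
    obtain ⟨P, hP, S, hS, rfl⟩ := D.mem_lifts_cons.1 h
    rw [D.edgeList_append_lifts hP hS]
    rw [List.isChain_cons_cons] at hc
    rw [edgeList_cons_cons, List.nodup_cons] at he
    rw [List.dropLast_cons_of_ne_nil (by simp), List.nodup_cons] at hn
    have hPv := (D.mem_seg.1 hP).2.2.1
    rw [List.nodup_cons, List.mem_append]
    refine ⟨?_, (nodup_edgeList (D.mem_seg.1 hP).1).append (ih hc.2 hn.2 he.2 hS) ?_⟩
    · have huv : s(u, v) = Sym2.map D.pr s(D.port u v, D.port v u) := by simp [D.pr_port]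
      rintro (h' | h')
      · have := D.map_pr_edge hPv h'
        rw [← huv] at this
        have h2 : G.Adj u v := hc.1
        simp only [Sym2.eq_iff] at this
        rcases this with ⟨rfl, _⟩ | ⟨rfl, _⟩ <;> exact G.irrefl h2
      · rcases D.edge_of_mem_lifts hS h' with h'' | ⟨z, _, h''⟩
        · rw [← huv] at h''; exact he.1 h''
        · rw [← huv] at h''
          have h2 : G.Adj u v := hc.1
          simp only [Sym2.eq_iff] at h''
          rcases h'' with ⟨rfl, rfl⟩ | ⟨rfl, rfl⟩ <;> exact G.irrefl h2
    · intro e h1 h2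
      have h3 := D.map_pr_edge hPv h1
      rcases D.edge_of_mem_lifts hS h2 with h'' | ⟨z, hz, h''⟩
      · rw [h3] at h''; exact not_diag_mem_edgeList hc.2 _ h''
      · rw [h3] at h''
        simp only [Sym2.eq_iff, or_self] at h''
        exact hn.1 (h''.1 ▸ hz)

/-- The good lifts of mid-edge self-avoiding walks are mid-edge self-avoiding walks. -/
lemma isMid_of_mem_lifts {u v : V} {t : List V} {L : List T} (hq : IsMid G (u :: v :: t))
    (h : L ∈ D.lifts u (v :: t)) : IsMid H (D.port u v :: L) where
  two_le := by
    have := List.length_pos_iff.2 (D.ne_nil_of_mem_lifts h)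
    simp; omega
  chain := D.chain_cons_of_mem_lifts hq.chain h
  edges := D.nodup_edgeList_of_mem_lifts hq.chain hq.inner hq.edges h
  inner := D.nodup_dropLast_of_mem_lifts hq.inner h

/-- The first entry outside the fiber of `v` marks the cut. All injectivity statements about lifts
reduce to this. -/
lemma append_cancel {v : V} : ∀ {P P' S S' : List T} {x x' : T}, (∀ p ∈ P, D.pr p = v) →
    (∀ p ∈ P', D.pr p = v) → S.head? = some x → S'.head? = some x' → D.pr x ≠ v → D.pr x' ≠ v →
    P ++ S = P' ++ S' → P = P' ∧ S = S'
  | [], [], S, S', _, _, _, _, _, _, _, _, h => ⟨rfl, h⟩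
  | [], p :: P', S, S', _, _, _, h2, h3, _, h5, _, h => by
    simp only [List.nil_append] at h
    rw [h] at h3
    simp only [List.cons_append, List.head?_cons, Option.some.injEq] at h3
    exact absurd (h3 ▸ h2 p (by simp)) h5
  | p :: P, [], S, S', _, _, h1, _, _, h4, _, h6, h => by
    simp only [List.nil_append] at h
    rw [← h] at h4
    simp only [List.cons_append, List.head?_cons, Option.some.injEq] at h4
    exact absurd (h4 ▸ h1 p (by simp)) h6
  | p :: P, p' :: P', S, S', _, _, h1, h2, h3, h4, h5, h6, h => by
    simp only [List.cons_append, List.cons.injEq] at h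
    obtain ⟨rfl, h⟩ := h
    obtain ⟨rfl, rfl⟩ := append_cancel (fun q hq => h1 q (List.mem_cons_of_mem _ hq))
      (fun q hq => h2 q (List.mem_cons_of_mem _ hq)) h3 h4 h5 h6 h
    exact ⟨rfl, rfl⟩

/-- The projection of the first entry is the first vertex; then the first traversal is split off by
`append_cancel` and the argument repeats. So the lifts of different walks are different. -/
lemma eq_of_mem_lifts {u : V} {t t' : List V} {L : List T} (hc : (u :: t).IsChain G.Adj)
    (hc' : (u :: t').IsChain G.Adj) (h : L ∈ D.lifts u t) (h' : L ∈ D.lifts u t') : t = t' := by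
  induction t generalizing u t' L with
  | nil => simp [lifts] at h
  | cons v t ih =>
    match t' with
    | [] => simp [lifts] at h'
    | v' :: t' =>
      have h1 := D.head_of_mem_lifts h
      rw [D.head_of_mem_lifts h', Option.some.injEq] at h1
      have h2 := congrArg D.pr h1
      rw [D.pr_port, D.pr_port] at h2
      subst h2
      have key : ∀ {w : V} {t : List V} {L : List T}, L ∈ D.lifts u (v' :: w :: t) →
          (u :: v' :: w :: t).IsChain G.Adj → L = [D.port v' u] → False := by
        rintro w t L hL hc rfl
        have h3 := D.head_of_mem_lifts hL
        obtain ⟨P, hP, S, hS, h⟩ := D.mem_lifts_cons.1 hL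
        have h4 := D.port_mem_left hP
        have h5 := D.head_of_mem_lifts hS
        match P, S, h4, h5 with
        | p :: P, q :: S, _, _ => simp at h
      match t, t' with
      | [], [] => rfl
      | [], w' :: t' => exact (key h' hc' (D.mem_lifts_singleton.1 h)).elim
      | w :: t, [] => exact (key h hc (D.mem_lifts_singleton.1 h')).elim
      | w :: t, w' :: t' =>
        obtain ⟨P, hP, S, hS, rfl⟩ := D.mem_lifts_cons.1 h
        obtain ⟨P', hP', S', hS', he⟩ := D.mem_lifts_cons.1 h'
        rw [List.isChain_cons_cons] at hc hc'
        obtain ⟨rfl, rfl⟩ := D.append_cancel (D.mem_seg.1 hP).2.2.1 (D.mem_seg.1 hP').2.2.1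
          (D.head_of_mem_lifts hS) (D.head_of_mem_lifts hS')
          (by rw [D.pr_port]; exact (List.isChain_cons_cons.1 hc.2).1.ne')
          (by rw [D.pr_port]; exact (List.isChain_cons_cons.1 hc'.2).1.ne') he
        rw [ih hc.2 hc'.2 hS hS']

/-- The weight of a walk of `G`, the product of the weights `γ` of the colours of all of its
vertices but the last one. -/
noncomputable def weight (χ : V → Bool) (γ : Bool → ℝ≥0∞) : List V → ℝ≥0∞
  | v :: w :: t => γ (χ v) * weight χ γ (w :: t)
  | _ => 1

/-- `γ` gives the generating functions of the traversals of the fibers, evaluated at `x`. -/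
def IsGen (x : ℝ≥0∞) (γ : Bool → ℝ≥0∞) : Prop :=
  ∀ ⦃v a b⦄, G.Adj v a → G.Adj v b → a ≠ b → ∑ P ∈ D.seg v a b, x ^ P.length = γ (χ v)

/-- The traversals of successive fibers are chosen independently, so the sum factorizes. As no edge
is repeated, a fiber is entered and left along different edges, which is what `IsGen` requires. The
last fiber is only entered: it has no weight, and its single vertex is not counted in the length. -/
lemma sum_lifts {x : ℝ≥0∞} {γ : Bool → ℝ≥0∞} (hγ : D.IsGen x γ) {u v : V} {t : List V}
    (hc : (u :: v :: t).IsChain G.Adj) (he : (edgeList (u :: v :: t)).Nodup) :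
    ∑ L ∈ D.lifts u (v :: t), x ^ (L.length - 1) = weight χ γ (v :: t) := by
  induction t generalizing u v with
  | nil => simp [lifts, weight]
  | cons w t ih =>
    rw [List.isChain_cons_cons] at hc
    rw [edgeList_cons_cons, List.nodup_cons] at he
    have hvw := (List.isChain_cons_cons.1 hc.2).1
    have huw : u ≠ w := by
      rintro rfl
      exact he.1 (by simp [Sym2.eq_swap])
    classical
    rw [lifts, Finset.sum_image]
    · rw [Finset.sum_product, weight, ← hγ hc.1.symm hvw huw, Finset.sum_mul]
      refine Finset.sum_congr rfl fun P _ => ?_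
      rw [← ih hc.2 he.2, Finset.mul_sum]
      refine Finset.sum_congr rfl fun S hS => ?_
      have := List.length_pos_iff.2 (D.ne_nil_of_mem_lifts hS)
      rw [← pow_add, List.length_append, Nat.add_sub_assoc this]
    · rintro ⟨P, S⟩ h ⟨P', S'⟩ h' e
      simp only [Finset.coe_product, Set.mem_prod, Finset.mem_coe] at h h' e
      obtain ⟨rfl, rfl⟩ := D.append_cancel (D.mem_seg.1 h.1).2.2.1 (D.mem_seg.1 h'.1).2.2.1
          (D.head_of_mem_lifts h.2) (D.head_of_mem_lifts h'.2)
          (by rw [D.pr_port]; exact hvw.ne') (by rw [D.pr_port]; exact hvw.ne') e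
      rfl

lemma length_of_mem_lifts {u v : V} {t : List V} {L : List T} (h : L ∈ D.lifts u (v :: t)) :
    t.length + 1 ≤ L.length ∧ L.length ≤ K * t.length + 1 := by
  induction t generalizing u v L with
  | nil => rw [mem_lifts_singleton] at h; simp [h]
  | cons w t ih =>
    obtain ⟨P, hP, S, hS, rfl⟩ := D.mem_lifts_cons.1 h
    have h1 := D.length_le_of_nodup (D.mem_seg.1 hP).2.2.1 (D.mem_seg.1 hP).1
    have h2 := List.length_pos_of_mem (D.port_mem_left hP)
    have h3 := ih hS
    rw [List.length_append, List.length_cons, mul_add]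
    omega

lemma drop_length_sub_two {α : Type*} {P S : List α} (h : 2 ≤ S.length) :
    (P ++ S).drop ((P ++ S).length - 2) = S.drop (S.length - 2) := by
  rw [List.length_append, List.drop_append, List.drop_eq_nil_of_le (by omega), List.nil_append]
  congr 1
  omega

lemma exists_drop_of_mem_lifts {u v : V} {t : List V} {L : List T}
    (h : L ∈ D.lifts u (v :: t)) : ∀ z ∈ (u :: v :: t).drop ((u :: v :: t).length - 2),
    ∃ p ∈ (D.port u v :: L).drop ((D.port u v :: L).length - 2), D.pr p = z := by
  induction t generalizing u v L with
  | nil => rw [mem_lifts_singleton] at h; simp [h, D.pr_port]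
  | cons w t ih =>
    obtain ⟨P, hP, S, hS, rfl⟩ := D.mem_lifts_cons.1 h
    have h1 := List.length_pos_iff.2 (D.ne_nil_of_mem_lifts hS)
    obtain ⟨P', hP'⟩ := List.getLast?_eq_some_iff.1 (D.mem_seg.1 hP).2.2.2.2
    have e1 : D.port u v :: (P ++ S) = (D.port u v :: P') ++ (D.port v w :: S) := by
      simp [hP']
    have e2 : u :: v :: w :: t = [u] ++ (v :: w :: t) := rfl
    rw [e1, e2, drop_length_sub_two (by simp), drop_length_sub_two (by simp; omega)]
    exact ih hS

/-! ### Projecting walks -/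

/-- `Proj v t L`: the walk `L` of `H` runs through the fibers of the vertices of `v :: t`. -/
inductive Proj : V → List V → List T → Prop
  | one {v P} : P ≠ [] → (∀ p ∈ P, D.pr p = v) → P.IsChain H.Adj → Proj v [] P
  | cons {v w t P S} : G.Adj v w → (∀ p ∈ P, D.pr p = v) → P.IsChain H.Adj →
      P.getLast? = some (D.port v w) → S.head? = some (D.port w v) → Proj w t S →
      Proj v (w :: t) (P ++ S)

variable {D}

lemma Proj.head {v : V} {t : List V} {L : List T} (h : D.Proj v t L) :
    ∃ p, L.head? = some p ∧ D.pr p = v := by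
  cases h with
  | one hP hv _ =>
    exact ⟨_, List.head?_eq_some_head hP, hv _ (List.head_mem hP)⟩
  | cons hadj hv hc hl hS h =>
    rename_i w t P S
    match P, hl with
    | p :: P, hl => exact ⟨p, rfl, hv p (by simp)⟩

lemma Proj.ne_nil {v : V} {t : List V} {L : List T} (h : D.Proj v t L) : L ≠ [] := by
  obtain ⟨p, hp, _⟩ := h.head
  rintro rfl
  simp at hp

lemma Proj.cons_same {v : V} {t : List V} {p p' : T} {L : List T} (h : D.Proj v t L)
    (hL : L.head? = some p') (hp : D.pr p = v) (hadj : H.Adj p p') : D.Proj v t (p :: L) := by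
  cases h with
  | one hP hv hc =>
    refine .one (by simp) (by simpa [hp] using hv) ?_
    match L, hL with
    | q :: L, hL =>
      simp only [List.head?_cons, Option.some.injEq] at hL
      exact List.isChain_cons_cons.2 ⟨hL ▸ hadj, hc⟩
  | cons hvw hv hc hl hS h =>
    rename_i w t P S
    rw [← List.cons_append]
    match P, hl with
    | q :: P, hl =>
      simp only [List.cons_append, List.head?_cons, Option.some.injEq] at hL
      exact .cons hvw (by simpa [hp] using hv) (List.isChain_cons_cons.2 ⟨hL ▸ hadj, hc⟩)
        (by simpa using hl) hS h

-- Read the walk from its end. A new first vertex lies in the fiber of its successor and extends the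
-- first piece, or is separated from it by a crossing edge, whose ends are the prescribed ports by
-- `cross`.
variable (D) in
lemma exists_proj {L : List T} {p : T} (hc : L.IsChain H.Adj) (hp : L.head? = some p) :
    ∃ t, D.Proj (D.pr p) t L := by
  induction L generalizing p with
  | nil => simp at hp
  | cons p' L ih =>
    simp only [List.head?_cons, Option.some.injEq] at hp
    subst hp
    match L with
    | [] => exact ⟨[], .one (by simp) (by simp) (by simp)⟩
    | q :: L =>
      rw [List.isChain_cons_cons] at hc
      obtain ⟨t, ht⟩ := ih hc.2 rfl
      by_cases hpq : D.pr p' = D.pr q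
      · exact ⟨t, hpq ▸ ht.cons_same rfl hpq hc.1⟩
      · obtain ⟨h1, h2, h3⟩ := D.cross hc.1 hpq
        exact ⟨D.pr q :: t, .cons (P := [p']) h1 (by simp) (by simp) (by simpa using h2)
          (by simpa using h3) ht⟩

lemma Proj.chain {v : V} {t : List V} {L : List T} (h : D.Proj v t L) :
    (v :: t).IsChain G.Adj := by
  induction h with
  | one => simp
  | cons hvw _ _ _ _ _ ih => exact List.isChain_cons_cons.2 ⟨hvw, ih⟩

variable (D) in
/-- The edge of `H` over an edge of `G`. -/
def liftEdge : Sym2 V → Sym2 T :=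
  Sym2.lift ⟨fun v w => s(D.port v w, D.port w v), fun _ _ => Sym2.eq_swap⟩

/-- The edges of the projected walk appear above, in order, as the crossing edges. Hence distinct
edges above give distinct edges below. -/
lemma Proj.sublist {v : V} {t : List V} {L : List T} (h : D.Proj v t L) :
    ((edgeList (v :: t)).map D.liftEdge).Sublist (edgeList L) := by
  induction h with
  | one => simp
  | cons hvw _ _ hl hS _ ih =>
    rw [edgeList_append hl hS, edgeList_cons_cons, List.map_cons]
    exact (ih.cons_cons _).trans (List.sublist_append_right _ _)

lemma Proj.take_two {v : V} {t : List V} {L : List T} (h : D.Proj v t L) :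
    ∀ p ∈ L.take 2, D.pr p ∈ (v :: t).take 2 := by
  cases h with
  | one _ hv _ => intro p hp; simp [hv p (List.mem_of_mem_take hp)]
  | cons hvw hv hc hl hS h =>
    rename_i w t P S
    obtain ⟨q, hq, hqw⟩ := h.head
    match P, hl, S, hq with
    | [a], hl, q :: S, hq =>
      simp only [List.head?_cons, Option.some.injEq] at hq
      subst hq
      simp [hqw, hv]
    | a :: b :: P, hl, S, hq => simp [hv]

lemma Proj.drop_two {v : V} {t : List V} {L : List T} (h : D.Proj v t L) :
    ∀ p ∈ L.drop (L.length - 2), D.pr p ∈ (v :: t).drop ((v :: t).length - 2) := by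
  induction h with
  | one _ hv _ => intro p hp; simp [hv p (List.mem_of_mem_drop hp)]
  | cons hvw hv hc hl hS h ih =>
    rename_i v w t P S
    match t, h with
    | [], .one hne hv' _ =>
      intro p hp
      rcases List.mem_append.1 (List.mem_of_mem_drop hp) with hp | hp
      · simp [hv p hp]
      · simp [hv' p hp]
    | x :: t, .cons (P := P') (S := S') _ _ _ hl' hS' _ =>
      have e2 : v :: w :: x :: t = [v] ++ (w :: x :: t) := rfl
      have h2 : 2 ≤ (P' ++ S').length := by
        have h3 := List.length_pos_of_mem (List.mem_of_getLast? hl')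
        have h4 := List.length_pos_of_mem (List.mem_of_head? hS')
        rw [List.length_append]; omega
      rw [e2, drop_length_sub_two (P := P) h2, drop_length_sub_two (P := [v]) (by simp)]
      exact ih

/-- Every visit to a fiber except the last enters at one port and leaves at another, hence is a
traversal. Of the last visit the lift keeps the entrance only; the rest is `B`, whose length is
bounded because only the final vertex of the walk may be a repetition. -/
lemma Proj.exists_lift {u v : V} {t : List V} {S : List T} (h : D.Proj v t S)
    (hS : S.head? = some (D.port v u)) (hn : S.dropLast.Nodup)
    (he : (edgeList (u :: v :: t)).Nodup) (huv : G.Adj u v) :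
    ∃ M B, S = M ++ B ∧ M ∈ D.lifts u (v :: t) ∧
      (∀ p ∈ B, (v :: t).getLast? = some (D.pr p)) ∧ B.length ≤ K := by
  induction h generalizing u with
  | one hP hv hc =>
    rename_i v P
    match P, hS with
    | p :: B, hS =>
      simp only [List.head?_cons, Option.some.injEq] at hS
      refine ⟨[p], B, rfl, by simp [lifts, hS], fun q hq => by simp [hv q (by simp [hq])], ?_⟩
      have := D.length_le_of_nodup (fun q hq => hv q (List.mem_of_mem_dropLast hq)) hn
      simpa using this
  | cons hvw hv hc hl hS' h ih =>
    rename_i v w t P S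
    have hne : S ≠ [] := h.ne_nil
    rw [List.dropLast_append_of_ne_nil hne] at hn
    rw [edgeList_cons_cons, List.nodup_cons] at he
    obtain ⟨M, B, rfl, hM, hB, hBl⟩ := ih hS' (hn.sublist (List.sublist_append_right _ _)) he.2 hvw
    refine ⟨P ++ M, B, by simp, D.mem_lifts_cons.2 ⟨P, ?_, M, hM, rfl⟩, ?_, hBl⟩
    · rw [mem_seg]
      refine ⟨hn.sublist (List.sublist_append_left _ _), hc, hv, ?_, hl⟩
      have : P ≠ [] := by rintro rfl; simp at hl
      match P, this with
      | p :: P, _ => simpa using hS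
    · intro p hp
      simpa using hB p hp

lemma seg_of_mem_dropLast {u : V} {t : List V} {L : List T} (hc : (u :: t).IsChain G.Adj)
    (he : (edgeList (u :: t)).Nodup) (h : L ∈ D.lifts u t) {z : V} (hz : z ∈ t.dropLast) :
    ∃ a b, G.Adj z a ∧ G.Adj z b ∧ a ≠ b ∧ D.port z a ∈ L.dropLast ∧ D.port z b ∈ L.dropLast := by
  induction t generalizing u L with
  | nil => simp at hz
  | cons v t ih =>
    match t with
    | [] => simp at hz
    | w :: t =>
      obtain ⟨P, hP, S, hS, rfl⟩ := D.mem_lifts_cons.1 h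
      rw [List.isChain_cons_cons] at hc
      rw [edgeList_cons_cons, List.nodup_cons] at he
      rw [List.dropLast_append_of_ne_nil (D.ne_nil_of_mem_lifts hS)]
      rw [List.dropLast_cons_of_ne_nil (by simp), List.mem_cons] at hz
      rcases hz with rfl | hz
      · refine ⟨u, w, hc.1.symm, (List.isChain_cons_cons.1 hc.2).1, ?_,
          List.mem_append_left _ (D.port_mem_left hP), List.mem_append_left _ (D.port_mem_right hP)⟩
        rintro rfl
        exact he.1 (by simp [Sym2.eq_swap])
      · obtain ⟨a, b, h1, h2, h3, h4, h5⟩ := ih hc.2 he.2 hS hz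
        exact ⟨a, b, h1, h2, h3, List.mem_append_right _ h4, List.mem_append_right _ h5⟩

/-- This is where the three ports matter. If a vertex were visited twice, its fiber would be
traversed by two disjoint walks, each of which contains the ports of two different edges; by `meet`
they share a port. -/
lemma nodup_dropLast_of_lift {u : V} {t : List V} {L : List T} (hc : (u :: t).IsChain G.Adj)
    (he : (edgeList (u :: t)).Nodup) (h : L ∈ D.lifts u t) (hn : L.dropLast.Nodup) :
    t.dropLast.Nodup := by
  induction t generalizing u L with
  | nil => simp
  | cons v t ih =>
    match t with
    | [] => simp
    | w :: t =>
      obtain ⟨P, hP, S, hS, rfl⟩ := D.mem_lifts_cons.1 h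
      rw [List.dropLast_append_of_ne_nil (D.ne_nil_of_mem_lifts hS)] at hn
      rw [List.isChain_cons_cons] at hc
      rw [edgeList_cons_cons, List.nodup_cons] at he
      rw [List.dropLast_cons_of_ne_nil (by simp), List.nodup_cons]
      refine ⟨fun hv => ?_, ih hc.2 he.2 hS (hn.sublist (List.sublist_append_right _ _))⟩
      obtain ⟨a, b, h1, h2, h3, h4, h5⟩ := D.seg_of_mem_dropLast hc.2 he.2 hS hv
      have huw : u ≠ w := by
        rintro rfl
        exact he.1 (by simp [Sym2.eq_swap])
      have hdis := List.disjoint_of_nodup_append hn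
      have h6 := D.port_mem_left hP
      have h7 := D.port_mem_right hP
      rcases D.meet hc.1.symm (List.isChain_cons_cons.1 hc.2).1 h1 h2 huw h3 with h | h | h | h
      · exact hdis h6 (h ▸ h4)
      · exact hdis h6 (h ▸ h5)
      · exact hdis h7 (h ▸ h4)
      · exact hdis h7 (h ▸ h5)

variable (D) in
/-- A mid-edge self-avoiding walk of `H` either stays in one fiber or is the good lift of a mid-edge
self-avoiding walk of `G` up to a bounded number of vertices at both ends. -/
theorem exists_lift_of_isMid {q : List T} (hq : IsMid H q) :
    (∃ v, ∀ p ∈ q, D.pr p = v) ∨ ∃ u v t A L B, IsMid G (u :: v :: t) ∧ L ∈ D.lifts u (v :: t) ∧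
      q = A ++ (D.port u v :: L) ++ B ∧ (∀ p ∈ A, D.pr p = u) ∧ A.length ≤ K ∧
      (∀ p ∈ B, (v :: t).getLast? = some (D.pr p)) ∧ B.length ≤ K ∧
      (∀ p ∈ q.take 2, D.pr p ∈ (u :: v :: t).take 2) ∧
      (∀ p ∈ q.drop (q.length - 2),
        D.pr p ∈ (u :: v :: t).drop ((u :: v :: t).length - 2)) := by
  have hne : q ≠ [] := by rintro rfl; have := hq.two_le; simp at this
  obtain ⟨t, ht⟩ := D.exists_proj hq.chain (List.head?_eq_some_head hne)
  generalize D.pr (q.head hne) = u at ht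
  have htake := ht.take_two
  have hdrop := ht.drop_two
  have hchain := ht.chain
  have hsub := ht.sublist
  have hedge := (hq.edges.sublist hsub).of_map
  cases ht with
  | one _ hv _ => exact Or.inl ⟨u, hv⟩
  | cons huv hv hc hl hS h =>
    rename_i v t P S
    right
    obtain ⟨A, rfl⟩ := List.getLast?_eq_some_iff.1 hl
    have hSne := h.ne_nil
    have hin := hq.inner
    have hin1 : S.dropLast.Nodup := by
      refine hin.sublist ?_
      rw [List.append_assoc]
      cases A with
      | nil => simp
      | cons a A =>
        simp only [List.cons_append, List.tail_cons]
        rw [List.dropLast_append_of_ne_nil (by simp), List.nil_append,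
          List.dropLast_cons_of_ne_nil hSne]
        exact (List.sublist_cons_self _ _).trans (List.sublist_append_right _ _)
    -- The first vertex of the walk is a far end and may be visited later. The bound comes from the
    -- rest of `A` together with the port, which number as many as the entries of `A`.
    have hin2 : A.length ≤ K := by
      cases A with
      | nil => simp
      | cons a A =>
        have h1 : (A ++ [D.port u v]).Nodup := by
          refine hin.sublist ?_
          rw [List.cons_append, List.cons_append, List.tail_cons,
            List.dropLast_append_of_ne_nil hSne]
          exact List.sublist_append_left _ _
        have := D.length_le_of_nodup (fun p hp => hv p (List.mem_cons_of_mem _ hp)) h1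
        simpa using this
    obtain ⟨M, B, rfl, hM, hB, hBl⟩ := h.exists_lift hS hin1 hedge huv
    refine ⟨u, v, t, A, M, B, ⟨by simp, hchain, hedge, ?_⟩, hM, by simp,
      fun p hp => hv p (by simp [hp]), hin2, hB, hBl, htake, hdrop⟩
    refine D.nodup_dropLast_of_lift hchain hedge hM (hin1.sublist ?_)
    rcases List.eq_nil_or_concat B with rfl | ⟨B', b, rfl⟩
    · simp
    · rw [List.concat_eq_append, ← List.append_assoc, List.dropLast_concat]
      exact (List.dropLast_sublist _).trans (List.sublist_append_left _ _)

end Decoration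

/-! ### Comparison of sums over the walks of `G` and of `H` -/

namespace Decoration

variable {V T : Type*} {G : SimpleGraph V} {χ : V → Bool} {H : SimpleGraph T} {K : ℕ}
  (D : Decoration G χ H K)

open Classical in
/-- The good lifts of a walk of `G`, the first vertex included. -/
noncomputable def goodLifts : List V → Finset (List T)
  | u :: v :: t => (D.lifts u (v :: t)).image fun L => D.port u v :: L
  | _ => ∅

lemma mem_goodLifts {u v : V} {t : List V} {g : List T} :
    g ∈ D.goodLifts (u :: v :: t) ↔ ∃ L ∈ D.lifts u (v :: t), D.port u v :: L = g := by
  simp [goodLifts]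

lemma _root_.IsMid.eq_cons {q : List V} (h : IsMid G q) : ∃ u v t, q = u :: v :: t := by
  match q, h.two_le with
  | u :: v :: t, _ => exact ⟨u, v, t, rfl⟩

lemma isMid_of_mem_goodLifts {q : List V} {g : List T} (hq : IsMid G q)
    (hg : g ∈ D.goodLifts q) : IsMid H g := by
  obtain ⟨u, v, t, rfl⟩ := hq.eq_cons
  obtain ⟨L, hL, rfl⟩ := D.mem_goodLifts.1 hg
  exact D.isMid_of_mem_lifts hq hL

lemma eq_of_mem_goodLifts {q q' : List V} {g : List T} (hq : q.IsChain G.Adj)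
    (hq' : q'.IsChain G.Adj) (hg : g ∈ D.goodLifts q) (hg' : g ∈ D.goodLifts q') : q = q' := by
  match q, hg, q', hg' with
  | u :: v :: t, hg, u' :: v' :: t', hg' =>
    obtain ⟨L, hL, rfl⟩ := D.mem_goodLifts.1 hg
    obtain ⟨L', hL', h⟩ := D.mem_goodLifts.1 hg'
    simp only [List.cons.injEq] at h
    obtain ⟨h1, rfl⟩ := h
    have := congrArg D.pr h1
    rw [D.pr_port, D.pr_port] at this
    subst this
    rw [D.eq_of_mem_lifts hq hq' hL hL']

lemma sum_goodLifts {x : ℝ≥0∞} {γ : Bool → ℝ≥0∞} (hγ : D.IsGen x γ) {q : List V}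
    (hq : IsMid G q) :
    ∑ g ∈ D.goodLifts q, x ^ (g.length - 2) = weight χ γ q.tail := by
  classical
  obtain ⟨u, v, t, rfl⟩ := hq.eq_cons
  rw [goodLifts, Finset.sum_image (by intro a _ b _ h; simpa using h)]
  simpa using D.sum_lifts hγ hq.chain hq.edges

lemma length_of_mem_goodLifts {q : List V} {g : List T} (hg : g ∈ D.goodLifts q) :
    q.length ≤ g.length ∧ g.length - 2 ≤ K * (q.length - 2) := by
  match q, hg with
  | u :: v :: t, hg =>
    obtain ⟨L, hL, rfl⟩ := D.mem_goodLifts.1 hg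
    have := D.length_of_mem_lifts hL
    have e : t.length + 1 + 1 - 2 = t.length := rfl
    simp only [List.length_cons, e]
    omega

lemma take_two_of_mem_goodLifts {q : List V} {g : List T} (hg : g ∈ D.goodLifts q) :
    ∀ z ∈ q.take 2, ∃ p ∈ g.take 2, D.pr p = z := by
  match q, hg with
  | u :: v :: t, hg =>
    obtain ⟨L, hL, rfl⟩ := D.mem_goodLifts.1 hg
    have := D.head_of_mem_lifts hL
    match L, this with
    | p :: L, this =>
      simp only [List.head?_cons, Option.some.injEq] at this
      simp [this, D.pr_port]

lemma drop_two_of_mem_goodLifts {q : List V} {g : List T} (hg : g ∈ D.goodLifts q) :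
    ∀ z ∈ q.drop (q.length - 2), ∃ p ∈ g.drop (g.length - 2), D.pr p = z := by
  match q, hg with
  | u :: v :: t, hg =>
    obtain ⟨L, hL, rfl⟩ := D.mem_goodLifts.1 hg
    exact D.exists_drop_of_mem_lifts hL

/-- Lower bound for sums over the mid-edge walks of `H`. -/
theorem midSum_ge {x : ℝ≥0∞} {γ : Bool → ℝ≥0∞} (hγ : D.IsGen x γ) (F : List V → ℝ≥0∞)
    (F' : List T → ℝ≥0∞)
    (hF : ∀ q g, IsMid G q → IsMid H g → g ∈ D.goodLifts q → F q * x ^ (g.length - 2) ≤ F' g) :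
    midSum G (fun q => F q * weight χ γ q.tail) ≤ midSum H F' := by
  -- A good lift remembers the walk below it, so summing over walks and then over their lifts counts
  -- no walk of `H` twice.
  have hinj : Function.Injective fun p : Σ q : {q // IsMid G q}, {g // g ∈ D.goodLifts q.1} =>
      (⟨p.2.1, D.isMid_of_mem_goodLifts p.1.2 p.2.2⟩ : {g // IsMid H g}) := by
    rintro ⟨⟨q, hq⟩, ⟨g, hg⟩⟩ ⟨⟨q', hq'⟩, ⟨g', hg'⟩⟩ h
    simp only [Subtype.mk.injEq] at h
    subst h
    obtain rfl := D.eq_of_mem_goodLifts hq.chain hq'.chain hg hg'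
    rfl
  calc midSum G (fun q => F q * weight χ γ q.tail)
      = ∑' q : {q // IsMid G q}, ∑' g : {g // g ∈ D.goodLifts q.1},
          F q.1 * x ^ (g.1.length - 2) := by
        refine tsum_congr fun q => ?_
        simp only
        rw [← D.sum_goodLifts hγ q.2, ENNReal.tsum_mul_left]
        congr 1
        exact (Finset.tsum_subtype (D.goodLifts q.1) (fun g => x ^ (g.length - 2))).symm
    _ ≤ ∑' q : {q // IsMid G q}, ∑' g : {g // g ∈ D.goodLifts q.1}, F' g.1 :=
        ENNReal.tsum_le_tsum fun q => ENNReal.tsum_le_tsum fun g =>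
          hF _ _ q.2 (D.isMid_of_mem_goodLifts q.2 g.2) g.2
    _ = ∑' p : Σ q : {q // IsMid G q}, {g // g ∈ D.goodLifts q.1}, F' p.2.1 :=
        (ENNReal.tsum_sigma' fun p : Σ q : {q // IsMid G q}, {g // g ∈ D.goodLifts q.1} =>
          F' p.2.1).symm
    _ ≤ _ := ENNReal.tsum_comp_le_tsum_of_injective hinj (fun g : {g // IsMid H g} => F' g.1)

/-- The walk `q` stays in one fiber. -/
def InFiber (q : List T) : Prop := ∃ v, ∀ p ∈ q, D.pr p = v

/-- Upper bound for sums over the mid-edge walks of `H` that do not stay in one fiber, up to a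
factor that depends only on `K`. -/
theorem tsum_not_inFiber_le (K : ℕ) : ∃ C : ℝ≥0∞, C ≠ ⊤ ∧
    ∀ {V T : Type*} {G : SimpleGraph V} {χ : V → Bool} {H : SimpleGraph T}
    (D : Decoration G χ H K) {x : ℝ≥0∞} {γ : Bool → ℝ≥0∞} (_ : D.IsGen x γ) (F : List V → ℝ≥0∞)
    (F' : List T → ℝ≥0∞)
    (_ : ∀ q' q g, IsMid H q' → IsMid G q → g ∈ D.goodLifts q → g.length ≤ q'.length →
      q'.length ≤ g.length + 2 * K → q'.head?.map D.pr = q.head? →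
      (∀ p ∈ q'.take 2, D.pr p ∈ q.take 2) →
      (∀ p ∈ q'.drop (q'.length - 2), D.pr p ∈ q.drop (q.length - 2)) →
      F' q' ≤ F q * x ^ (g.length - 2)),
    ∑' q : {q // IsMid H q ∧ ¬ D.InFiber q}, F' q.1 ≤
      C * midSum G (fun q => F q * weight χ γ q.tail) := by
  have hfin := List.finite_length_le (Fin K) K
  let _ : Fintype {l : List (Fin K) | l.length ≤ K} := hfin.fintype
  -- The constant counts the possible codes of the two end pieces `A` and `B`. It involves neither
  -- the graph nor the weights.
  refine ⟨Fintype.card ({l : List (Fin K) | l.length ≤ K} × {l : List (Fin K) | l.length ≤ K}),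
    ENNReal.natCast_ne_top _, ?_⟩
  intro V T G χ H D x γ hγ F F' hF
  have key : ∀ q : {q // IsMid H q ∧ ¬ D.InFiber q}, ∃ (q0 : List V) (g A B : List T),
      IsMid G q0 ∧ g ∈ D.goodLifts q0 ∧ q.1 = A ++ g ++ B ∧
      (∀ p ∈ A, q0.head? = some (D.pr p)) ∧ A.length ≤ K ∧
      (∀ p ∈ B, q0.getLast? = some (D.pr p)) ∧ B.length ≤ K ∧
      F' q.1 ≤ F q0 * x ^ (g.length - 2) := by
    rintro ⟨q, hq, hq'⟩
    rcases D.exists_lift_of_isMid hq with h | ⟨u, v, t, A, L, B, h1, h2, h3, h4, h5, h6, h7, h8, h9⟩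
    · exact absurd h hq'
    · have hg : D.port u v :: L ∈ D.goodLifts (u :: v :: t) := D.mem_goodLifts.2 ⟨L, h2, rfl⟩
      refine ⟨u :: v :: t, D.port u v :: L, A, B, h1, hg, h3, fun p hp => by simp [h4 p hp], h5,
        fun p hp => by simpa using h6 p hp, h7, hF _ _ _ hq h1 hg ?_ ?_ ?_ h8 h9⟩
      · simp only [h3, List.length_append]; omega
      · simp only [h3, List.length_append]; omega
      · simp only [h3]
        cases A with
        | nil => simp [D.pr_port]
        | cons a A => simp [h4]
  choose q0 g A B h1 h2 h3 h4 h5 h6 h7 h8 using key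
  have := tsum_le_mul_of_injective
    (f := fun q : {q // IsMid H q ∧ ¬ D.InFiber q} => F' q.1)
    (g := fun p : Σ q : {q // IsMid G q}, {g // g ∈ D.goodLifts q.1} =>
      F p.1.1 * x ^ (p.2.1.length - 2))
    (ι := {l : List (Fin K) | l.length ≤ K} × {l : List (Fin K) | l.length ≤ K})
    (fun q => (⟨⟨q0 q, h1 q⟩, ⟨g q, h2 q⟩⟩, (⟨(A q).map D.code, by simpa using h5 q⟩,
      ⟨(B q).map D.code, by simpa using h7 q⟩))) ?_ h8
  · refine this.trans (le_of_eq ?_)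
    congr 1
    rw [ENNReal.tsum_sigma']
    refine tsum_congr fun q => ?_
    simp only
    rw [← D.sum_goodLifts hγ q.2, ENNReal.tsum_mul_left]
    congr 1
    exact Finset.tsum_subtype (D.goodLifts q.1) (fun g => x ^ (g.length - 2))
  -- The walk of `G` determines the fibers that contain `A` and `B`, and within a known fiber the
  -- codes determine the pieces.
  · intro q q' h
    simp only [Prod.mk.injEq, Sigma.mk.injEq, Subtype.mk.injEq] at h
    obtain ⟨⟨e1, e2⟩, e3, e4⟩ := h
    have e2' : g q = g q' := by
      have : ∀ (a b : List V) (g : {g // g ∈ D.goodLifts a}) (g' : {g // g ∈ D.goodLifts b}),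
          a = b → g ≍ g' → g.1 = g'.1 := by
        rintro a _ g g' rfl h
        rw [eq_of_heq h]
      exact this _ _ _ _ e1 e2
    obtain ⟨u, v, t, hu⟩ := (h1 q).eq_cons
    have e3' : A q = A q' := by
      refine D.map_code_injOn u (fun p hp => ?_) (fun p hp => ?_) e3
      · have := h4 q p hp; rw [hu] at this; simpa [eq_comm] using this
      · have := h4 q' p hp; rw [← e1, hu] at this; simpa [eq_comm] using this
    have e4' : B q = B q' := by
      refine D.map_code_injOn ((v :: t).getLast (by simp)) (fun p hp => ?_) (fun p hp => ?_) e4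
      · have := h6 q p hp
        rw [hu, List.getLast?_cons_cons, List.getLast?_eq_some_getLast (by simp)] at this
        simpa [eq_comm] using this
      · have := h6 q' p hp
        rw [← e1, hu, List.getLast?_cons_cons, List.getLast?_eq_some_getLast (by simp)] at this
        simpa [eq_comm] using this
    apply Subtype.ext
    rw [h3, h3, e2', e3', e4']

lemma length_le_of_inFiber {q : List T} (hq : IsMid H q) {v : V} (hv : ∀ p ∈ q, D.pr p = v) :
    q.length ≤ K + 2 := by
  have := D.length_le_of_nodup
    (fun p hp => hv p (List.mem_of_mem_tail (List.mem_of_mem_dropLast hp))) hq.inner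
  simp at this
  omega

lemma midSum_eq_add (F' : List T → ℝ≥0∞) : midSum H F' =
    ∑' q : {q // IsMid H q ∧ D.InFiber q}, F' q.1 +
      ∑' q : {q // IsMid H q ∧ ¬ D.InFiber q}, F' q.1 := by
  classical
  unfold midSum
  have e : ∀ P : List T → Prop, ∑' q : {q // P q}, F' q.1 = ∑' q, {q | P q}.indicator F' q :=
    fun P => tsum_subtype {q | P q} F'
  rw [e, e, e, ← ENNReal.tsum_add]
  refine tsum_congr fun q => ?_
  by_cases h1 : IsMid H q <;> by_cases h2 : D.InFiber q <;> simp [Set.indicator, h1, h2]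

/-- The walks inside the fibers contribute finitely many terms. -/
lemma tsum_inFiber_lt_top {W : Set V} (hW : W.Finite) (F' : List T → ℝ≥0∞)
    (h0 : ∀ q, ¬ StartsAt (D.pr ⁻¹' W) q → F' q = 0) (h1 : ∀ q, F' q ≠ ⊤) :
    ∑' q : {q // IsMid H q ∧ D.InFiber q}, F' q.1 < ⊤ := by
  set S : Set (List T) := ⋃ v ∈ W, {P : List T | (∀ p ∈ P, D.pr p = v) ∧ P.length ≤ K + 2}
  have hS : S.Finite := hW.biUnion fun v _ => D.finite_fiberLists v (K + 2)
  have e : ∑' q : {q // IsMid H q ∧ D.InFiber q}, F' q.1 ≤ ∑ q ∈ hS.toFinset, F' q := by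
    have e1 : ∑' q : {q // IsMid H q ∧ D.InFiber q}, F' q.1 =
      ∑' q, {q | IsMid H q ∧ D.InFiber q}.indicator F' q :=
        tsum_subtype {q | IsMid H q ∧ D.InFiber q} F'
    rw [e1, tsum_eq_sum (s := hS.toFinset)]
    · exact Finset.sum_le_sum fun q _ => Set.indicator_le_self _ _ q
    · intro q hq
      by_cases hmem : q ∈ {q | IsMid H q ∧ D.InFiber q}
      · rw [Set.indicator_of_mem hmem]
        obtain ⟨hm, v, hv⟩ := hmem
        refine h0 q fun ⟨p, hp, hpq⟩ => hq ?_
        rw [Set.Finite.mem_toFinset]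
        simp only [S, Set.mem_iUnion]
        have hpv := hv p (List.mem_of_mem_take hpq)
        exact ⟨v, hpv ▸ hp, hv, D.length_le_of_inFiber hm hv⟩
      · rw [Set.indicator_of_notMem hmem]
  exact e.trans_lt (ENNReal.sum_lt_top.2 fun q _ => (h1 q).lt_top)

/-- The factors of two neighbours multiply to `y ^ 2`. If the number of factors is even all of them
pair up; if it is odd, one factor of the colour of `v` remains. The second alternative is multiplied
by `y` to avoid a division. -/
lemma weight_cases (hc : ∀ {v w}, G.Adj v w → χ w = !χ v) {γ : Bool → ℝ≥0∞} {y : ℝ≥0∞}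
    (hy0 : y ≠ 0) (hy : y ≠ ⊤) (hγ : γ true * γ false = y ^ 2) {v : V} {t : List V}
    (ht : (v :: t).IsChain G.Adj) :
    weight χ γ (v :: t) = y ^ t.length ∨ y * weight χ γ (v :: t) = γ (χ v) * y ^ t.length := by
  induction t generalizing v with
  | nil => simp [weight]
  | cons w t ih =>
    rw [List.isChain_cons_cons] at ht
    rw [weight, List.length_cons]
    rcases ih ht.2 with h | h
    · right
      rw [h, pow_succ]
      ring
    · left
      have h2 : γ (χ v) * γ (χ w) = y ^ 2 := by
        rw [hc ht.1]
        cases χ v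
        · rw [mul_comm]; exact hγ
        · exact hγ
      refine (ENNReal.mul_right_inj hy0 hy).1 ?_
      calc y * (γ (χ v) * weight χ γ (w :: t)) = γ (χ v) * (y * weight χ γ (w :: t)) := by ring
        _ = (γ (χ v) * γ (χ w)) * y ^ t.length := by rw [h]; ring
        _ = _ := by rw [h2]; ring

/-- By `weight_cases` the ratio of the weight to the power of `y` takes one of three values, `1`, `γ
true / y` and `γ false / y`. From here on parity and colours play no role. -/
lemma weight_bounds (hc : ∀ {v w}, G.Adj v w → χ w = !χ v) {γ : Bool → ℝ≥0∞} {y : ℝ≥0∞}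
    (hy0 : y ≠ 0) (hy : y ≠ ⊤) (hγ0 : ∀ c, γ c ≠ 0) (hγ1 : ∀ c, γ c ≠ ⊤)
    (hγ : γ true * γ false = y ^ 2) :
    ∃ c C : ℝ≥0∞, c ≠ 0 ∧ C ≠ ⊤ ∧ ∀ q, IsMid G q →
      c * y ^ (q.length - 2) ≤ weight χ γ q.tail ∧ weight χ γ q.tail ≤ C * y ^ (q.length - 2) := by
  refine ⟨min 1 (min (γ true / y) (γ false / y)), max 1 (max (γ true / y) (γ false / y)), ?_, ?_,
    fun q hq => ?_⟩
  · simp [hy, hγ0]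
  · simp [ENNReal.div_eq_top, hy0, hγ1]
  · obtain ⟨u, v, t, rfl⟩ := hq.eq_cons
    have hch := (List.isChain_cons_cons.1 hq.chain).2
    simp only [List.tail_cons, List.length_cons, show t.length + 1 + 1 - 2 = t.length from rfl]
    rcases weight_cases hc hy0 hy hγ hch with h | h
    · rw [h]
      exact ⟨(mul_le_mul_left (min_le_left _ _) _).trans (by rw [one_mul]),
        le_trans (by rw [one_mul]) (mul_le_mul_left (le_max_left _ _) _)⟩
    · have h2 : weight χ γ (v :: t) = γ (χ v) / y * y ^ t.length := by
        refine (ENNReal.mul_right_inj hy0 hy).1 ?_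
        rw [h, ← mul_assoc, ENNReal.mul_div_cancel hy0 hy]
      rw [h2]
      constructor
      · refine mul_le_mul_left ?_ _
        cases χ v <;> simp
      · refine mul_le_mul_left ?_ _
        cases χ v <;> simp

end Decoration

/-! ### Subcritical sums over the walks from one vertex -/

section HeadSum

variable {V : Type u} {G : SimpleGraph V}

lemma sawCount_zero_le (v : V) : sawCount G v 0 ≤ 1 := by
  rw [sawCount_eq_ncard]
  have : sawLists G v 0 ⊆ {[v]} := by
    rintro l ⟨_, _, h3, h4⟩
    match l, h3, h4 with
    | [a], h3, _ => simpa using h3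
  exact (Set.ncard_le_ncard this).trans (by simp)

/-- The vertex lists from `u` of the mid-edge walks of length `n`. -/
def midLists (G : SimpleGraph V) (u : V) (n : ℕ) : Set (List V) :=
  {q | IsMid G q ∧ q.head? = some u ∧ q.length = n + 2}

/-- For `n ≥ 1` the list consists of an edge, a SAW with `n - 1` steps and another edge. Each of the
three pieces contributes a factor `C`, and together they have `n + 1` steps. -/
lemma midLists_card_le (hf : ∀ v, (G.neighborSet v).Finite) {C l : ℝ} (hC : 1 ≤ C) (hl : 1 ≤ l)
    (h : ∀ v n, (sawCount G v n : ℝ) ≤ C * l ^ n) (u : V) (n : ℕ) :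
    (midLists G u n).Finite ∧ ((midLists G u n).ncard : ℝ) ≤ C ^ 3 * l ^ (n + 1) := by
  classical
  set F : V → ℕ → Finset (List V) := fun v n => (sawLists_finite hf v n).toFinset with hF
  have hcard : ∀ v n, ((F v n).card : ℝ) ≤ C * l ^ n := fun v n => by
    refine le_trans (le_of_eq ?_) (h v n)
    rw [sawCount_eq_ncard, Set.ncard_eq_toFinset_card _ (sawLists_finite hf v n)]
  have hmem : ∀ v n l, l ∈ F v n ↔ l ∈ sawLists G v n := fun v n l => Set.Finite.mem_toFinset _
  have hone : ∀ {a b : V}, G.Adj a b → [a, b] ∈ F a 1 := fun {a b} hab => by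
    rw [hmem]; exact ⟨by simpa using hab.ne, by simpa using hab, rfl, rfl⟩
  rcases Nat.eq_zero_or_pos n with rfl | hn
  · have hsub : midLists G u 0 ⊆ (F u 1 : Set (List V)) := by
      rintro q ⟨hq, h1, h2⟩
      match q, h1, h2 with
      | [a, b], h1, _ =>
        obtain rfl : a = u := by simpa using h1
        exact hone (by simpa using hq.chain)
    refine ⟨(Finset.finite_toSet _).subset hsub, ?_⟩
    have := (Set.ncard_le_ncard hsub (Finset.finite_toSet _))
    rw [Set.ncard_coe_finset] at this
    calc ((midLists G u 0).ncard : ℝ) ≤ (F u 1).card := by exact_mod_cast this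
      _ ≤ C * l ^ 1 := hcard u 1
      _ ≤ C ^ 3 * l ^ (0 + 1) := by
        gcongr
        exact le_self_pow₀ hC (by norm_num)
  · set S : Finset (List V) := (F u 1).biUnion fun p => (F (p.getLastD u) (n - 1)).biUnion fun r =>
      (F (r.getLastD u) 1).image fun s => u :: (r ++ s.tail) with hS
    have hsub : midLists G u n ⊆ (S : Set (List V)) := by
      rintro q ⟨hq, h1, h2⟩
      have hne : q.tail.dropLast ≠ [] := by
        intro h
        have := congrArg List.length h
        simp at this; omega
      obtain ⟨a, v, t, rfl⟩ := hq.eq_cons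
      obtain rfl : a = u := by simpa using h1
      rcases List.eq_nil_or_concat (v :: t) with h | ⟨r, b, hr⟩
      · simp at h
      rw [List.concat_eq_append] at hr
      have hin := hq.inner
      have hch := hq.chain
      simp only [List.tail_cons] at hin hne
      rw [hr, List.dropLast_concat] at hin hne
      have hav := (List.isChain_cons_cons.1 hch).1
      have hch2 := (List.isChain_cons_cons.1 hch).2
      rw [hr, List.isChain_append] at hch2
      have hrl : r.getLast? = some (r.getLast hne) := List.getLast?_eq_some_getLast hne
      have hrh : r.head? = some v := by
        match r, hne with
        | c :: r, _ =>
          simp only [List.cons_append, List.cons.injEq] at hr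
          simp [hr.1]
      have hlen : r.length = n := by
        have := congrArg List.length hr
        simp at this h2; omega
      have hgl : r.getLastD a = r.getLast hne := by
        rw [List.getLastD_eq_getLast?, hrl]; rfl
      simp only [hS, Finset.coe_biUnion, Set.mem_iUnion, Finset.coe_image, Set.mem_image,
        Finset.mem_coe]
      refine ⟨[a, v], hone hav, r, ?_, [r.getLast hne, b], ?_, ?_⟩
      · rw [hmem]
        exact ⟨hin, hch2.1, by simpa using hrh, by omega⟩
      · rw [hgl]
        exact hone (hch2.2.2 _ hrl b rfl)
      · simp [hr]
    refine ⟨(Finset.finite_toSet _).subset hsub, ?_⟩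
    have h1 := (Set.ncard_le_ncard hsub (Finset.finite_toSet _))
    rw [Set.ncard_coe_finset] at h1
    have hC0 : 0 ≤ C := by linarith
    have hl0 : 0 ≤ l := by linarith
    have h2 : (S.card : ℝ) ≤ ∑ p ∈ F u 1, ∑ r ∈ F (p.getLastD u) (n - 1),
        ((F (r.getLastD u) 1).card : ℝ) := by
      have : S.card ≤ ∑ p ∈ F u 1, ∑ r ∈ F (p.getLastD u) (n - 1), (F (r.getLastD u) 1).card :=
        Finset.card_biUnion_le.trans (Finset.sum_le_sum fun p _ => Finset.card_biUnion_le.trans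
          (Finset.sum_le_sum fun r _ => Finset.card_image_le))
      exact_mod_cast this
    calc ((midLists G u n).ncard : ℝ) ≤ S.card := by exact_mod_cast h1
      _ ≤ _ := h2
      _ ≤ ∑ p ∈ F u 1, ∑ r ∈ F (p.getLastD u) (n - 1), C * l ^ 1 :=
        Finset.sum_le_sum fun p _ => Finset.sum_le_sum fun r _ => hcard _ _
      _ = ∑ p ∈ F u 1, (F (p.getLastD u) (n - 1)).card * (C * l ^ 1) := by
        simp [Finset.sum_const]
      _ ≤ ∑ p ∈ F u 1, (C * l ^ (n - 1)) * (C * l ^ 1) :=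
        Finset.sum_le_sum fun p _ => mul_le_mul_of_nonneg_right (hcard _ _) (by positivity)
      _ = (F u 1).card * ((C * l ^ (n - 1)) * (C * l ^ 1)) := by simp [Finset.sum_const]
      _ ≤ C * l ^ 1 * ((C * l ^ (n - 1)) * (C * l ^ 1)) :=
        mul_le_mul_of_nonneg_right (hcard _ _) (by positivity)
      _ = C ^ 3 * l ^ (n + 1) := by
        obtain ⟨k, rfl⟩ := Nat.exists_eq_add_of_le hn
        rw [Nat.add_sub_cancel_left]
        ring

lemma tsum_indicator_const {α : Type*} {S : Set α} (hS : S.Finite) (c : ℝ≥0∞) :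
    ∑' a, S.indicator (fun _ => c) a = S.ncard * c := by
  rw [tsum_eq_sum (s := hS.toFinset)]
  · rw [Finset.sum_congr rfl (g := fun _ => c)
      fun a ha => Set.indicator_of_mem (hS.mem_toFinset.1 ha) _]
    rw [Finset.sum_const, nsmul_eq_mul, Set.ncard_eq_toFinset_card _ hS]
  · intro a ha
    exact Set.indicator_of_notMem (fun h => ha (hS.mem_toFinset.2 h)) _

-- For `y < μ⁻¹` some rate `l > μ` still has `l * y < 1`, and the sum is dominated by a geometric
-- series that is the same for all starting points.
open Classical in
lemma headSum_le (hf : ∀ v, (G.neighborSet v).Finite) {μ y : ℝ} (hμ : 1 ≤ μ)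
    (hu : UpperGrowth G μ) (hy0 : 0 ≤ y) (hy : y < μ⁻¹) :
    ∃ C : ℝ≥0∞, C ≠ ⊤ ∧ ∀ u, midSum G (fun q => if q.head? = some u then
      ENNReal.ofReal y ^ (q.length - 2) else 0) ≤ C := by
  obtain ⟨l, hl1, hl2⟩ : ∃ l, μ < l ∧ l * y < 1 := by
    rcases hy0.eq_or_lt with rfl | hy0
    · exact ⟨μ + 1, by linarith, by simp⟩
    · have hμy : μ < y⁻¹ := (lt_inv_comm₀ hy0 (by linarith)).1 hy
      obtain ⟨l, h1, h2⟩ := exists_between hμy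
      refine ⟨l, h1, ?_⟩
      rwa [lt_inv_comm₀ (by linarith) hy0, ← one_div, lt_div_iff₀' (by linarith)] at h2
  have hl0 : 1 ≤ l := by linarith
  obtain ⟨C, hC, hC'⟩ := hu l hl1
  have hCu : ∀ v n, (sawCount G v n : ℝ) ≤ max C 1 * l ^ n := fun v n =>
    (hC' v n).trans (by gcongr; exact le_max_left _ _)
  refine ⟨∑' n : ℕ, ENNReal.ofReal (max C 1 ^ 3 * l * (l * y) ^ n), ?_, fun u => ?_⟩
  · rw [← ENNReal.ofReal_tsum_of_nonneg (fun n => by positivity)]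
    · exact ENNReal.ofReal_ne_top
    · exact (summable_geometric_of_lt_one (by positivity) hl2).mul_left _
  · calc _ ≤ ∑' q : {q // IsMid G q}, ∑' n : ℕ,
          (midLists G u n).indicator (fun _ => ENNReal.ofReal y ^ n) q.1 := by
          refine ENNReal.tsum_le_tsum fun q => ?_
          simp only
          split_ifs with hq
          · refine le_trans (le_of_eq ?_) (ENNReal.le_tsum (q.1.length - 2))
            rw [Set.indicator_of_mem]
            exact ⟨q.2, hq, by have := q.2.two_le; omega⟩
          · exact zero_le
      _ = ∑' n : ℕ, ∑' q : {q // IsMid G q},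
          (midLists G u n).indicator (fun _ => ENNReal.ofReal y ^ n) q.1 := ENNReal.tsum_comm
      _ ≤ ∑' n : ℕ, ∑' q : List V,
          (midLists G u n).indicator (fun _ => ENNReal.ofReal y ^ n) q :=
          ENNReal.tsum_le_tsum fun n =>
            ENNReal.tsum_comp_le_tsum_of_injective Subtype.val_injective _
      _ ≤ _ := by
          refine ENNReal.tsum_le_tsum fun n => ?_
          obtain ⟨h1, h2⟩ := midLists_card_le hf (le_max_right C 1) hl0 hCu u n
          rw [tsum_indicator_const h1, ← ENNReal.ofReal_pow hy0, ← ENNReal.ofReal_natCast,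
            ← ENNReal.ofReal_mul (by positivity)]
          refine ENNReal.ofReal_le_ofReal ?_
          calc ((midLists G u n).ncard : ℝ) * y ^ n ≤ max C 1 ^ 3 * l ^ (n + 1) * y ^ n := by gcongr
            _ = _ := by ring

end HeadSum

/-! ### The critical point -/

/-- The properties of the generating functions of the traversals of a gadget. -/
structure IsGenFun (g : ℝ → ℝ) : Prop where
  cont : Continuous g
  zero : g 0 = 0
  one : 1 ≤ g 1
  pos : ∀ x, 0 < x → 0 < g x
  scale : ∀ t x, 0 ≤ t → t ≤ 1 → 0 ≤ x → g (t * x) ≤ t * g x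

lemma IsGenFun.nonneg {g : ℝ → ℝ} (h : IsGenFun g) {x : ℝ} (hx : 0 ≤ x) : 0 ≤ g x := by
  rcases hx.eq_or_lt with rfl | hx
  · exact h.zero.ge
  · exact (h.pos x hx).le

/-- Intermediate value theorem on `[0, 1]`: the product vanishes at `0`, and at `1` it is at least
`1 ≥ μ⁻¹ ^ 2`. -/
lemma exists_critical {g : Bool → ℝ → ℝ} (hg : ∀ c, IsGenFun (g c)) {μ : ℝ} (hμ : 1 ≤ μ) :
    ∃ x, 0 < x ∧ x ≤ 1 ∧ g true x * g false x = μ⁻¹ ^ 2 := by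
  have hμ' : 0 < μ⁻¹ := by positivity
  have hμ1 : μ⁻¹ ≤ 1 := inv_le_one_of_one_le₀ hμ
  have hc : ContinuousOn (fun x => g true x * g false x) (Icc 0 1) :=
    ((hg true).cont.mul (hg false).cont).continuousOn
  have h := intermediate_value_Icc (zero_le_one (α := ℝ)) hc
  have hmem : μ⁻¹ ^ 2 ∈ Icc (g true 0 * g false 0) (g true 1 * g false 1) := by
    rw [(hg true).zero]
    have h1 := (hg true).one
    have h2 := (hg false).one
    constructor
    · rw [zero_mul]; positivity
    · nlinarith
  obtain ⟨x, ⟨hx0, hx1⟩, hx⟩ := h hmem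
  refine ⟨x, lt_of_le_of_ne hx0 ?_, hx1, hx⟩
  rintro rfl
  simp only [(hg true).zero, zero_mul] at hx
  have : 0 < μ⁻¹ ^ 2 := by positivity
  linarith

/-! ### The connective constant of the decorated graph -/

namespace Decoration

variable {V : Type u} {T : Type w} {G : SimpleGraph V} {χ : V → Bool} {H : SimpleGraph T} {K : ℕ}
  (D : Decoration G χ H K)

lemma finite_fiber (v : V) : {p | D.pr p = v}.Finite := by
  refine Set.Finite.of_injOn (f := D.code) (t := Set.univ) (by simp [Set.MapsTo]) ?_ Set.finite_univ
  intro p hp q hq h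
  exact D.code_inj (Eq.trans hp (Eq.symm hq)) h

lemma finite_neighborSet (D : Decoration G χ H K) (hf : ∀ v, (G.neighborSet v).Finite) (p : T) :
    (H.neighborSet p).Finite := by
  refine ((D.finite_fiber (D.pr p)).union ((hf (D.pr p)).image fun w => D.port w (D.pr p))).subset ?_
  intro q hq
  by_cases h : D.pr p = D.pr q
  · exact Or.inl h.symm
  · obtain ⟨h1, h2, h3⟩ := D.cross hq h
    exact Or.inr ⟨D.pr q, h1, h3.symm⟩

/-- `g` gives the generating functions of the traversals of the fibers. -/
def HasGen (g : Bool → ℝ → ℝ) : Prop :=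
  ∀ x, 0 ≤ x → D.IsGen (ENNReal.ofReal x) fun c => ENNReal.ofReal (g c x)

lemma sum_sawLists_eq {W : Type*} {H : SimpleGraph W} (hf : ∀ v, (H.neighborSet v).Finite)
    (X : ℝ≥0∞) (v : W) (n : ℕ) (f : List W → ℝ≥0∞)
    (h : ∀ q ∈ sawLists H v n, f q = X) :
    ∑' q : sawLists H v n, f q.1 = sawCount H v n * X := by
  rw [sawCount_eq_ncard, ← tsum_indicator_const (sawLists_finite hf v n), tsum_subtype]
  refine tsum_congr fun q => ?_
  by_cases hq : q ∈ sawLists H v n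
  · rw [Set.indicator_of_mem hq, Set.indicator_of_mem hq, h q hq]
  · rw [Set.indicator_of_notMem hq, Set.indicator_of_notMem hq]

/-- For `x < x₀` the number `y` with `y ^ 2 = h(x)` is below `μ⁻¹`, so the sum over the walks of `G`
from a vertex is bounded uniformly. The comparison of sums bounds the generating function at `x` of
the walks of `H` from any `p` by one constant `B`, hence also every single term of it. -/
theorem upperGrowth (hf : ∀ v, (G.neighborSet v).Finite) {μ : ℝ} (hμ : 1 ≤ μ)
    (hu : UpperGrowth G μ) {g : Bool → ℝ → ℝ} (hg : ∀ c, IsGenFun (g c)) (hD : D.HasGen g)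
    {x₀ : ℝ} (hx0 : 0 < x₀) (hx1 : x₀ ≤ 1) (hx : g true x₀ * g false x₀ = μ⁻¹ ^ 2) :
    UpperGrowth H x₀⁻¹ := by
  classical
  intro l hl
  have hl0 : 0 < l := (inv_pos.2 hx0).trans hl
  set x := l⁻¹ with hxdef
  have hxpos : 0 < x := by positivity
  have hxlt : x < x₀ := inv_lt_of_inv_lt₀ hx0 hl
  -- The inequality is strict because `g (t * x) ≤ t * g x` for both factors, here with `t = x / x₀
  -- < 1`.
  have hh : g true x * g false x < μ⁻¹ ^ 2 := by
    have ht0 : 0 < x / x₀ := by positivity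
    have ht1 : x / x₀ < 1 := (div_lt_one hx0).2 hxlt
    have e : x / x₀ * x₀ = x := by field_simp
    have h1 := (hg true).scale (x / x₀) x₀ ht0.le ht1.le hx0.le
    have h2 := (hg false).scale (x / x₀) x₀ ht0.le ht1.le hx0.le
    rw [e] at h1 h2
    have h3 := (hg true).pos x₀ hx0
    have h4 := (hg false).pos x₀ hx0
    calc g true x * g false x ≤ (x / x₀ * g true x₀) * (x / x₀ * g false x₀) :=
          mul_le_mul h1 h2 ((hg false).nonneg hxpos.le) (by positivity)
      _ = (x / x₀) ^ 2 * (g true x₀ * g false x₀) := by ring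
      _ < 1 * (g true x₀ * g false x₀) :=
          mul_lt_mul_of_pos_right (pow_lt_one₀ ht0.le ht1 two_ne_zero) (by positivity)
      _ = _ := by rw [one_mul, hx]
  have hpos : 0 < g true x * g false x := mul_pos ((hg true).pos x hxpos) ((hg false).pos x hxpos)
  set y := Real.sqrt (g true x * g false x) with hy
  have hy0 : 0 < y := Real.sqrt_pos.2 hpos
  have hysq : y ^ 2 = g true x * g false x := Real.sq_sqrt hpos.le
  have hyμ : y < μ⁻¹ := by
    rw [← hysq] at hh
    exact lt_of_pow_lt_pow_left₀ 2 (by positivity) hh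
  obtain ⟨C₁, hC₁, hhead⟩ := headSum_le hf hμ hu hy0.le hyμ
  obtain ⟨c₂, C₂, -, hC₂, hw⟩ := weight_bounds (G := G) (χ := χ) D.color
    (γ := fun c => ENNReal.ofReal (g c x)) (y := ENNReal.ofReal y) (by simpa using hy0) (by simp)
    (fun c => by simpa using (hg c).pos x hxpos) (fun c => ENNReal.ofReal_ne_top) (by
      rw [← ENNReal.ofReal_mul ((hg true).nonneg hxpos.le), ← hysq, ENNReal.ofReal_pow hy0.le])
  obtain ⟨C₃, hC₃, hup⟩ := tsum_not_inFiber_le K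
  have hfin := List.finite_length_le (Fin K) (K + 2)
  set B : ℝ≥0∞ := ({l : List (Fin K) | l.length ≤ K + 2}.ncard : ℝ≥0∞) + C₃ * (C₂ * C₁) with hB
  have hBtop : B ≠ ⊤ := by
    refine ENNReal.add_ne_top.2 ⟨ENNReal.natCast_ne_top _, ?_⟩
    exact ENNReal.mul_ne_top hC₃ (ENNReal.mul_ne_top hC₂ hC₁)
  have hX1 : ENNReal.ofReal x ≤ 1 := by
    rw [ENNReal.ofReal_le_one]; linarith
  have main : ∀ p, midSum H (fun q => if q.head? = some p then
      ENNReal.ofReal x ^ (q.length - 2) else 0) ≤ B := by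
    intro p
    rw [D.midSum_eq_add]
    refine add_le_add ?_ ?_
    · set S : Set (List T) := {q | (∀ a ∈ q, D.pr a = D.pr p) ∧ q.length ≤ K + 2} with hS
      have hSf : S.Finite := D.finite_fiberLists _ _
      calc _ ≤ ∑' q : {q // IsMid H q ∧ D.InFiber q}, S.indicator (fun _ => (1 : ℝ≥0∞)) q.1 := by
            refine ENNReal.tsum_le_tsum fun ⟨q, hq, v, hv⟩ => ?_
            simp only
            split_ifs with h
            · have hpv := hv p (List.mem_of_head? h)
              rw [Set.indicator_of_mem]
              · exact pow_le_one₀ zero_le hX1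
              · exact ⟨fun a ha => (hv a ha).trans hpv.symm, D.length_le_of_inFiber hq hv⟩
            · exact zero_le
        _ ≤ ∑' q, S.indicator (fun _ => (1 : ℝ≥0∞)) q :=
            ENNReal.tsum_comp_le_tsum_of_injective Subtype.val_injective _
        _ = S.ncard := by rw [tsum_indicator_const hSf, mul_one]
        _ ≤ _ := by
            have := Set.ncard_le_ncard_of_injOn (s := S)
              (t := {l : List (Fin K) | l.length ≤ K + 2}) (List.map D.code)
              (fun q hq => by simpa using hq.2)
              ((D.map_code_injOn (D.pr p)).mono fun q hq => hq.1) hfin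
            exact_mod_cast this
    · refine (hup D (hD x hxpos.le) (fun q => if q.head? = some (D.pr p) then 1 else 0)
        (fun q => if q.head? = some p then ENNReal.ofReal x ^ (q.length - 2) else 0) ?_).trans ?_
      · intro q' q s hq' hq hs h1 h2 h3 _ _
        split_ifs with h4 h5 h5
        · rw [one_mul]
          exact pow_le_pow_right_of_le_one' hX1 (by omega)
        · rw [h4] at h3
          exact absurd h3.symm h5
        · exact zero_le
        · exact zero_le
      · gcongr
        refine le_trans ?_ (mul_le_mul_right (hhead (D.pr p)) C₂)
        unfold midSum
        rw [← ENNReal.tsum_mul_left]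
        refine ENNReal.tsum_le_tsum fun q => ?_
        simp only
        split_ifs
        · rw [one_mul]; exact (hw q.1 q.2).2
        · simp
  have hbound : ∀ p n, 1 ≤ n → (sawCount H p n : ℝ) * x ^ (n - 1) ≤ B.toReal := by
    intro p n hn
    have h1 : (sawCount H p n : ℝ≥0∞) * ENNReal.ofReal x ^ (n - 1) ≤ B := by
      rw [← sum_sawLists_eq (D.finite_neighborSet hf) (ENNReal.ofReal x ^ (n - 1)) p n
        (fun q => if q.head? = some p then ENNReal.ofReal x ^ (q.length - 2) else 0)]
      · refine le_trans ?_ (main p)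
        have hinj : Function.Injective fun q : sawLists H p n =>
            (⟨q.1, IsMid.of_nodup (by rw [q.2.2.2.2]; omega) q.2.2.1 q.2.1⟩ : {q // IsMid H q}) := by
          intro a b h
          exact Subtype.ext (congrArg (fun z : {q // IsMid H q} => z.1) h)
        exact ENNReal.tsum_comp_le_tsum_of_injective hinj (fun q : {q // IsMid H q} =>
          if q.1.head? = some p then ENNReal.ofReal x ^ (q.1.length - 2) else 0)
      · intro q hq
        rw [if_pos hq.2.2.1, hq.2.2.2]
        congr 1
    rw [← ENNReal.ofReal_le_iff_le_toReal hBtop, ENNReal.ofReal_mul (by positivity),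
      ENNReal.ofReal_natCast, ENNReal.ofReal_pow hxpos.le]
    exact h1
  refine ⟨B.toReal + 1, by positivity, fun p n => ?_⟩
  have hl1 : 1 ≤ l := le_trans (one_le_inv_iff₀.2 ⟨hx0, hx1⟩) hl.le
  rcases Nat.eq_zero_or_pos n with rfl | hn
  · have : (sawCount H p 0 : ℝ) ≤ 1 := by exact_mod_cast sawCount_zero_le p
    have h0 : 0 ≤ B.toReal := ENNReal.toReal_nonneg
    rw [pow_zero]; linarith
  · have h1 := hbound p n hn
    have h0 : 0 ≤ B.toReal := ENNReal.toReal_nonneg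
    rw [hxdef, inv_pow, ← div_eq_mul_inv, div_le_iff₀ (by positivity)] at h1
    refine h1.trans ?_
    gcongr
    · linarith
    · omega

/-- A lift starts at a port, whereas the walks counted on the right start at `p`. So the initial
port is replaced by a path `A w` in the fiber, fixed for every exit `w`, from `p` to that port; this
costs at most the factor `x ^ K`. The `m` traversed fibers give between `m` and `K * m` steps. -/
lemma sum_sawCount_ge (hf : ∀ v, (G.neighborSet v).Finite) {x : ℝ≥0∞} (hx1 : x ≤ 1)
    {γ : Bool → ℝ≥0∞} (hγ : D.IsGen x γ) (p : T) (m : ℕ) (hm : 1 ≤ m) :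
    ∑' q : sawLists G (D.pr p) m, weight χ γ q.1.tail * x ^ K ≤
      ∑ N ∈ Finset.Icc m (K * m), (sawCount H p N : ℝ≥0∞) * x ^ N := by
  choose A hA1 hA2 hA3 hA4 hA5 using fun w => D.conn p (D.port (D.pr p) w) (D.pr_port _ _).symm
  have hAK : ∀ w, (A w).length ≤ K := fun w => D.length_le_of_nodup (hA3 w) (hA1 w)
  have hA0 : ∀ w, 1 ≤ (A w).length := fun w => List.length_pos_of_mem (List.mem_of_head? (hA4 w))
  have hHf := D.finite_neighborSet hf
  have hmid : ∀ q : sawLists G (D.pr p) m, IsMid G q.1 := fun q =>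
    IsMid.of_nodup (by rw [q.2.2.2.2]; omega) q.2.2.1 q.2.1
  set U : Set (List T) := ⋃ N ∈ Finset.Icc m (K * m), sawLists H p N with hU
  have key : ∀ (q : sawLists G (D.pr p) m) (g : {g // g ∈ D.goodLifts q.1}),
      ∃ w t L, q.1 = D.pr p :: w :: t ∧ g.1 = D.port (D.pr p) w :: L ∧
        L ∈ D.lifts (D.pr p) (w :: t) ∧ (D.pr p :: w :: t).IsChain G.Adj := by
    rintro ⟨q, hq⟩ ⟨g, hg⟩
    obtain ⟨u, w, t, rfl⟩ := (hmid ⟨q, hq⟩).eq_cons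
    obtain ⟨L, hL, rfl⟩ := D.mem_goodLifts.1 hg
    have hu : u = D.pr p := by simpa using hq.2.2.1
    exact ⟨w, t, L, congrArg (· :: w :: t) hu, congrArg (fun z => D.port z w :: L) hu,
      hu ▸ hL, hu ▸ hq.2.1⟩
  choose w t L e1 e2 hL hch using key
  have hlen : ∀ q g, m ≤ (A (w q g) ++ L q g).length - 1 ∧
      (A (w q g) ++ L q g).length - 1 ≤ K * m ∧
      (A (w q g) ++ L q g).length - 1 ≤ g.1.length - 2 + K := by
    intro q g
    have h1 := D.length_of_mem_lifts (hL q g)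
    have h2 := congrArg List.length (e2 q g)
    have h3 := congrArg List.length (e1 q g)
    rw [q.2.2.2.2] at h3
    simp only [List.length_cons] at h2 h3
    have h4 := hAK (w q g)
    have h5 := hA0 (w q g)
    have h6 : ∀ j, m = j + 1 → K * m = K * j + K := fun j hj => by rw [hj, mul_add, mul_one]
    have h7 := h6 (t q g).length (by omega)
    rw [List.length_append]
    omega
  have hmem : ∀ q g, A (w q g) ++ L q g ∈
      sawLists H p ((A (w q g) ++ L q g).length - 1) := by
    intro q g
    have hqn := q.2.1
    rw [e1 q g, List.nodup_cons] at hqn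
    refine ⟨(hA1 _).append (D.nodup_of_mem_lifts hqn.2 (hL q g)) fun a ha ha' => ?_, ?_, ?_, ?_⟩
    · have h1 := hA3 _ a ha
      have h2 := D.pr_mem_of_mem_lifts (hL q g) a ha'
      rw [h1] at h2
      exact hqn.1 h2
    · rw [List.isChain_append]
      refine ⟨hA2 _, D.chain_of_mem_lifts (hch q g) (hL q g), ?_⟩
      rw [hA5, D.head_of_mem_lifts (hL q g)]
      simpa using D.adj_port (List.isChain_cons_cons.1 (hch q g)).1
    · rw [List.head?_append, hA4]; rfl
    · have := hlen q g; omega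
  set Φ : (Σ q : sawLists G (D.pr p) m, {g // g ∈ D.goodLifts q.1}) → U := fun s =>
    ⟨A (w s.1 s.2) ++ L s.1 s.2, by
      rw [hU]
      simp only [Set.mem_iUnion]
      refine ⟨_, ?_, hmem s.1 s.2⟩
      have := hlen s.1 s.2
      rw [Finset.mem_Icc]
      omega⟩ with hΦ
  have hinj : Function.Injective Φ := by
    rintro ⟨q, g⟩ ⟨q', g'⟩ h
    have h := congrArg Subtype.val h
    simp only [hΦ] at h
    have hh := D.head_of_mem_lifts (hL q g)
    have hh' := D.head_of_mem_lifts (hL q' g')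
    obtain ⟨-, hLL⟩ := D.append_cancel (hA3 _) (hA3 _) hh hh'
      (by rw [D.pr_port]; exact (List.isChain_cons_cons.1 (hch q g)).1.ne')
      (by rw [D.pr_port]; exact (List.isChain_cons_cons.1 (hch q' g')).1.ne') h
    have ht := D.eq_of_mem_lifts (hch q g) (hch q' g') (hL q g) (hLL ▸ hL q' g')
    have hq : q = q' := Subtype.ext (by rw [e1 q g, e1 q' g', ht])
    subst hq
    have hg : g = g' := Subtype.ext (by
      rw [e2 q g, e2 q g', hLL, (List.cons.inj ht).1])
    rw [hg]
  calc ∑' q : sawLists G (D.pr p) m, weight χ γ q.1.tail * x ^ K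
      = ∑' q : sawLists G (D.pr p) m, ∑' g : {g // g ∈ D.goodLifts q.1},
          x ^ (g.1.length - 2) * x ^ K := by
        refine tsum_congr fun q => ?_
        rw [← D.sum_goodLifts hγ (hmid q), ENNReal.tsum_mul_right]
        congr 1
        exact (Finset.tsum_subtype (D.goodLifts q.1) (fun g => x ^ (g.length - 2))).symm
    _ = ∑' s : Σ q : sawLists G (D.pr p) m, {g // g ∈ D.goodLifts q.1},
          x ^ (s.2.1.length - 2) * x ^ K :=
        (ENNReal.tsum_sigma' fun s : Σ q : sawLists G (D.pr p) m, {g // g ∈ D.goodLifts q.1} =>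
          x ^ (s.2.1.length - 2) * x ^ K).symm
    _ ≤ ∑' s, x ^ ((Φ s).1.length - 1) := by
        refine ENNReal.tsum_le_tsum fun s => ?_
        rw [← pow_add]
        exact pow_le_pow_right_of_le_one' hx1 (hlen s.1 s.2).2.2
    _ ≤ ∑' q : U, x ^ (q.1.length - 1) :=
        ENNReal.tsum_comp_le_tsum_of_injective hinj (fun q : U => x ^ (q.1.length - 1))
    _ ≤ ∑ N ∈ Finset.Icc m (K * m), ∑' q : sawLists H p N, x ^ (q.1.length - 1) :=
        ENNReal.tsum_biUnion_le (fun q : List T => x ^ (q.length - 1)) _ _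
    _ = _ := by
        refine Finset.sum_congr rfl fun N _ => ?_
        refine sum_sawLists_eq hHf _ p N (fun q => x ^ (q.length - 1)) fun q hq => ?_
        rw [hq.2.2.2, Nat.add_sub_cancel]

/-- At `x₀` the lifts of the `m`-step walks of `G` have total weight of order `sawCount G v m * μ⁻¹
^ m`, which is not exponentially small, where `v` is the projection of `p`. They are spread over the
lengths from `m` to `K * m`, at most linearly many in `m`, so one of these lengths carries a share
large enough for `lowerGrowth_of_frequent`. -/
theorem lowerGrowth (hf : ∀ v, (G.neighborSet v).Finite) {μ : ℝ} (hμ : 1 ≤ μ)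
    (hl : ∀ v, LowerGrowth (sawCount G v) μ)
    {g : Bool → ℝ → ℝ} (hg : ∀ c, IsGenFun (g c)) (hD : D.HasGen g)
    {x₀ : ℝ} (hx0 : 0 < x₀) (hx1 : x₀ ≤ 1) (hx : g true x₀ * g false x₀ = μ⁻¹ ^ 2)
    (hu : UpperGrowth H x₀⁻¹) (p : T) : LowerGrowth (sawCount H p) x₀⁻¹ := by
  refine lowerGrowth_of_frequent (D.finite_neighborSet hf) (inv_pos.2 hx0) hu p K ?_
  have hμ0 : 0 < μ := by linarith
  have hμi : 0 < μ⁻¹ := by positivity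
  obtain ⟨c₂, C₂, hc₂, -, hw⟩ := weight_bounds (G := G) (χ := χ) D.color
    (γ := fun c => ENNReal.ofReal (g c x₀)) (y := ENNReal.ofReal μ⁻¹) (by simpa using hμ0) (by simp)
    (fun c => by simpa using (hg c).pos x₀ hx0) (fun c => ENNReal.ofReal_ne_top) (by
      rw [← ENNReal.ofReal_mul ((hg true).nonneg hx0.le), hx, ENNReal.ofReal_pow hμi.le])
  obtain ⟨c₀, hc₀, hc₀'⟩ : ∃ c₀ : ℝ, 0 < c₀ ∧ ENNReal.ofReal c₀ ≤ c₂ := by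
    refine ⟨(min c₂ 1).toReal, ENNReal.toReal_pos ?_ ?_, ?_⟩
    · simp [hc₂]
    · exact ne_top_of_le_ne_top ENNReal.one_ne_top (min_le_right _ _)
    · rw [ENNReal.ofReal_toReal (ne_top_of_le_ne_top ENNReal.one_ne_top (min_le_right _ _))]
      exact min_le_left _ _
  have core : ∀ m, 1 ≤ m → (sawCount G (D.pr p) m : ℝ) * (c₀ * μ⁻¹ ^ m * x₀ ^ K) ≤
      ∑ N ∈ Finset.Icc m (K * m), (sawCount H p N : ℝ) * x₀ ^ N := by
    intro m hm
    have h1 := D.sum_sawCount_ge hf (x := ENNReal.ofReal x₀) (by rwa [ENNReal.ofReal_le_one])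
      (hD x₀ hx0.le) p m hm
    have h2 : (sawCount G (D.pr p) m : ℝ≥0∞) * ENNReal.ofReal (c₀ * μ⁻¹ ^ m * x₀ ^ K) ≤
        ∑' q : sawLists G (D.pr p) m, weight χ (fun c => ENNReal.ofReal (g c x₀)) q.1.tail *
          ENNReal.ofReal x₀ ^ K := by
      rw [← sum_sawLists_eq hf _ (D.pr p) m
        (fun _ => ENNReal.ofReal (c₀ * μ⁻¹ ^ m * x₀ ^ K)) fun _ _ => rfl]
      refine ENNReal.tsum_le_tsum fun q => ?_
      have hq : IsMid G q.1 := IsMid.of_nodup (by rw [q.2.2.2.2]; omega) q.2.2.1 q.2.1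
      rw [ENNReal.ofReal_mul (by positivity), ENNReal.ofReal_mul hc₀.le, ENNReal.ofReal_pow hμi.le,
        ENNReal.ofReal_pow hx0.le]
      gcongr
      refine le_trans ?_ (hw q.1 hq).1
      rw [q.2.2.2.2]
      refine mul_le_mul' hc₀' (pow_le_pow_right_of_le_one' ?_ (by omega))
      rw [ENNReal.ofReal_le_one]
      exact inv_le_one_of_one_le₀ hμ
    have h3 := h2.trans h1
    rw [← ENNReal.ofReal_natCast, ← ENNReal.ofReal_mul (by positivity)] at h3
    have h4 : ∑ N ∈ Finset.Icc m (K * m), (sawCount H p N : ℝ≥0∞) * ENNReal.ofReal x₀ ^ N =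
        ENNReal.ofReal (∑ N ∈ Finset.Icc m (K * m), (sawCount H p N : ℝ) * x₀ ^ N) := by
      rw [ENNReal.ofReal_sum_of_nonneg fun N _ => by positivity]
      refine Finset.sum_congr rfl fun N _ => ?_
      rw [ENNReal.ofReal_mul (by positivity), ENNReal.ofReal_natCast, ENNReal.ofReal_pow hx0.le]
    rw [h4, ENNReal.ofReal_le_ofReal_iff (Finset.sum_nonneg fun N _ => by positivity)] at h3
    exact h3
  intro l hl0 hlμ
  set s := l * x₀ with hs
  have hs0 : 0 < s := by positivity
  have hs1 : s < 1 := by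
    rw [hs, ← lt_div_iff₀ hx0, one_div]; exact hlμ
  obtain ⟨s', hs', hs'1⟩ := exists_between hs1
  have hs'0 : 0 < s' := hs0.trans hs'
  obtain ⟨c₁, hc₁, hlow⟩ := hl (D.pr p) (s' * μ) (by positivity) (by nlinarith)
  obtain ⟨d, hd, hd'⟩ := exists_mul_le_pow (r := s' / s) (by rwa [one_lt_div hs0])
  -- With this `c`, if all lengths from `m` to `K * m` failed the bound, then a positive number
  -- would be at most half of itself. The factor `d * (2 * m + 2)`, gained from `s < s'`, outweighs
  -- the number of lengths.
  set c : ℝ := c₁ * c₀ * x₀ ^ K * d / (K + 1) with hc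
  have hc0 : 0 < c := by positivity
  have main : ∀ m, 1 ≤ m → ∃ N, m ≤ N ∧ N ≤ K * m ∧ c * l ^ N ≤ (sawCount H p N : ℝ) := by
    intro m hm
    by_contra! hcon
    have h1 := core m hm
    have h2 : ∑ N ∈ Finset.Icc m (K * m), (sawCount H p N : ℝ) * x₀ ^ N ≤
        ∑ N ∈ Finset.Icc m (K * m), c * s ^ m := by
      refine Finset.sum_le_sum fun N hN => ?_
      rw [Finset.mem_Icc] at hN
      calc (sawCount H p N : ℝ) * x₀ ^ N ≤ c * l ^ N * x₀ ^ N := by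
            gcongr; exact (hcon N hN.1 hN.2).le
        _ = c * s ^ N := by rw [hs, mul_pow]; ring
        _ ≤ c * s ^ m := by
            gcongr ?_ * ?_
            exact pow_le_pow_of_le_one hs0.le hs1.le hN.1
    rw [Finset.sum_const, nsmul_eq_mul, Nat.card_Icc] at h2
    have h3 : ((K * m + 1 - m : ℕ) : ℝ) ≤ (K + 1) * (m + 1) := by
      have : K * m + 1 - m ≤ (K + 1) * (m + 1) := by
        have : (K + 1) * (m + 1) = K * m + K + m + 1 := by ring
        omega
      exact_mod_cast this
    have h4 : c₁ * s' ^ m * (c₀ * x₀ ^ K) ≤ (K + 1) * (m + 1) * (c * s ^ m) := by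
      calc c₁ * s' ^ m * (c₀ * x₀ ^ K) = c₁ * (s' * μ) ^ m * (c₀ * μ⁻¹ ^ m * x₀ ^ K) := by
            rw [mul_pow, inv_pow]; field_simp
        _ ≤ (sawCount G (D.pr p) m : ℝ) * (c₀ * μ⁻¹ ^ m * x₀ ^ K) := by
            gcongr; exact hlow m
        _ ≤ _ := h1
        _ ≤ _ := h2
        _ ≤ _ := by gcongr
    have h5 : d * (2 * m + 2) * s ^ m ≤ s' ^ m := by
      have := hd' m
      rwa [div_pow, le_div_iff₀ (by positivity)] at this
    have h6 : c₁ * (d * (2 * m + 2) * s ^ m) * (c₀ * x₀ ^ K) ≤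
        (K + 1) * (m + 1) * (c * s ^ m) := le_trans (by gcongr) h4
    have h7 : c₁ * (d * (2 * m + 2) * s ^ m) * (c₀ * x₀ ^ K) =
        2 * ((K + 1) * (m + 1) * (c * s ^ m)) := by
      rw [hc]; field_simp
    have h8 : 0 < (K + 1) * (m + 1) * (c * s ^ m) := by positivity
    linarith
  refine ⟨c, hc0, fun m => ?_⟩
  rcases Nat.eq_zero_or_pos m with rfl | hm
  · obtain ⟨N, h1, h2, h3⟩ := main 1 le_rfl
    exact ⟨N, by omega, by omega, h3⟩
  · obtain ⟨N, h1, h2, h3⟩ := main m hm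
    exact ⟨N, h1, h2.trans (Nat.mul_le_mul_left K (by omega)), h3⟩

end Decoration

/-! ### Comparison of the sums over walks that define the exponents -/

/-- The sum of `ω(|q|) x^{|q|} d(q)` over the mid-edge walks `q` of `H`. -/
noncomputable def weightedSum {V : Type*} (H : SimpleGraph V) (ω : ℕ → ℝ≥0∞) (x : ℝ≥0∞)
    (d : List V → ℝ≥0∞) : ℝ≥0∞ :=
  midSum H fun q => ω (q.length - 2) * x ^ (q.length - 2) * d q

/-- `ω` changes at most by a constant factor between arguments of comparable size. -/
def IsRegularWeight (ω : ℕ → ℝ≥0∞) : Prop :=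
  ∀ K : ℕ, ∃ A : ℝ≥0∞, A ≠ ⊤ ∧ ∀ n n', n ≤ n' → n' ≤ K * n + K → ω n' ≤ A * ω n ∧ ω n ≤ A * ω n'

namespace Decoration

variable {V : Type u} {T : Type w} {G : SimpleGraph V} {χ : V → Bool} {H : SimpleGraph T} {K : ℕ}
  {D : Decoration G χ H K}

/-- `x₀` is the critical point of `H` that corresponds to the critical point `1 / μ` of `G`. -/
structure Critical (D : Decoration G χ H K) (g : Bool → ℝ → ℝ) (μ x₀ : ℝ) : Prop where
  one_le : 1 ≤ μ
  isGenFun : ∀ c, IsGenFun (g c)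
  hasGen : D.HasGen g
  pos : 0 < x₀
  le_one : x₀ ≤ 1
  eq : g true x₀ * g false x₀ = μ⁻¹ ^ 2

/-- The walk `q'` of `H` has its ends over the ends of the walk `q` of `G`. -/
structure EndsOver (D : Decoration G χ H K) (q' : List T) (q : List V) : Prop where
  take : ∀ p ∈ q'.take 2, D.pr p ∈ q.take 2
  drop : ∀ p ∈ q'.drop (q'.length - 2), D.pr p ∈ q.drop (q.length - 2)

/-- At either end the two entries of the lift project onto the two distinct entries below, and so
have no room to project elsewhere. -/
lemma endsOver_of_mem_goodLifts {q : List V} {g : List T} (hq : IsMid G q) (hg : g ∈ D.goodLifts q) :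
    D.EndsOver g q := by
  have two : ∀ (l : List T) (m : List V), l.length = 2 → m.length = 2 → m.Nodup →
      (∀ z ∈ m, ∃ p ∈ l, D.pr p = z) → ∀ p ∈ l, D.pr p ∈ m := by
    intro l m hl hm hn h
    match l, m, hl, hm with
    | [a, b], [c, d], _, _ => simp at hn h ⊢; grind
  have hgm := D.isMid_of_mem_goodLifts hq hg
  have h1 := hq.two_le
  have h2 := hgm.two_le
  have hnd : ∀ l : List V, l.length = 2 → l.IsChain G.Adj → l.Nodup := by
    intro l hl hc
    match l, hl with
    | [a, b], _ => simp at hc ⊢; exact hc.ne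
  exact ⟨two _ _ (by simp; omega) (by simp; omega) (hnd _ (by simp; omega) (hq.chain.take 2))
      (D.take_two_of_mem_goodLifts hg),
    two _ _ (by simp; omega) (by simp; omega) (hnd _ (by simp; omega) (hq.chain.drop _))
      (D.drop_two_of_mem_goodLifts hg)⟩

/-- The comparison of the weighted sums of `G` and `H` at their critical points. -/
theorem Critical.compare {g : Bool → ℝ → ℝ} {μ x₀ : ℝ} (h : D.Critical g μ x₀) {ω : ℕ → ℝ≥0∞}
    (hω : IsRegularWeight ω) {A : ℝ≥0∞} (hA : A ≠ ⊤) :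
    ∃ C : ℝ≥0∞, C ≠ ⊤ ∧ ∀ (d : List V → ℝ≥0∞) (d' : List T → ℝ≥0∞),
      ((∀ q' q, IsMid H q' → IsMid G q → D.EndsOver q' q → d' q' ≤ A * d q) →
        ∑' q : {q // IsMid H q ∧ ¬ D.InFiber q},
          ω (q.1.length - 2) * ENNReal.ofReal x₀ ^ (q.1.length - 2) * d' q.1 ≤
          C * weightedSum G ω (ENNReal.ofReal μ⁻¹) d) ∧
      ((∀ q' q, IsMid H q' → IsMid G q → q' ∈ D.goodLifts q → d q ≤ A * d' q') →
        weightedSum G ω (ENNReal.ofReal μ⁻¹) d ≤ C * weightedSum H ω (ENNReal.ofReal x₀) d') := by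
  have hμi : 0 < μ⁻¹ := inv_pos.2 (by linarith [h.one_le])
  set X := ENNReal.ofReal x₀ with hX
  set Y := ENNReal.ofReal μ⁻¹ with hY
  have hX1 : X ≤ 1 := by rw [hX, ENNReal.ofReal_le_one]; exact h.le_one
  obtain ⟨c₂, C₂, hc₂, hC₂, hw⟩ := weight_bounds (G := G) (χ := χ) D.color
    (γ := fun c => ENNReal.ofReal (g c x₀)) (y := Y) (by simpa [hY] using hμi)
    ENNReal.ofReal_ne_top
    (fun c => by simpa using (h.isGenFun c).pos x₀ h.pos) (fun c => ENNReal.ofReal_ne_top) (by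
      rw [← ENNReal.ofReal_mul ((h.isGenFun true).nonneg h.pos.le), h.eq, ENNReal.ofReal_pow hμi.le])
  obtain ⟨C₃, hC₃, hup⟩ := tsum_not_inFiber_le K
  obtain ⟨B, hB, hωB⟩ := hω (2 * K)
  have hγ := h.hasGen x₀ h.pos.le
  -- A traversal has at most `K` vertices and the end pieces at most `2 * K` together. So the
  -- lengths are comparable in the sense of `IsRegularWeight` with parameter `2 * K`.
  have lens : ∀ {q : List V} {s q' : List T}, IsMid G q → s ∈ D.goodLifts q →
      s.length ≤ q'.length → q'.length ≤ s.length + 2 * K →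
      q.length - 2 ≤ q'.length - 2 ∧ q'.length - 2 ≤ 2 * K * (q.length - 2) + 2 * K := by
    intro q s q' hq hs h1 h2
    have h3 := D.length_of_mem_goodLifts hs
    have h4 := hq.two_le
    have h5 : 2 * K * (q.length - 2) = 2 * (K * (q.length - 2)) := by ring
    omega
  refine ⟨B * A * C₃ * C₂ + B * A * c₂⁻¹, ?_, fun d d' => ⟨fun hd => ?_, fun hd => ?_⟩⟩
  · refine ENNReal.add_ne_top.2 ⟨?_, ?_⟩
    · exact ENNReal.mul_ne_top (ENNReal.mul_ne_top (ENNReal.mul_ne_top hB hA) hC₃) hC₂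
    · exact ENNReal.mul_ne_top (ENNReal.mul_ne_top hB hA) (ENNReal.inv_ne_top.2 hc₂)
  · have h1 := hup D hγ (fun q => B * ω (q.length - 2) * (A * d q))
      (fun q => ω (q.length - 2) * X ^ (q.length - 2) * d' q) (by
        intro q' q s hq' hq hs h1 h2 _ h4 h5
        obtain ⟨e1, e2⟩ := lens hq hs h1 h2
        calc ω (q'.length - 2) * X ^ (q'.length - 2) * d' q'
            ≤ (B * ω (q.length - 2)) * X ^ (s.length - 2) * (A * d q) := by
              refine mul_le_mul' (mul_le_mul' (hωB _ _ e1 e2).1 ?_) (hd q' q hq' hq ⟨h4, h5⟩)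
              exact pow_le_pow_right_of_le_one' hX1 (by omega)
          _ = _ := by ring)
    refine h1.trans ?_
    rw [add_mul]
    refine le_trans ?_ (le_self_add)
    have h2 : midSum G (fun q => B * ω (q.length - 2) * (A * d q) *
        weight χ (fun c => ENNReal.ofReal (g c x₀)) q.tail) ≤
        B * A * C₂ * weightedSum G ω Y d := by
      unfold weightedSum midSum
      rw [← ENNReal.tsum_mul_left]
      refine ENNReal.tsum_le_tsum fun q => ?_
      calc _ ≤ B * ω (q.1.length - 2) * (A * d q.1) * (C₂ * Y ^ (q.1.length - 2)) :=
            mul_le_mul' le_rfl (hw q.1 q.2).2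
        _ = _ := by ring
    calc _ ≤ C₃ * (B * A * C₂ * weightedSum G ω Y d) := mul_le_mul' le_rfl h2
      _ = _ := by ring
  · have h1 := D.midSum_ge hγ (fun q => ω (q.length - 2) * d q)
      (fun q => B * A * (ω (q.length - 2) * X ^ (q.length - 2) * d' q)) (by
        intro q s hq hs hsq
        obtain ⟨e1, e2⟩ := lens hq hsq le_rfl (by omega)
        calc ω (q.length - 2) * d q * X ^ (s.length - 2)
            ≤ (B * ω (s.length - 2)) * (A * d' s) * X ^ (s.length - 2) := by
              exact mul_le_mul' (mul_le_mul' (hωB _ _ e1 e2).2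
                (hd s q hs hq hsq)) le_rfl
          _ = _ := by ring)
    have h2 : weightedSum G ω Y d ≤ c₂⁻¹ * midSum G (fun q => ω (q.length - 2) * d q *
        weight χ (fun c => ENNReal.ofReal (g c x₀)) q.tail) := by
      unfold weightedSum midSum
      rw [← ENNReal.tsum_mul_left]
      refine ENNReal.tsum_le_tsum fun q => ?_
      have h3 := (hw q.1 q.2).1
      have h4 : Y ^ (q.1.length - 2) ≤
          c₂⁻¹ * weight χ (fun c => ENNReal.ofReal (g c x₀)) q.1.tail := by
        -- `weight_bounds` does not exclude `c₂ = ⊤` by itself; with a walk at hand, the finite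
        -- upper bound does.
        rcases eq_or_ne c₂ ⊤ with rfl | hct
        · have : Y ^ (q.1.length - 2) ≠ 0 := pow_ne_zero _ (by simpa [hY] using hμi)
          have h5 := (hw q.1 q.2).2
          rw [ENNReal.top_mul this, top_le_iff] at h3
          rw [h3, top_le_iff] at h5
          exact absurd h5 (ENNReal.mul_ne_top hC₂ (ENNReal.pow_ne_top ENNReal.ofReal_ne_top))
        · calc Y ^ (q.1.length - 2) = c₂⁻¹ * (c₂ * Y ^ (q.1.length - 2)) := by
                rw [← mul_assoc, ENNReal.inv_mul_cancel hc₂ hct, one_mul]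
            _ ≤ _ := mul_le_mul' le_rfl h3
      calc _ ≤ ω (q.1.length - 2) *
            (c₂⁻¹ * weight χ (fun c => ENNReal.ofReal (g c x₀)) q.1.tail) * d q.1 :=
              mul_le_mul' (mul_le_mul' le_rfl h4) le_rfl
        _ = _ := by ring
    have h3 : midSum H (fun q => B * A * (ω (q.length - 2) * X ^ (q.length - 2) * d' q)) =
        B * A * weightedSum H ω X d' := by
      unfold weightedSum midSum
      rw [ENNReal.tsum_mul_left]
    rw [add_mul]
    refine le_trans ?_ le_add_self
    calc _ ≤ _ := h2
      _ ≤ c₂⁻¹ * (B * A * weightedSum H ω X d') := mul_le_mul' le_rfl (h1.trans h3.le)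
      _ = _ := by ring

open Classical in
/-- The indicator function of the walks that start in `W`. -/
noncomputable def _root_.startInd {V : Type*} (W : Set V) (q : List V) : ℝ≥0∞ :=
  if StartsAt W q then 1 else 0

end Decoration

/-! ### Existence and uniqueness of thresholds -/

section Threshold

lemma IsThreshold.unique {F : ℝ → ℝ≥0∞} {c d : EReal} (hc : IsThreshold F c)
    (hd : IsThreshold F d) : c = d := by
  by_contra hne
  rcases lt_or_gt_of_ne hne with h | h
  · obtain ⟨r, h1, h2⟩ := EReal.lt_iff_exists_real_btwn.1 h
    exact (hc.2 r h1).ne (hd.1 r h2)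
  · obtain ⟨r, h1, h2⟩ := EReal.lt_iff_exists_real_btwn.1 h
    exact (hd.2 r h1).ne (hc.1 r h2)

lemma exists_isThreshold {F : ℝ → ℝ≥0∞} (hF : Antitone F) : ∃ c, IsThreshold F c := by
  refine ⟨sSup {y : EReal | ∃ r : ℝ, y = r ∧ F r = ⊤}, fun y hy => ?_, fun y hy => ?_⟩
  · obtain ⟨_, ⟨r, rfl, hr⟩, h⟩ := lt_sSup_iff.1 hy
    exact top_le_iff.1 (hr ▸ hF (EReal.coe_lt_coe_iff.1 h).le)
  · rw [lt_top_iff_ne_top]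
    intro h
    exact hy.not_ge (le_sSup ⟨y, rfl, h⟩)

/-- A threshold depends only on where the function is finite, so constant factors and finite
additive errors are harmless. Monotonicity of one function yields existence for both. -/
lemma sameExponent_isThreshold {F F' : ℝ → ℝ≥0∞} (hF : Antitone F)
    (h : ∀ y, F y < ⊤ ↔ F' y < ⊤) : SameExponent (IsThreshold F) (IsThreshold F') := by
  obtain ⟨c, hc⟩ := exists_isThreshold hF
  have h' : ∀ y, F y = ⊤ ↔ F' y = ⊤ := fun y => by
    rw [← not_iff_not, ← Ne, ← Ne, ← lt_top_iff_ne_top, ← lt_top_iff_ne_top, h]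
  have e : ∀ d, IsThreshold F' d ↔ IsThreshold F d := fun d => by
    simp only [IsThreshold, h, h']
  have hu : ∀ d, IsThreshold F d ↔ d = c := fun d =>
    ⟨fun hd => hd.unique hc, fun hd => hd ▸ hc⟩
  exact ⟨c, hu, fun d => (e d).trans (hu d)⟩

end Threshold

/-! ### Sequences that vary slowly enough for the comparison -/

section Regular

/-- A positive sequence that changes at most by a constant factor between arguments of
comparable size. -/
def RegularSeq (f : ℕ → ℝ) : Prop :=
  (∀ n, 1 ≤ n → 0 < f n) ∧ ∀ K : ℕ, ∃ A, 0 < A ∧ ∀ n n', 1 ≤ n → n ≤ n' → n' ≤ K * n →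
    f n' ≤ A * f n ∧ f n ≤ A * f n'

lemma RegularSeq.mul {f g : ℕ → ℝ} (hf : RegularSeq f) (hg : RegularSeq g) :
    RegularSeq fun n => f n * g n := by
  refine ⟨fun n hn => mul_pos (hf.1 n hn) (hg.1 n hn), fun K => ?_⟩
  obtain ⟨A, hA, h1⟩ := hf.2 K
  obtain ⟨B, hB, h2⟩ := hg.2 K
  refine ⟨A * B, by positivity, fun n n' hn hnn' hn' => ?_⟩
  have f1 := hf.1 n hn
  have f2 := hf.1 n' (hn.trans hnn')
  have g1 := hg.1 n hn
  have g2 := hg.1 n' (hn.trans hnn')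
  obtain ⟨a1, a2⟩ := h1 n n' hn hnn' hn'
  obtain ⟨b1, b2⟩ := h2 n n' hn hnn' hn'
  constructor
  · calc f n' * g n' ≤ (A * f n) * (B * g n) := mul_le_mul a1 b1 g2.le (by positivity)
      _ = _ := by ring
  · calc f n * g n ≤ (A * f n') * (B * g n') := mul_le_mul a2 b2 g1.le (by positivity)
      _ = _ := by ring

lemma RegularSeq.inv {f : ℕ → ℝ} (hf : RegularSeq f) : RegularSeq fun n => (f n)⁻¹ := by
  refine ⟨fun n hn => inv_pos.2 (hf.1 n hn), fun K => ?_⟩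
  obtain ⟨A, hA, h1⟩ := hf.2 K
  refine ⟨A, hA, fun n n' hn hnn' hn' => ?_⟩
  have f1 := hf.1 n hn
  have f2 := hf.1 n' (hn.trans hnn')
  obtain ⟨a1, a2⟩ := h1 n n' hn hnn' hn'
  rw [inv_le_iff_one_le_mul₀ f2, inv_le_iff_one_le_mul₀ f1]
  constructor
  · rw [mul_assoc, mul_left_comm, ← div_eq_inv_mul, one_le_div f1]; exact a2
  · rw [mul_assoc, mul_left_comm, ← div_eq_inv_mul, one_le_div f2]; exact a1

lemma rpow_le_mul_rpow {K a b : ℝ} (y : ℝ) (ha : 0 < a) (hab : a ≤ b) (hb : b ≤ K * a) :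
    b ^ y ≤ K ^ |y| * a ^ y ∧ a ^ y ≤ K ^ |y| * b ^ y := by
  have hb0 : 0 < b := ha.trans_le hab
  set t := b / a with ht
  have ht1 : 1 ≤ t := (one_le_div ha).2 hab
  have htK : t ≤ K := (div_le_iff₀ ha).2 hb
  have hbt : b = t * a := by rw [ht]; field_simp
  have ht0 : 0 < t := by linarith
  have key : ∀ z, |z| ≤ |y| → t ^ z ≤ K ^ |y| := fun z hz =>
    calc t ^ z ≤ t ^ |y| := Real.rpow_le_rpow_of_exponent_le ht1 ((le_abs_self z).trans hz)
      _ ≤ K ^ |y| := Real.rpow_le_rpow ht0.le htK (abs_nonneg y)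
  constructor
  · rw [hbt, Real.mul_rpow ht0.le ha.le]
    gcongr
    exact key y le_rfl
  · have : a ^ y = t ^ (-y) * b ^ y := by
      rw [hbt, Real.mul_rpow ht0.le ha.le, ← mul_assoc, ← Real.rpow_add ht0]
      simp
    rw [this]
    gcongr
    exact key (-y) (abs_neg y).le

lemma regularSeq_rpow (y : ℝ) : RegularSeq fun n => (n : ℝ) ^ y := by
  refine ⟨fun n hn => Real.rpow_pos_of_pos (by exact_mod_cast hn) y, fun K =>
    ⟨max 1 (K : ℝ) ^ |y|, by positivity, fun n n' hn hnn' hn' => ?_⟩⟩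
  refine rpow_le_mul_rpow y (by exact_mod_cast hn) (by exact_mod_cast hnn') ?_
  calc (n' : ℝ) ≤ K * n := by exact_mod_cast hn'
    _ ≤ max 1 (K : ℝ) * n := by gcongr; exact le_max_right _ _

/-- Only the index `0`, where the value is set to `1`, is new. It is compared with the indices up to
`K`, and `B` covers these finitely many ratios. For `n ≥ 1` one has `K * n + K ≤ 2 * K * n`. -/
lemma RegularSeq.isRegularWeight {f : ℕ → ℝ} (hf : RegularSeq f) :
    IsRegularWeight fun n => ENNReal.ofReal (if n = 0 then 1 else f n) := by
  intro K
  obtain ⟨A, hA, h⟩ := hf.2 (2 * K)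
  set g : ℕ → ℝ := fun n => if n = 0 then 1 else f n with hg
  have hg0 : ∀ n, 0 < g n := by
    intro n
    simp only [hg]
    split_ifs with hn
    · exact one_pos
    · exact hf.1 n (by omega)
  set B := ∑ k ∈ Finset.range (K + 1), (g k + (g k)⁻¹) with hB
  have hB0 : 0 ≤ B := Finset.sum_nonneg fun k _ => by have := hg0 k; positivity
  refine ⟨ENNReal.ofReal (A + B), ENNReal.ofReal_ne_top, fun n n' hnn' hn' => ?_⟩
  rw [← ENNReal.ofReal_mul (by positivity), ← ENNReal.ofReal_mul (by positivity)]
  suffices g n' ≤ (A + B) * g n ∧ g n ≤ (A + B) * g n' from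
    ⟨ENNReal.ofReal_le_ofReal this.1, ENNReal.ofReal_le_ofReal this.2⟩
  have p1 := hg0 n
  have p2 := hg0 n'
  rcases Nat.eq_zero_or_pos n with rfl | hn
  · have h1 : g 0 = 1 := by simp [hg]
    have h2 : g n' + (g n')⁻¹ ≤ B :=
      Finset.single_le_sum (f := fun k => g k + (g k)⁻¹)
        (fun k _ => by have := hg0 k; positivity) (Finset.mem_range.2 (by omega))
    have p3 : 0 < (g n')⁻¹ := by positivity
    rw [h1]
    constructor
    · linarith
    · have : (g n')⁻¹ * g n' = 1 := inv_mul_cancel₀ p2.ne'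
      nlinarith
  · have e1 : g n = f n := by simp [hg, hn.ne']
    have e2 : g n' = f n' := by simp [hg, show n' ≠ 0 by omega]
    have := h n n' hn hnn' (by nlinarith)
    rw [← e1, ← e2] at this
    constructor <;> nlinarith

lemma isRegularWeight_one : IsRegularWeight fun _ => 1 := fun _ =>
  ⟨1, ENNReal.one_ne_top, fun _ _ _ _ => by simp⟩

end Regular

/-! ### The defining series as weighted sums over vertex lists -/

section Series

variable {V : Type u} {G : SimpleGraph V}

/-- The coefficients of the series that defines the exponent `γ`. -/
noncomputable def weightY (y : ℝ) (n : ℕ) : ℝ≥0∞ :=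
  ENNReal.ofReal (if n = 0 then 1 else ((n : ℝ) ^ y)⁻¹)

lemma tsum_subtype_eq_tsum_ite {α : Type*} (P : α → Prop) (f : α → ℝ≥0∞) [DecidablePred P] :
    ∑' a : {a // P a}, f a.1 = ∑' a, if P a then f a else 0 := by
  refine (tsum_subtype {a | P a} f).trans (tsum_congr fun a => ?_)
  by_cases h : P a <;> simp [Set.indicator, h]

lemma seriesY_lt_top_iff {W : Set V} {x : ℝ} (hx : 0 ≤ x) (y : ℝ) :
    seriesY G W x y < ⊤ ↔
      weightedSum G (weightY y) (ENNReal.ofReal x) (startInd W) < ⊤ := by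
  classical
  have e : seriesY G W x y = ∑' π : Σ n, MidSAW G n, if π.2.first ∈ incidentEdges G W then
      weightY y π.1 * ENNReal.ofReal x ^ π.1 else 0 := by
    rw [← tsum_subtype_eq_tsum_ite]
    refine tsum_congr fun π => ?_
    rw [weightY, ← ENNReal.ofReal_pow hx, ← ENNReal.ofReal_mul, mul_comm, div_eq_mul_inv]
    · congr 2
      split_ifs <;> simp
    · split_ifs <;> positivity
  have key : ∀ q (hq : IsMid G q), (if hq.toMidSAW.first ∈ incidentEdges G W then
      weightY y (q.length - 2) * ENNReal.ofReal x ^ (q.length - 2) else 0) =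
      weightY y (q.length - 2) * ENNReal.ofReal x ^ (q.length - 2) * startInd W q := by
    intro q hq
    rw [startInd]
    simp only [hq.first_mem_iff]
    split_ifs <;> simp
  constructor
  · intro h
    refine lt_of_le_of_lt (midSum_le_tsum_midSAW (fun π => if π.2.first ∈ incidentEdges G W then
      weightY y π.1 * ENNReal.ofReal x ^ π.1 else 0) _ fun q hq => (key q hq).symm.le) ?_
    rw [← e]
    exact ENNReal.mul_lt_top (by simp) h
  · intro h
    rw [e]
    exact lt_of_le_of_lt (tsum_midSAW_le_midSum _ _ fun q hq => (key q hq).le) h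

lemma seriesY_antitone {W : Set V} {x : ℝ} (hx : 0 ≤ x) : Antitone fun y => seriesY G W x y := by
  intro y y' h
  refine ENNReal.tsum_le_tsum fun π => ENNReal.ofReal_le_ofReal ?_
  split_ifs with h0
  · rfl
  · have h1 : (1 : ℝ) ≤ π.1.1 := by exact_mod_cast Nat.one_le_iff_ne_zero.2 h0
    gcongr

open Classical in
/-- The indicator function of the walks that start in `W` and end in `T`. -/
noncomputable def startEndInd (W T : Set V) (q : List V) : ℝ≥0∞ :=
  if StartsAt W q ∧ EndsAt T q then 1 else 0

lemma seriesZ_bounds {W T : Set V} {x : ℝ} (hx : 0 ≤ x) :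
    seriesZ G W T x ≤ weightedSum G (fun _ => 1) (ENNReal.ofReal x) (startEndInd W T) ∧
      weightedSum G (fun _ => 1) (ENNReal.ofReal x) (startEndInd W T) ≤ 2 * seriesZ G W T x := by
  classical
  have e : seriesZ G W T x = ∑' π : Σ n, MidSAW G n, if π.2.first ∈ incidentEdges G W ∧
      π.2.last ∈ incidentEdges G T then ENNReal.ofReal x ^ π.1 else 0 := by
    rw [← tsum_subtype_eq_tsum_ite]
    refine tsum_congr fun π => ?_
    rw [← ENNReal.ofReal_pow hx]
  have key : ∀ q (hq : IsMid G q), (if hq.toMidSAW.first ∈ incidentEdges G W ∧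
      hq.toMidSAW.last ∈ incidentEdges G T then ENNReal.ofReal x ^ (q.length - 2) else 0) =
      1 * ENNReal.ofReal x ^ (q.length - 2) * startEndInd W T q := by
    intro q hq
    rw [startEndInd]
    simp only [hq.first_mem_iff, hq.last_mem_iff]
    split_ifs <;> simp
  rw [e]
  exact ⟨tsum_midSAW_le_midSum _ _ fun q hq => (key q hq).le,
    midSum_le_tsum_midSAW _ _ fun q hq => (key q hq).symm.le⟩

end Series

/-! ### The exponent `γ` -/

namespace Decoration

variable {V : Type u} {T : Type w} {G : SimpleGraph V} {χ : V → Bool} {H : SimpleGraph T} {K : ℕ}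
  {D : Decoration G χ H K} {g : Bool → ℝ → ℝ} {μ x₀ : ℝ}

lemma EndsOver.startsAt {W : Set V} {q' : List T} {q : List V} (h : D.EndsOver q' q)
    (hs : StartsAt (D.pr ⁻¹' W) q') : StartsAt W q := by
  obtain ⟨p, hp, hp'⟩ := hs
  exact ⟨D.pr p, hp, h.take p hp'⟩

lemma EndsOver.endsAt {W : Set V} {q' : List T} {q : List V} (h : D.EndsOver q' q)
    (hs : EndsAt (D.pr ⁻¹' W) q') : EndsAt W q := by
  obtain ⟨p, hp, hp'⟩ := hs
  exact ⟨D.pr p, hp, h.drop p hp'⟩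

lemma startsAt_of_mem_goodLifts {W : Set V} {q' : List T} {q : List V} (h : q' ∈ D.goodLifts q)
    (hs : StartsAt W q) : StartsAt (D.pr ⁻¹' W) q' := by
  obtain ⟨z, hz, hz'⟩ := hs
  obtain ⟨p, hp, rfl⟩ := D.take_two_of_mem_goodLifts h z hz'
  exact ⟨p, hz, hp⟩

lemma endsAt_of_mem_goodLifts {W : Set V} {q' : List T} {q : List V} (h : q' ∈ D.goodLifts q)
    (hs : EndsAt W q) : EndsAt (D.pr ⁻¹' W) q' := by
  obtain ⟨z, hz, hz'⟩ := hs
  obtain ⟨p, hp, rfl⟩ := D.drop_two_of_mem_goodLifts h z hz'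
  exact ⟨p, hz, hp⟩

/-- The only walks of `H` that escape the comparison stay in one fiber. Those that start over the
finite set `W` are finitely many, and each of them contributes a finite term. -/
lemma Critical.weightedSum_lt_top_iff (h : D.Critical g μ x₀) {ω : ℕ → ℝ≥0∞}
    (hω : IsRegularWeight ω) (hωt : ∀ n, ω n ≠ ⊤) {A : ℝ≥0∞} (hA : A ≠ ⊤) {W : Set V}
    (hW : W.Finite) (d : List V → ℝ≥0∞) (d' : List T → ℝ≥0∞) (hd't : ∀ q, d' q ≠ ⊤)
    (hd0 : ∀ q, ¬ StartsAt (D.pr ⁻¹' W) q → d' q = 0)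
    (h1 : ∀ q' q, IsMid H q' → IsMid G q → D.EndsOver q' q → d' q' ≤ A * d q)
    (h2 : ∀ q' q, IsMid H q' → IsMid G q → q' ∈ D.goodLifts q → d q ≤ A * d' q') :
    weightedSum G ω (ENNReal.ofReal μ⁻¹) d < ⊤ ↔ weightedSum H ω (ENNReal.ofReal x₀) d' < ⊤ := by
  obtain ⟨C, hC, hCc⟩ := h.compare hω hA
  obtain ⟨hu, hl⟩ := hCc d d'
  constructor
  · intro hlt
    rw [weightedSum, D.midSum_eq_add, ENNReal.add_lt_top]
    constructor
    · refine D.tsum_inFiber_lt_top hW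
        (fun q => ω (q.length - 2) * ENNReal.ofReal x₀ ^ (q.length - 2) * d' q)
        (fun q hq => by simp [hd0 q hq]) fun q => ?_
      exact ENNReal.mul_ne_top (ENNReal.mul_ne_top (hωt _)
        (ENNReal.pow_ne_top ENNReal.ofReal_ne_top)) (hd't q)
    · exact (hu h1).trans_lt (ENNReal.mul_lt_top hC.lt_top hlt)
  · intro hlt
    exact (hl h2).trans_lt (ENNReal.mul_lt_top hC.lt_top hlt)

theorem Critical.sameExponent_gamma (h : D.Critical g μ x₀) {W : Set V} (hW : W.Finite) :
    SameExponent (IsGamma G W μ) (IsGamma H (D.pr ⁻¹' W) x₀⁻¹) := by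
  have hμi : 0 ≤ μ⁻¹ := inv_nonneg.2 (by linarith [h.one_le])
  refine sameExponent_isThreshold (seriesY_antitone hμi) fun y => ?_
  rw [seriesY_lt_top_iff hμi, inv_inv, seriesY_lt_top_iff h.pos.le]
  refine h.weightedSum_lt_top_iff (A := 1) (regularSeq_rpow y).inv.isRegularWeight
    (fun n => ENNReal.ofReal_ne_top) ENNReal.one_ne_top hW _ _ (fun q => ?_) (fun q hq => ?_)
    (fun q' q hq' hq hqq => ?_) fun q' q hq' hq hqq => ?_
  · rw [startInd]; split_ifs <;> simp
  · rw [startInd, if_neg hq]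
  · rw [startInd, startInd]
    by_cases hs : StartsAt (D.pr ⁻¹' W) q'
    · simp [hs, hqq.startsAt hs]
    · simp [hs]
  · rw [startInd, startInd]
    by_cases hs : StartsAt W q
    · simp [hs, startsAt_of_mem_goodLifts hqq hs]
    · simp [hs]

/-! ### Distances -/

lemma exists_walk_of_list {P : List T} (hc : P.IsChain H.Adj) {p q : T} (hp : P.head? = some p)
    (hq : P.getLast? = some q) : ∃ W : H.Walk p q, W.length = P.length - 1 := by
  have hne : P ≠ [] := by rintro rfl; simp at hp
  rw [List.head?_eq_some_head hne, Option.some.injEq] at hp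
  rw [List.getLast?_eq_some_getLast hne, Option.some.injEq] at hq
  subst hp hq
  exact ⟨SimpleGraph.Walk.ofSupport P hne hc, SimpleGraph.Walk.length_ofSupport hne hc⟩

variable (D)

lemma exists_walk_fiber {p q : T} (h : D.pr p = D.pr q) : ∃ W : H.Walk p q, W.length + 1 ≤ K := by
  obtain ⟨P, h1, h2, h3, h4, h5⟩ := D.conn p q h
  obtain ⟨W, hW⟩ := exists_walk_of_list h2 h4 h5
  have := D.length_le_of_nodup h3 h1
  have := List.length_pos_of_mem (List.mem_of_head? h4)
  exact ⟨W, by omega⟩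

/-- Crossing a fiber takes at most `K - 1` steps, and the edge to the next fiber one more. -/
lemma exists_walk_lift {a b : V} (w : G.Walk a b) : ∀ p q, D.pr p = a → D.pr q = b →
    ∃ W : H.Walk p q, W.length ≤ K * (w.length + 1) := by
  induction w with
  | nil =>
    intro p q hp hq
    obtain ⟨W, hW⟩ := D.exists_walk_fiber (hp.trans hq.symm)
    exact ⟨W, by simp; omega⟩
  | cons hab w ih =>
    rename_i a b c
    intro p q hp hq
    obtain ⟨W1, h1⟩ := D.exists_walk_fiber (p := p) (q := D.port a b) (by rw [hp, D.pr_port])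
    obtain ⟨W2, h2⟩ := ih (D.port b a) q (D.pr_port _ _) hq
    refine ⟨W1.append (SimpleGraph.Walk.cons (D.adj_port hab) W2), ?_⟩
    rw [SimpleGraph.Walk.length_append, SimpleGraph.Walk.length_cons, SimpleGraph.Walk.length_cons]
    have : K * (w.length + 1 + 1) = K * (w.length + 1) + K := by ring
    omega

lemma exists_walk_proj {p q : T} (W : H.Walk p q) :
    ∃ w : G.Walk (D.pr p) (D.pr q), w.length ≤ W.length := by
  induction W with
  | nil => exact ⟨.nil, le_rfl⟩
  | cons hab W ih =>
    rename_i a b c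
    obtain ⟨w, hw⟩ := ih
    by_cases h : D.pr a = D.pr b
    · rw [h]
      exact ⟨w, by simp; omega⟩
    · exact ⟨.cons (D.cross hab h).1 w, by simpa using hw⟩

lemma connected (D : Decoration G χ H K) (hG : G.Connected) (hT : Nonempty T) : H.Connected := by
  refine { preconnected := fun p q => ?_, nonempty := hT }
  obtain ⟨w⟩ := hG.preconnected (D.pr p) (D.pr q)
  obtain ⟨W, -⟩ := D.exists_walk_lift w p q rfl rfl
  exact ⟨W⟩

lemma dist_le (hG : G.Connected) (p q : T) :
    H.dist p q ≤ K * (G.dist (D.pr p) (D.pr q) + 1) := by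
  obtain ⟨w, hw⟩ := hG.exists_walk_length_eq_dist (D.pr p) (D.pr q)
  obtain ⟨W, hW⟩ := D.exists_walk_lift w p q rfl rfl
  rw [← hw]
  exact (SimpleGraph.dist_le W).trans hW

lemma dist_pr_le (hH : H.Connected) (p q : T) : G.dist (D.pr p) (D.pr q) ≤ H.dist p q := by
  obtain ⟨W, hW⟩ := hH.exists_walk_length_eq_dist p q
  obtain ⟨w, hw⟩ := D.exists_walk_proj W
  rw [← hW]
  exact (SimpleGraph.dist_le w).trans hw

lemma _root_.setDist_le {V : Type*} {G : SimpleGraph V} {W T : Set V} {a b : V} (ha : a ∈ W)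
    (hb : b ∈ T) : setDist G W T ≤ G.dist a b :=
  Nat.sInf_le ⟨a, ha, b, hb, rfl⟩

lemma _root_.exists_setDist_eq {V : Type*} (G : SimpleGraph V) {W T : Set V} (hW : W.Nonempty)
    (hT : T.Nonempty) : ∃ a ∈ W, ∃ b ∈ T, setDist G W T = G.dist a b := by
  obtain ⟨a, ha⟩ := hW
  obtain ⟨b, hb⟩ := hT
  exact Nat.sInf_mem (s := {d : ℕ | ∃ a ∈ W, ∃ b ∈ T, d = G.dist a b}) ⟨_, a, ha, b, hb, rfl⟩

lemma setDist_bounds (hG : G.Connected) (hH : H.Connected) {W S : Set V} (hW : W.Nonempty)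
    (hS : S.Nonempty) (hpr : Function.Surjective D.pr) :
    setDist G W S ≤ setDist H (D.pr ⁻¹' W) (D.pr ⁻¹' S) ∧
      setDist H (D.pr ⁻¹' W) (D.pr ⁻¹' S) ≤ K * (setDist G W S + 1) := by
  constructor
  · obtain ⟨p, hp, q, hq, h⟩ := exists_setDist_eq H (hW.preimage hpr) (hS.preimage hpr)
    rw [h]
    exact (setDist_le (G := G) (show D.pr p ∈ W from hp) (show D.pr q ∈ S from hq)).trans (D.dist_pr_le hH p q)
  · obtain ⟨a, ha, b, hb, h⟩ := exists_setDist_eq G hW hS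
    obtain ⟨p, rfl⟩ := hpr a
    obtain ⟨q, rfl⟩ := hpr b
    rw [h]
    exact (setDist_le (G := H) (show p ∈ D.pr ⁻¹' W from ha) (show q ∈ D.pr ⁻¹' S from hb)).trans
      (D.dist_le hG p q)

/-! ### The exponent `η` -/

variable {D}

/-- The two-point functions of `G` and `H` are comparable. -/
theorem Critical.seriesZ_compare (h : D.Critical g μ x₀) (W : Set V) :
    ∃ C : ℝ≥0∞, C ≠ ⊤ ∧ ∀ S : Set V, Disjoint W S →
      seriesZ G W S μ⁻¹ ≤ C * seriesZ H (D.pr ⁻¹' W) (D.pr ⁻¹' S) x₀ ∧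
      seriesZ H (D.pr ⁻¹' W) (D.pr ⁻¹' S) x₀ ≤ C * seriesZ G W S μ⁻¹ := by
  have hμi : 0 ≤ μ⁻¹ := inv_nonneg.2 (by linarith [h.one_le])
  obtain ⟨C, hC, hCc⟩ := h.compare isRegularWeight_one ENNReal.one_ne_top
  refine ⟨2 * C, ENNReal.mul_ne_top (by simp) hC, fun S hS => ?_⟩
  obtain ⟨hu, hl⟩ := hCc (startEndInd W S) (startEndInd (D.pr ⁻¹' W) (D.pr ⁻¹' S))
  have g1 := seriesZ_bounds (G := G) (W := W) (T := S) hμi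
  have g2 := seriesZ_bounds (G := H) (W := D.pr ⁻¹' W) (T := D.pr ⁻¹' S) h.pos.le
  constructor
  · calc _ ≤ _ := g1.1
      _ ≤ _ := hl fun q' q _ _ hqq => by
        rw [startEndInd, startEndInd]
        by_cases hs : StartsAt W q ∧ EndsAt S q
        · simp [hs, startsAt_of_mem_goodLifts hqq hs.1, endsAt_of_mem_goodLifts hqq hs.2]
        · simp [hs]
      _ ≤ C * (2 * _) := mul_le_mul' le_rfl g2.2
      _ = _ := by ring
  · have h0 : weightedSum H (fun _ => 1) (ENNReal.ofReal x₀)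
        (startEndInd (D.pr ⁻¹' W) (D.pr ⁻¹' S)) =
        ∑' q : {q // IsMid H q ∧ ¬ D.InFiber q}, 1 * ENNReal.ofReal x₀ ^ (q.1.length - 2) *
          startEndInd (D.pr ⁻¹' W) (D.pr ⁻¹' S) q.1 := by
      rw [weightedSum, D.midSum_eq_add]
      convert zero_add _ using 2
      rw [ENNReal.tsum_eq_zero]
      rintro ⟨q, hq, v, hv⟩
      rw [startEndInd, if_neg, mul_zero]
      rintro ⟨⟨a, ha, ha'⟩, ⟨b, hb, hb'⟩⟩
      have ha : D.pr a ∈ W := ha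
      have hb : D.pr b ∈ S := hb
      have e1 := hv a (List.mem_of_mem_take ha')
      have e2 := hv b (List.mem_of_mem_drop hb')
      rw [e1] at ha
      rw [e2] at hb
      exact Set.disjoint_left.1 hS ha hb
    calc _ ≤ _ := g2.1
      _ ≤ _ := by
        rw [h0]
        exact hu fun q' q _ _ hqq => by
          rw [startEndInd, startEndInd]
          by_cases hs : StartsAt (D.pr ⁻¹' W) q' ∧ EndsAt (D.pr ⁻¹' S) q'
          · simp [hs, hqq.startsAt hs.1, hqq.endsAt hs.2]
          · simp [hs]
      _ ≤ C * (2 * _) := mul_le_mul' le_rfl g1.2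
      _ = _ := by ring

/-- The exponent `η` of `H` is an exponent of `G`. -/
theorem Critical.isEta (h : D.Critical g μ x₀) (hG : G.Connected) {W : Set V} (hW : W.Nonempty)
    (hpr : Function.Surjective D.pr) {𝒯 : Set (Set V)} {𝒯' : Set (Set T)}
    (h𝒯 : ∀ S ∈ 𝒯, S.Nonempty ∧ D.pr ⁻¹' S ∈ 𝒯') {η : EReal}
    (hη : IsEta H (D.pr ⁻¹' W) 𝒯' x₀⁻¹ η) : IsEta G W 𝒯 μ η := by
  intro S hS hd s
  have hH : H.Connected := D.connected hG (hW.preimage hpr).to_type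
  obtain ⟨C, hC, hCc⟩ := h.seriesZ_compare W
  have hbd := fun k => D.setDist_bounds hG hH hW (h𝒯 _ (hS k)).1 hpr
  set d : ℕ → ℕ := fun k => setDist G W (S k) with hddef
  set d' : ℕ → ℕ := fun k => setDist H (D.pr ⁻¹' W) (D.pr ⁻¹' S k) with hd'def
  set B := ENNReal.ofReal (((2 * K : ℕ) : ℝ) ^ |s|) with hB
  have hd' : Tendsto d' atTop atTop := tendsto_atTop_mono (fun k => (hbd k).1) hd
  have hη' := hη (fun k => D.pr ⁻¹' S k) (fun k => (h𝒯 _ (hS k)).2) hd' s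
  rw [inv_inv] at hη'
  -- Once the distance `d k` is positive the two sets are disjoint, and `d k ≤ d' k ≤ 2 * K * d k`,
  -- so that the powers of the distances differ by at most the factor `B`.
  have hev : ∀ᶠ k in atTop,
      seriesZ G W (S k) μ⁻¹ * ENNReal.ofReal ((d k : ℝ) ^ s) ≤ C * B *
        (seriesZ H (D.pr ⁻¹' W) (D.pr ⁻¹' S k) x₀ * ENNReal.ofReal ((d' k : ℝ) ^ s)) ∧
      seriesZ H (D.pr ⁻¹' W) (D.pr ⁻¹' S k) x₀ * ENNReal.ofReal ((d' k : ℝ) ^ s) ≤ C * B *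
        (seriesZ G W (S k) μ⁻¹ * ENNReal.ofReal ((d k : ℝ) ^ s)) := by
    filter_upwards [hd.eventually_ge_atTop 1] with k hk
    have hdis : Disjoint W (S k) := by
      rw [Set.disjoint_left]
      intro a ha hb
      have := setDist_le (G := G) ha hb
      simp only [SimpleGraph.dist_self] at this
      change 1 ≤ setDist G W (S k) at hk
      omega
    obtain ⟨z1, z2⟩ := hCc (S k) hdis
    obtain ⟨b1, b2⟩ := hbd k
    obtain ⟨r1, r2⟩ := rpow_le_mul_rpow (K := ((2 * K : ℕ) : ℝ)) (a := d k) (b := d' k) s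
      (by exact_mod_cast hk) (by exact_mod_cast b1) (by
        have : d' k ≤ 2 * K * d k := by
          refine b2.trans ?_
          have : K * (setDist G W (S k) + 1) ≤ K * (2 * d k) := Nat.mul_le_mul_left K (by
            change 1 ≤ setDist G W (S k) at hk
            change _ ≤ 2 * setDist G W (S k)
            omega)
          linarith
        exact_mod_cast this)
    have hK0 : (0 : ℝ) ≤ ((2 * K : ℕ) : ℝ) ^ |s| := by positivity
    have q1 := ENNReal.ofReal_le_ofReal r1
    have q2 := ENNReal.ofReal_le_ofReal r2
    rw [ENNReal.ofReal_mul hK0] at q1 q2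
    constructor
    · calc _ ≤ _ := mul_le_mul' z1 q2
        _ = _ := by ring
    · calc _ ≤ _ := mul_le_mul' z2 q1
        _ = _ := by ring
  have hCB : C * B ≠ ⊤ := ENNReal.mul_ne_top hC ENNReal.ofReal_ne_top
  constructor
  · intro hs
    have h1 := ENNReal.Tendsto.const_mul (hη'.1 hs) (Or.inr hCB)
    rw [mul_zero] at h1
    exact tendsto_of_tendsto_of_tendsto_of_le_of_le' tendsto_const_nhds h1
      (Eventually.of_forall fun _ => zero_le) (hev.mono fun k hk => hk.1)
  · intro hs
    have h1 := hη'.2 hs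
    rw [ENNReal.tendsto_nhds_top_iff_nnreal] at h1 ⊢
    intro r
    have hlt : C * B * r < ⊤ := ENNReal.mul_lt_top hCB.lt_top ENNReal.coe_lt_top
    filter_upwards [hev, h1 (C * B * r).toNNReal] with k hk hk'
    rw [ENNReal.coe_toNNReal hlt.ne] at hk'
    exact lt_of_mul_lt_mul_left' (hk'.trans_le hk.2)

/-- Uniqueness of `η`. -/
lemma _root_.IsEta.unique {V : Type*} {G : SimpleGraph V} {W : Set V} {𝒯 : Set (Set V)} {μ : ℝ}
    {η η' : EReal} (h : IsEta G W 𝒯 μ η) (h' : IsEta G W 𝒯 μ η')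
    (hex : ∃ T : ℕ → Set V, (∀ k, T k ∈ 𝒯) ∧ Tendsto (fun k => setDist G W (T k)) atTop atTop) :
    η = η' := by
  obtain ⟨T, hT, hd⟩ := hex
  by_contra hne
  rcases lt_or_gt_of_ne hne with hlt | hlt
  · obtain ⟨s, h1, h2⟩ := EReal.lt_iff_exists_real_btwn.1 hlt
    exact ENNReal.zero_ne_top
      (tendsto_nhds_unique ((h' T hT hd s).1 h2) ((h T hT hd s).2 h1))
  · obtain ⟨s, h1, h2⟩ := EReal.lt_iff_exists_real_btwn.1 hlt
    exact ENNReal.zero_ne_top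
      (tendsto_nhds_unique ((h T hT hd s).1 h2) ((h' T hT hd s).2 h1))

/-- Existence is passed from `H` to `G` only, since `𝒯'` may contain more than the sets over the
members of `𝒯`. One sequence of translates receding to infinity gives uniqueness in `G`, and the
sets over it give uniqueness in `H`. -/
theorem Critical.sameExponent_eta (h : D.Critical g μ x₀) (hG : G.Connected) {W : Set V}
    (hW : W.Nonempty) (hpr : Function.Surjective D.pr) {𝒯 : Set (Set V)} {𝒯' : Set (Set T)}
    (h𝒯 : ∀ S ∈ 𝒯, S.Nonempty ∧ D.pr ⁻¹' S ∈ 𝒯')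
    (hex : ∃ S : ℕ → Set V, (∀ k, S k ∈ 𝒯) ∧ Tendsto (fun k => setDist G W (S k)) atTop atTop)
    (hη : ∃ η, IsEta H (D.pr ⁻¹' W) 𝒯' x₀⁻¹ η) :
    SameExponent (IsEta G W 𝒯 μ) (IsEta H (D.pr ⁻¹' W) 𝒯' x₀⁻¹) := by
  obtain ⟨η, hη⟩ := hη
  have hH : H.Connected := D.connected hG (hW.preimage hpr).to_type
  have hηG := h.isEta hG hW hpr h𝒯 hη
  refine ⟨η, fun d => ⟨fun hd => hd.unique hηG hex, fun hd => hd ▸ hηG⟩,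
    fun d => ⟨fun hd => hd.unique hη ?_, fun hd => hd ▸ hη⟩⟩
  obtain ⟨S, hS, hd⟩ := hex
  exact ⟨fun k => D.pr ⁻¹' S k, fun k => (h𝒯 _ (hS k)).2,
    tendsto_atTop_mono (fun k => (D.setDist_bounds hG hH hW (h𝒯 _ (hS k)).1 hpr).1) hd⟩

end Decoration

/-! ### Slowly varying functions -/

section SlowVariation

open MeasureTheory

/-- Pointwise convergence implies convergence in measure on a bounded interval. This is the only use
of measurability. -/
lemma volume_tendsto_zero_of_translates {f : ℝ → ℝ} (hf : Measurable f)
    (h : ∀ u, Tendsto (fun x => f (x + u) - f x) atTop (𝓝 0)) (c : ℝ) {x : ℕ → ℝ}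
    (hx : Tendsto x atTop atTop) :
    Tendsto (fun n => volume ({u | 1 ≤ |f (x n + u) - f (x n)|} ∩ Icc 0 c)) atTop (𝓝 0) := by
  have h1 : TendstoInMeasure (volume.restrict (Icc 0 c))
      (fun n u => f (x n + u) - f (x n)) atTop (fun _ => (0 : ℝ)) := by
    refine tendstoInMeasure_of_tendsto_ae (fun n => ?_) (ae_of_all _ fun u => (h u).comp hx)
    exact ((hf.comp (measurable_const_add (x n))).sub_const _).aestronglyMeasurable
  refine (h1 1 one_pos).congr fun n => ?_
  rw [Measure.restrict_apply' measurableSet_Icc]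
  congr 2
  ext u
  simp only [Set.mem_ofPred_eq, edist_zero_right]
  rw [← ofReal_norm, ← ENNReal.ofReal_one, ENNReal.ofReal_le_ofReal_iff (norm_nonneg _),
    Real.norm_eq_abs]

/-- The increments of a measurable function over bounded intervals are eventually uniformly bounded
if they tend to zero pointwise. -/
lemma exists_forall_abs_sub_le {f : ℝ → ℝ} (hf : Measurable f)
    (h : ∀ u, Tendsto (fun x => f (x + u) - f x) atTop (𝓝 0)) (a : ℝ) :
    ∃ X : ℝ, ∀ x ≥ X, ∀ u ∈ Icc 0 a, |f (x + u) - f x| ≤ 2 := by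
  by_contra! hcon
  choose x hx u hu hbad using fun n : ℕ => hcon n
  have hx' : Tendsto x atTop atTop := tendsto_atTop_mono hx tendsto_natCast_atTop_atTop
  have hy' : Tendsto (fun n => x n + u n) atTop atTop :=
    tendsto_atTop_mono (fun n => by linarith [(hu n).1]) hx'
  have h1 := volume_tendsto_zero_of_translates hf h (a + 1) hx'
  have h2 := volume_tendsto_zero_of_translates hf h (a + 1) hy'
  have h3 := h1.add h2
  rw [add_zero] at h3
  obtain ⟨n, hn⟩ := (h3.eventually_lt_const (show (0 : ℝ≥0∞) < 1 by simp)).exists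
  set B := {t | 1 ≤ |f (x n + t) - f (x n)|} ∩ Icc 0 (a + 1)
  set B' := {t | 1 ≤ |f (x n + u n + t) - f (x n + u n)|} ∩ Icc 0 (a + 1)
  obtain ⟨u0, u1⟩ := hu n
  -- The interval has length at least `1`, while the two exceptional sets have total measure below
  -- `1`. A point `t` outside both satisfies `|f (x n + t) - f (x n)| < 1` and `|f (x n + t) - f (x
  -- n + u n)| < 1`, contrary to the assumed increment above `2`.
  have h4 : ¬ Icc (u n) (a + 1) ⊆ B ∪ (fun t => t + (-u n)) ⁻¹' B' := by
    intro hsub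
    have h5 := (measure_mono hsub).trans (measure_union_le (μ := volume) _ _)
    rw [measure_preimage_add_right, Real.volume_Icc] at h5
    have h6 := h5.trans_lt hn
    rw [← ENNReal.ofReal_one, ENNReal.ofReal_lt_ofReal_iff one_pos] at h6
    linarith
  obtain ⟨t, ⟨t0, t1⟩, ht⟩ := Set.not_subset.1 h4
  simp only [B, B', mem_union, mem_inter_iff, mem_preimage, mem_Icc, Set.mem_ofPred_eq, not_or,
    not_and] at ht
  have e1 : |f (x n + t) - f (x n)| < 1 := by
    by_contra! hc
    exact ht.1 hc (by linarith) t1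
  have e2 : |f (x n + u n + (t + -u n)) - f (x n + u n)| < 1 := by
    by_contra! hc
    exact ht.2 hc (by linarith) (by linarith)
  rw [show x n + u n + (t + -u n) = x n + t by ring] at e2
  have := hbad n
  rw [abs_lt] at e1 e2
  rw [lt_abs] at this
  rcases this with h | h <;> linarith [e1.1, e1.2, e2.1, e2.2]

/-- In the variable `log x`, slow variation says that the increments of `log L` tend to zero
pointwise. `exists_forall_abs_sub_le`, for shifts up to `log K`, bounds the ratios by `exp 2` from
some `N` on. -/
lemma SlowlyVarying.regularSeq {L : ℝ → ℝ} (hL : SlowlyVarying L) :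
    RegularSeq fun n => L n := by
  obtain ⟨hm, hpos, ht⟩ := hL
  have hpos' : ∀ n : ℕ, 1 ≤ n → 0 < L n := fun n hn => hpos n (by exact_mod_cast hn)
  refine ⟨hpos', fun K => ?_⟩
  have hlim : ∀ u, Tendsto (fun x => Real.log (L (Real.exp (x + u))) - Real.log (L (Real.exp x)))
      atTop (𝓝 0) := by
    intro u
    have h1 := (Real.continuousAt_log one_ne_zero).tendsto.comp
      ((ht (Real.exp u) (Real.exp_pos u)).comp Real.tendsto_exp_atTop)
    rw [Real.log_one] at h1
    refine h1.congr fun x => ?_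
    have p1 := hpos _ (Real.exp_pos x)
    have p2 := hpos _ (mul_pos (Real.exp_pos u) (Real.exp_pos x))
    simp only [Function.comp]
    rw [Real.log_div p2.ne' p1.ne', add_comm, Real.exp_add]
  obtain ⟨X, hX⟩ := exists_forall_abs_sub_le (f := fun x => Real.log (L (Real.exp x)))
    (Real.measurable_log.comp (hm.comp Real.measurable_exp)) hlim (Real.log K)
  obtain ⟨N, hN⟩ := exists_nat_ge (Real.exp X)
  set S := ∑ k ∈ Finset.Icc 1 (K * N), (L k + (L k)⁻¹) with hS
  have hterm : ∀ k ∈ Finset.Icc 1 (K * N), 0 ≤ L k + (L k)⁻¹ := fun k hk => by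
    have := hpos' k (Finset.mem_Icc.1 hk).1
    positivity
  have hS0 : 0 ≤ S := Finset.sum_nonneg hterm
  -- For `n < N` all indices involved are at most `K * N`, where both `L` and its inverse are
  -- bounded by `S`; hence the term `S * S`.
  refine ⟨Real.exp 2 + S * S, by positivity, fun n n' hn hnn' hn' => ?_⟩
  have p1 := hpos' n hn
  have p2 := hpos' n' (hn.trans hnn')
  have hn0 : (0 : ℝ) < n := by exact_mod_cast hn
  have hn0' : (0 : ℝ) < n' := by exact_mod_cast hn.trans hnn'
  have e2 : (0 : ℝ) ≤ Real.exp 2 := (Real.exp_pos 2).le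
  rcases le_or_gt N n with hNn | hNn
  · have hXn : X ≤ Real.log n := by
      rw [Real.le_log_iff_exp_le hn0]
      exact hN.trans (by exact_mod_cast hNn)
    have hu0 : 0 ≤ Real.log n' - Real.log n := by
      rw [sub_nonneg]
      exact Real.log_le_log hn0 (by exact_mod_cast hnn')
    have hK : 0 < (K : ℝ) := by
      rcases Nat.eq_zero_or_pos K with rfl | hK
      · omega
      · exact_mod_cast hK
    have hu1 : Real.log n' - Real.log n ≤ Real.log K := by
      rw [sub_le_iff_le_add, ← Real.log_mul hK.ne' hn0.ne']
      exact Real.log_le_log hn0' (by exact_mod_cast hn')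
    have h1 := hX _ hXn _ ⟨hu0, hu1⟩
    simp only [add_sub_cancel, Real.exp_log hn0, Real.exp_log hn0'] at h1
    rw [abs_le] at h1
    have key : ∀ {a b : ℝ}, 0 < a → 0 < b → Real.log a - Real.log b ≤ 2 →
        a ≤ (Real.exp 2 + S * S) * b := by
      intro a b ha hb hab
      have : a ≤ Real.exp 2 * b := by
        rw [← Real.exp_log ha, ← Real.exp_log hb, ← Real.exp_add]
        refine Real.exp_le_exp.2 ?_
        linarith
      nlinarith [mul_nonneg (mul_nonneg hS0 hS0) hb.le]
    exact ⟨key p2 p1 h1.2, key p1 p2 (by linarith [h1.1])⟩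
  · have key : ∀ m : ℕ, 1 ≤ m → m ≤ K * N → L m ≤ S ∧ 1 ≤ S * L m := by
      intro m h1 h2
      have p := hpos' m h1
      have hle := Finset.single_le_sum (f := fun k : ℕ => L k + (L k)⁻¹) hterm
        (Finset.mem_Icc.2 ⟨h1, h2⟩)
      have p' : 0 < (L m)⁻¹ := inv_pos.2 p
      refine ⟨by linarith, ?_⟩
      rw [← inv_mul_cancel₀ p.ne']
      exact mul_le_mul_of_nonneg_right (by linarith) p.le
    have hle : K * n ≤ K * N := Nat.mul_le_mul_left _ hNn.le
    obtain ⟨a1, a2⟩ := key n hn (by omega)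
    obtain ⟨b1, b2⟩ := key n' (by omega) (by omega)
    constructor
    · nlinarith [mul_le_mul_of_nonneg_left a2 hS0, mul_nonneg e2 p1.le]
    · nlinarith [mul_le_mul_of_nonneg_left b2 hS0, mul_nonneg e2 p2.le]

end SlowVariation

/-! ### The mean square displacement -/

section Displacement

variable {V : Type u} {G : SimpleGraph V}

/-- The distance between the first and the last edge of a walk. -/
noncomputable def displacement (G : SimpleGraph V) (q : List V) : ℕ :=
  sInf {d : ℕ | ∃ a ∈ q.take 2, ∃ b ∈ q.drop (q.length - 2), d = G.dist a b}

lemma displacement_le {q : List V} {a b : V} (ha : a ∈ q.take 2)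
    (hb : b ∈ q.drop (q.length - 2)) : displacement G q ≤ G.dist a b :=
  Nat.sInf_le ⟨a, ha, b, hb, rfl⟩

lemma exists_displacement_eq (G : SimpleGraph V) {q : List V} (hq : 2 ≤ q.length) :
    ∃ a ∈ q.take 2, ∃ b ∈ q.drop (q.length - 2), displacement G q = G.dist a b := by
  have h1 : q.take 2 ≠ [] := by rw [← List.length_pos_iff]; simp; omega
  have h2 : q.drop (q.length - 2) ≠ [] := by rw [← List.length_pos_iff]; simp; omega
  exact Nat.sInf_mem (s := {d : ℕ | ∃ a ∈ q.take 2, ∃ b ∈ q.drop (q.length - 2), d = G.dist a b})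
    ⟨_, _, List.head_mem h1, _, List.head_mem h2, rfl⟩

lemma IsMid.midDist_eq {q : List V} (hq : IsMid G q) (h : q.length - 2 ≠ 0) :
    midDist G hq.toMidSAW.first hq.toMidSAW.last = 1 + displacement G q := by
  have hne : hq.toMidSAW.first ≠ hq.toMidSAW.last := by
    intro he
    have := congrArg Fin.val (hq.toMidSAW.edge_injective he)
    simp at this
    omega
  rw [midDist, if_neg hne, displacement]
  simp only [mem_take_two_iff hq.two_le, mem_drop_two_iff hq.two_le]
  rfl

open Classical in
/-- The square of the displacement, for the walks that start in `W`. -/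
noncomputable def sqDisp (G : SimpleGraph V) (W : Set V) (q : List V) : ℝ≥0∞ :=
  if StartsAt W q then ((1 + displacement G q : ℕ) : ℝ≥0∞) ^ 2 else 0

lemma finite_isMid_of_length_eq_two (hf : ∀ v, (G.neighborSet v).Finite) {W : Set V}
    (hW : W.Finite) : {q | IsMid G q ∧ StartsAt W q ∧ q.length - 2 = 0}.Finite := by
  have : (⋃ v ∈ W, ((fun w => [v, w]) '' G.neighborSet v ∪
      (fun w => [w, v]) '' G.neighborSet v)).Finite :=
    hW.biUnion fun v _ => ((hf v).image _).union ((hf v).image _)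
  refine this.subset ?_
  rintro q ⟨hq, ⟨v, hv, hvq⟩, hl⟩
  have h2 := hq.two_le
  match q, (show q.length = 2 by omega) with
  | [a, b], _ =>
    have hab : G.Adj a b := by simpa using hq.chain
    simp only [mem_iUnion]
    simp at hvq
    rcases hvq with rfl | rfl
    · exact ⟨v, hv, Or.inl ⟨b, hab, rfl⟩⟩
    · exact ⟨v, hv, Or.inr ⟨a, hab.symm, rfl⟩⟩

/-- The walks without vertices do not affect the finiteness of the sum of the squared
displacements. -/
lemma weightedSum_sqDisp_lt_top_iff (hf : ∀ v, (G.neighborSet v).Finite) {W : Set V}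
    (hW : W.Finite) {ω : ℕ → ℝ≥0∞} (hω : ∀ n, ω n ≠ ⊤) {x : ℝ} :
    weightedSum G ω (ENNReal.ofReal x) (sqDisp G W) < ⊤ ↔
      ∑' n, ∑' π : {π : MidSAW G (n + 1) // π.first ∈ incidentEdges G W},
        ω (n + 1) * ENNReal.ofReal x ^ (n + 1) * (midDist G π.1.first π.1.last : ℝ≥0∞) ^ 2 < ⊤ := by
  classical
  set F : (Σ n, MidSAW G n) → ℝ≥0∞ := fun π =>
    if π.1 ≠ 0 ∧ π.2.first ∈ incidentEdges G W then
      ω π.1 * ENNReal.ofReal x ^ π.1 * (midDist G π.2.first π.2.last : ℝ≥0∞) ^ 2 else 0 with hF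
  set F₀ : List V → ℝ≥0∞ := fun q =>
    ω (q.length - 2) * ENNReal.ofReal x ^ (q.length - 2) * sqDisp G W q with hF₀
  -- `sqDisp` is `1` and not `0` on a walk without vertices that starts in `W`. These finitely many
  -- walks are split off as `F₂`.
  set F₁ : List V → ℝ≥0∞ := fun q => if q.length - 2 = 0 then 0 else F₀ q with hF₁
  set F₂ : List V → ℝ≥0∞ := fun q => if q.length - 2 = 0 then F₀ q else 0 with hF₂
  have e1 : ∑' n, ∑' π : {π : MidSAW G (n + 1) // π.first ∈ incidentEdges G W},
        ω (n + 1) * ENNReal.ofReal x ^ (n + 1) * (midDist G π.1.first π.1.last : ℝ≥0∞) ^ 2 =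
        ∑' π, F π := by
    rw [ENNReal.tsum_sigma', tsum_eq_zero_add' (f := fun n => ∑' π : MidSAW G n, F ⟨n, π⟩)
      ENNReal.summable]
    have : ∑' π : MidSAW G 0, F ⟨0, π⟩ = 0 := by simp [hF]
    rw [this, zero_add]
    refine tsum_congr fun n => ?_
    rw [tsum_subtype_eq_tsum_ite (fun π : MidSAW G (n + 1) => π.first ∈ incidentEdges G W)
      fun π => ω (n + 1) * ENNReal.ofReal x ^ (n + 1) * (midDist G π.first π.last : ℝ≥0∞) ^ 2]
    refine tsum_congr fun π => ?_
    simp [hF]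
  have key : ∀ q (hq : IsMid G q), F ⟨_, hq.toMidSAW⟩ = F₁ q := by
    intro q hq
    simp only [hF, hF₁, hF₀, sqDisp, hq.first_mem_iff]
    by_cases h0 : q.length - 2 = 0
    · simp [h0]
    · rw [hq.midDist_eq h0]
      by_cases hs : StartsAt W q
      · simp [h0, hs]
      · simp [hs]
  have e2 : weightedSum G ω (ENNReal.ofReal x) (sqDisp G W) = midSum G F₁ + midSum G F₂ := by
    rw [weightedSum, midSum, midSum, midSum, ← ENNReal.tsum_add]
    refine tsum_congr fun q => ?_
    simp only [hF₁, hF₂]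
    split_ifs <;> simp [hF₀]
  have h2 : midSum G F₂ < ⊤ := by
    have hfin := finite_isMid_of_length_eq_two hf hW
    have : midSum G F₂ ≤ ∑ q ∈ hfin.toFinset, F₀ q := by
      have e := tsum_subtype {q | IsMid G q} F₂
      refine (le_of_eq e).trans ?_
      have e' : ∑' q, {q | IsMid G q ∧ StartsAt W q ∧ q.length - 2 = 0}.indicator F₀ q =
          ∑ q ∈ hfin.toFinset,
            {q | IsMid G q ∧ StartsAt W q ∧ q.length - 2 = 0}.indicator F₀ q :=
        tsum_eq_sum fun q hq => Set.indicator_of_notMem (by rwa [Set.Finite.mem_toFinset] at hq) _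
      refine le_trans (ENNReal.tsum_le_tsum fun q => ?_) (e'.le.trans (Finset.sum_le_sum fun q _ =>
          Set.indicator_le_self _ _ _))
      by_cases h1 : IsMid G q
      · by_cases h2 : q.length - 2 = 0
        · by_cases h3 : StartsAt W q
          · simp [Set.indicator, h1, h2, h3, hF₂]
          · simp [Set.indicator, h1, h3, hF₂, hF₀, sqDisp]
        · simp [Set.indicator, h1, h2, hF₂]
      · simp [Set.indicator, h1]
    refine this.trans_lt (ENNReal.sum_lt_top.2 fun q _ => ENNReal.mul_lt_top ?_ ?_)
    · exact ENNReal.mul_lt_top (hω _).lt_top (ENNReal.pow_lt_top ENNReal.ofReal_lt_top)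
    · rw [sqDisp]
      split_ifs
      · exact ENNReal.pow_lt_top (ENNReal.natCast_lt_top _)
      · exact ENNReal.zero_lt_top
  rw [e1, e2, ENNReal.add_lt_top]
  constructor
  · intro h
    exact (tsum_midSAW_le_midSum F F₁ fun q hq => (key q hq).le).trans_lt h.1
  · intro h
    exact ⟨(midSum_le_tsum_midSAW F F₁ fun q hq => (key q hq).symm.le).trans_lt
      (ENNReal.mul_lt_top (by simp) h), h2⟩

/-- The coefficients that replace those of the series defining `ν` if the growth is regular. -/
noncomputable def weightV (γ : ℝ) (L : ℝ → ℝ) (z : ℝ) (n : ℕ) : ℝ≥0∞ :=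
  ENNReal.ofReal (if n = 0 then 1 else
    ((n : ℝ) ^ (2 * z + 1) * (L n * (n : ℝ) ^ (γ - 1)))⁻¹)

lemma isRegularWeight_weightV (γ : ℝ) {L : ℝ → ℝ} (hL : SlowlyVarying L) (z : ℝ) :
    IsRegularWeight (weightV γ L z) :=
  ((regularSeq_rpow (2 * z + 1)).mul
    (hL.regularSeq.mul (regularSeq_rpow (γ - 1)))).inv.isRegularWeight

/-- Regular growth replaces `σ_n⁻¹` by an explicit expression up to constants. The mean then becomes
a plain sum over walks, with a regular weight that is the same for both graphs because they share
`γ` and `L`. -/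
lemma seriesV_lt_top_iff {W : Set V} (hf : ∀ v, (G.neighborSet v).Finite) (hW : W.Finite)
    {μ γ : ℝ} (hμ : 0 < μ) {L : ℝ → ℝ} (hL : SlowlyVarying L) (hG : HasRegularGrowth G W μ γ L)
    (z : ℝ) :
    seriesV G W z < ⊤ ↔
      weightedSum G (weightV γ L z) (ENNReal.ofReal μ⁻¹) (sqDisp G W) < ⊤ := by
  rw [weightedSum_sqDisp_lt_top_iff (ω := weightV γ L z) hf hW fun n => ENNReal.ofReal_ne_top]
  obtain ⟨C₁, C₂, hC₁, hC₂, hgr⟩ := hG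
  have hterm : ∀ n : ℕ, ∃ c : ℝ≥0∞, ENNReal.ofReal (1 / ((n + 1 : ℕ) : ℝ) ^ (2 * z + 1)) *
      meanSqDist G W (n + 1) = c *
        ∑' π : {π : MidSAW G (n + 1) // π.first ∈ incidentEdges G W},
          ((midDist G π.1.first π.1.last : ℝ≥0∞)) ^ 2 ∧
      c ≤ ENNReal.ofReal C₁⁻¹ * (weightV γ L z (n + 1) * ENNReal.ofReal μ⁻¹ ^ (n + 1)) ∧
      weightV γ L z (n + 1) * ENNReal.ofReal μ⁻¹ ^ (n + 1) ≤ ENNReal.ofReal C₂ * c := by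
    intro n
    obtain ⟨g1, g2⟩ := hgr (n + 1) (by omega)
    set a := ((n + 1 : ℕ) : ℝ) ^ (2 * z + 1) with ha
    set R := L (n + 1 : ℕ) * ((n + 1 : ℕ) : ℝ) ^ (γ - 1) with hR
    set N := midSawCount G W (n + 1) with hN
    have hn : (0 : ℝ) < (n + 1 : ℕ) := by positivity
    have a0 : 0 < a := Real.rpow_pos_of_pos hn _
    have R0 : 0 < R := mul_pos (hL.2.1 _ hn) (Real.rpow_pos_of_pos hn _)
    have m0 : 0 < μ ^ (n + 1) := pow_pos hμ _
    have g1' : C₁ * (R * μ ^ (n + 1)) ≤ N := by rw [hR]; linarith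
    have g2' : N ≤ C₂ * (R * μ ^ (n + 1)) := by rw [hR]; linarith
    have hN0 : (0 : ℝ) < N := lt_of_lt_of_le (by positivity) g1'
    have hw : weightV γ L z (n + 1) * ENNReal.ofReal μ⁻¹ ^ (n + 1) =
        ENNReal.ofReal ((a * (R * μ ^ (n + 1)))⁻¹) := by
      rw [weightV, if_neg (by omega), ← ENNReal.ofReal_pow (inv_nonneg.2 hμ.le),
        ← ENNReal.ofReal_mul (by positivity)]
      congr 1
      rw [inv_pow, ← mul_inv, mul_assoc]
    refine ⟨ENNReal.ofReal (a * N)⁻¹, ?_, ?_, ?_⟩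
    · rw [meanSqDist, one_div, mul_inv, div_eq_mul_inv,
        ENNReal.ofReal_mul (by positivity), ENNReal.ofReal_inv_of_pos hN0, ENNReal.ofReal_natCast]
      ring
    · rw [hw, ← ENNReal.ofReal_mul (by positivity), ← mul_inv]
      refine ENNReal.ofReal_le_ofReal (inv_anti₀ (by positivity) ?_)
      nlinarith
    · rw [hw, ← ENNReal.ofReal_mul hC₂.le, ← div_eq_mul_inv]
      refine ENNReal.ofReal_le_ofReal ?_
      rw [inv_le_iff_one_le_mul₀ (by positivity), div_mul_eq_mul_div, one_le_div (by positivity)]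
      nlinarith
  choose c hc1 hc2 hc3 using hterm
  have e1 : seriesV G W z = ∑' n, c n *
      ∑' π : {π : MidSAW G (n + 1) // π.first ∈ incidentEdges G W},
          ((midDist G π.1.first π.1.last : ℝ≥0∞)) ^ 2 := tsum_congr hc1
  simp only [ENNReal.tsum_mul_left]
  rw [e1]
  constructor
  · intro h
    refine lt_of_le_of_lt ?_ (ENNReal.mul_lt_top (ENNReal.ofReal_lt_top (r := C₂)) h)
    rw [← ENNReal.tsum_mul_left]
    refine ENNReal.tsum_le_tsum fun n => ?_
    rw [← mul_assoc]
    exact mul_le_mul' (hc3 n) le_rfl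
  · intro h
    refine lt_of_le_of_lt ?_ (ENNReal.mul_lt_top (ENNReal.ofReal_lt_top (r := C₁⁻¹)) h)
    rw [← ENNReal.tsum_mul_left]
    refine ENNReal.tsum_le_tsum fun n => ?_
    rw [← mul_assoc]
    exact mul_le_mul' (hc2 n) le_rfl

lemma seriesV_antitone (W : Set V) : Antitone fun z => seriesV G W z := by
  intro z z' h
  refine ENNReal.tsum_le_tsum fun n => mul_le_mul' (ENNReal.ofReal_le_ofReal ?_) le_rfl
  have h1 : (1 : ℝ) ≤ (n + 1 : ℕ) := by push_cast; linarith [n.cast_nonneg (α := ℝ)]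
  have : ((n + 1 : ℕ) : ℝ) ^ (2 * z + 1) ≤ ((n + 1 : ℕ) : ℝ) ^ (2 * z' + 1) :=
    Real.rpow_le_rpow_of_exponent_le h1 (by linarith)
  exact one_div_le_one_div_of_le (Real.rpow_pos_of_pos (by linarith) _) this

end Displacement

/-! ### The exponent `ν` -/

namespace Decoration

variable {V : Type u} {T : Type w} {G : SimpleGraph V} {χ : V → Bool} {H : SimpleGraph T} {K : ℕ}
  {D : Decoration G χ H K} {g : Bool → ℝ → ℝ} {μ x₀ : ℝ}

lemma finite_preimage (D : Decoration G χ H K) {W : Set V} (hW : W.Finite) :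
    (D.pr ⁻¹' W).Finite := by
  refine (hW.biUnion fun v _ => D.finite_fiber v).subset fun p hp => ?_
  simp only [mem_iUnion]
  exact ⟨D.pr p, hp, rfl⟩

lemma EndsOver.displacement_le {q' : List T} {q : List V} (h : D.EndsOver q' q)
    (hq' : IsMid H q') (hH : H.Connected) : displacement G q ≤ displacement H q' := by
  obtain ⟨a, ha, b, hb, e⟩ := exists_displacement_eq H hq'.two_le
  rw [e]
  exact (_root_.displacement_le (h.take a ha) (h.drop b hb)).trans (D.dist_pr_le hH a b)

/-- The ends of one edge are at distance `1`, so the projections of the chosen ends are at distance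
at most `displacement G q + 2`. Lifting turns this into `K * (displacement G q + 3)`, whence the
factor `3 * K + 1`. -/
lemma EndsOver.le_displacement {q' : List T} {q : List V} (h : D.EndsOver q' q)
    (hq' : IsMid H q') (hq : IsMid G q) (hG : G.Connected) :
    1 + displacement H q' ≤ (3 * K + 1) * (1 + displacement G q) := by
  have two : ∀ l : List V, l.length = 2 → l.IsChain G.Adj → ∀ a ∈ l, ∀ b ∈ l, G.dist a b ≤ 1 := by
    intro l hl hc a ha b hb
    match l, hl with
    | [c, d], _ =>
      have hcd : G.Adj c d := by simpa using hc
      simp only [List.mem_cons, List.not_mem_nil, or_false] at ha hb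
      rcases ha with rfl | rfl <;> rcases hb with rfl | rfl
      · simp
      · exact (SimpleGraph.dist_eq_one_iff_adj.2 hcd).le
      · exact (SimpleGraph.dist_eq_one_iff_adj.2 hcd.symm).le
      · simp
  have h2 := hq.two_le
  obtain ⟨a, ha, b, hb, e⟩ := exists_displacement_eq G hq.two_le
  obtain ⟨p, hp, r, hr, -⟩ := exists_displacement_eq H hq'.two_le
  have t1 := two _ (by simp; omega) (hq.chain.take 2) _ (h.take p hp) a ha
  have t2 := two _ (by simp; omega) (hq.chain.drop _) b hb _ (h.drop r hr)
  have t3 := hG.dist_triangle (u := D.pr p) (v := a) (w := D.pr r)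
  have t4 := hG.dist_triangle (u := a) (v := b) (w := D.pr r)
  have t5 := D.dist_le hG p r
  have t6 := _root_.displacement_le (G := H) hp hr
  have t7 : K * (G.dist (D.pr p) (D.pr r) + 1) ≤ K * (displacement G q + 3) :=
    Nat.mul_le_mul_left K (by omega)
  nlinarith [Nat.zero_le (K * displacement G q)]

theorem Critical.sameExponent_nu (h : D.Critical g μ x₀) (hG : G.Connected)
    (hf : ∀ v, (G.neighborSet v).Finite) {W : Set V} (hWn : W.Nonempty)
    (hW : W.Finite) (hpr : Function.Surjective D.pr) {γ : ℝ} {L : ℝ → ℝ} (hL : SlowlyVarying L)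
    (h1 : HasRegularGrowth G W μ γ L) (h2 : HasRegularGrowth H (D.pr ⁻¹' W) x₀⁻¹ γ L) :
    SameExponent (IsNu G W) (IsNu H (D.pr ⁻¹' W)) := by
  have hH : H.Connected := D.connected hG (hWn.preimage hpr).to_type
  refine sameExponent_isThreshold (seriesV_antitone W) fun z => ?_
  rw [seriesV_lt_top_iff hf hW (by linarith [h.one_le]) hL h1, seriesV_lt_top_iff
    (D.finite_neighborSet hf) (D.finite_preimage hW) (inv_pos.2 h.pos) hL h2, inv_inv]
  refine h.weightedSum_lt_top_iff (A := ((3 * K + 1 : ℕ) : ℝ≥0∞) ^ 2)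
    (isRegularWeight_weightV γ hL z) (fun n => ENNReal.ofReal_ne_top)
    (ENNReal.pow_ne_top (ENNReal.natCast_ne_top _)) hW _ _ (fun q => ?_) (fun q hq => ?_)
    (fun q' q hq' hq hqq => ?_) fun q' q hq' hq hqq => ?_
  · rw [sqDisp]
    split_ifs
    · exact ENNReal.pow_ne_top (ENNReal.natCast_ne_top _)
    · exact ENNReal.zero_ne_top
  · rw [sqDisp, if_neg hq]
  · rw [sqDisp, sqDisp]
    by_cases hs : StartsAt (D.pr ⁻¹' W) q'
    · rw [if_pos hs, if_pos (hqq.startsAt hs), ← mul_pow]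
      refine pow_le_pow_left' ?_ 2
      exact_mod_cast hqq.le_displacement hq' hq hG
    · simp [hs]
  · rw [sqDisp, sqDisp]
    by_cases hs : StartsAt W q
    · rw [if_pos hs, if_pos (startsAt_of_mem_goodLifts hqq hs), ← mul_pow]
      refine pow_le_pow_left' ?_ 2
      have := (endsOver_of_mem_goodLifts hq hqq).displacement_le hq' hH
      have h3 : 1 + displacement G q ≤ (3 * K + 1) * (1 + displacement H q') := by nlinarith
      exact_mod_cast h3
    · simp [hs]

end Decoration

/-! ### Sums over the paths of a finite graph -/

namespace SimpleGraph

variable {U : Type w} (Γ : SimpleGraph U)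

/-- The sum of `x ^ n` over the paths from `a` to `b`, where `n` is the number of vertices. -/
noncomputable def pathSum (a b : U) (x : ℝ) : ℝ :=
  ∑ᶠ p : Γ.Path a b, x ^ (p.1.length + 1)

lemma pathSum_symm (a b : U) (x : ℝ) : Γ.pathSum a b x = Γ.pathSum b a x := by
  refine finsum_eq_of_bijective Path.reverse ?_ fun p => by simp [Path.reverse]
  refine Function.bijective_iff_has_inverse.2 ⟨Path.reverse, fun p => ?_, fun p => ?_⟩ <;>
    exact Subtype.ext (Walk.reverse_reverse _)

lemma pathSum_iso (α : Γ ≃g Γ) (a b : U) (x : ℝ) :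
    Γ.pathSum (α a) (α b) x = Γ.pathSum a b x := by
  symm
  refine finsum_eq_of_bijective (fun p => p.map α.toHom α.injective) ⟨?_, ?_⟩ fun p => ?_
  · exact Path.map_injective α.injective a b
  · intro p
    have h : ∀ {c d : U} (e : Γ.Walk c d), e.IsPath → c = α a → d = α b →
        ∃ q : Γ.Walk a b, q.IsPath ∧ (q.map α.toHom).support = e.support := by
      rintro c d e he rfl rfl
      have h1 := he.map (f := α.symm.toHom) α.symm.injective
      refine ⟨(e.map α.symm.toHom).copy (by simp) (by simp), by simpa using h1, ?_⟩
      rw [Walk.support_map, Walk.support_copy, Walk.support_map, List.map_map]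
      refine (List.map_congr_left fun y _ => ?_).trans (List.map_id _)
      exact α.apply_symm_apply y
    obtain ⟨q, hq, hqe⟩ := h p.1 p.2 rfl rfl
    exact ⟨⟨q, hq⟩, Subtype.ext (Walk.ext_support hqe)⟩
  · simp [Path.map]

lemma finite_path [Finite U] (a b : U) : Finite (Γ.Path a b) := by
  classical
  cases nonempty_fintype U
  infer_instance

/-- Every path has a vertex, so only positive powers of `x` occur; this gives the value at `0` and
the scaling inequality. Connectedness supplies a path, hence positivity and the bound at `1`. -/
lemma isGenFun_pathSum [Finite U] (hΓ : Γ.Connected) (a b : U) : IsGenFun (Γ.pathSum a b) := by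
  classical
  have := Γ.finite_path a b
  have := Fintype.ofFinite (Γ.Path a b)
  obtain ⟨w₀⟩ := hΓ.preconnected a b
  have hne : Nonempty (Γ.Path a b) := ⟨w₀.toPath⟩
  have e : ∀ x, Γ.pathSum a b x = ∑ p : Γ.Path a b, x ^ (p.1.length + 1) := fun x =>
    finsum_eq_sum_of_fintype _
  refine ⟨?_, ?_, ?_, fun x hx => ?_, fun t x ht0 ht1 hx => ?_⟩
  · rw [funext e]
    fun_prop
  · rw [e]
    simp
  · rw [e]
    simp only [one_pow, Finset.sum_const, Finset.card_univ, nsmul_eq_mul, mul_one]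
    exact_mod_cast Fintype.card_pos
  · rw [e]
    exact Finset.sum_pos (fun p _ => pow_pos hx _) Finset.univ_nonempty
  · rw [e, e, Finset.mul_sum]
    refine Finset.sum_le_sum fun p _ => ?_
    rw [mul_pow]
    refine mul_le_mul_of_nonneg_right ?_ (pow_nonneg hx _)
    exact pow_le_of_le_one ht0 ht1 (by omega)

end SimpleGraph

/-! ### The transformed graph is a decoration -/

namespace PortedGraph

variable {U : Type w} {φ : PortedGraph U} {N : Type u} {att : N → Fin 3}

/-- The vertex with the edges `N` can be replaced by `φ`, the edges being attached according to
`att`. -/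
structure Fits (φ : PortedGraph U) (att : N → Fin 3) : Prop where
  sum : ∀ a b, a ≠ b → ∀ x, φ.graph.pathSum (φ.port (att a)) (φ.port (att b)) x = φ.gen x
  meet : ∀ a b c d, a ≠ b → c ≠ d →
    φ.port (att a) = φ.port (att c) ∨ φ.port (att a) = φ.port (att d) ∨
    φ.port (att b) = φ.port (att c) ∨ φ.port (att b) = φ.port (att d)

/-- Transitivity controls only one port at a time, so it is applied to the third one: an
automorphism that moves the port `k ∉ {i, j}` to port `2` must send the pair `i, j` to `0, 1` in
some order. Reversing paths makes the order irrelevant. -/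
lemma IsGadget.pathSum_port (h : φ.IsGadget) {i j : Fin 3} (hij : i ≠ j) (x : ℝ) :
    φ.graph.pathSum (φ.port i) (φ.port j) x = φ.gen x := by
  obtain ⟨S, hS, htr⟩ := h.symmetric
  obtain ⟨k, hki, hkj⟩ : ∃ k : Fin 3, k ≠ i ∧ k ≠ j := by revert i j; decide
  obtain ⟨α, hα, hαk⟩ := htr k 2
  have hr : ∀ i, ∃ i', φ.port i' = α (φ.port i) := fun i => by
    have : α (φ.port i) ∈ α '' range φ.port := ⟨_, ⟨i, rfl⟩, rfl⟩
    rwa [hS α hα] at this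
  obtain ⟨i', hi'⟩ := hr i
  obtain ⟨j', hj'⟩ := hr j
  have ne : ∀ {a b c d : Fin 3}, φ.port a = α (φ.port c) → φ.port b = α (φ.port d) → c ≠ d →
      a ≠ b := by
    rintro a b c d h1 h2 hcd rfl
    exact hcd (h.port_injective (α.injective (h1.symm.trans h2)))
  have n1 := ne hi' hj' hij
  have n2 := ne hαk.symm hi' hki
  have n3 := ne hαk.symm hj' hkj
  rw [← SimpleGraph.pathSum_iso _ α, ← hi', ← hj']
  have : (i' = 0 ∧ j' = 1) ∨ (i' = 1 ∧ j' = 0) := by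
    clear hi' hj' hij
    revert i' j'
    decide
  rcases this with ⟨rfl, rfl⟩ | ⟨rfl, rfl⟩
  · rfl
  · rw [SimpleGraph.pathSum_symm]
    rfl

lemma IsGadget.fits (h : φ.IsGadget) (hatt : Function.Injective att) : φ.Fits att := by
  refine ⟨fun a b hab x => h.pathSum_port (hatt.ne hab) x, fun a b c d hab hcd => ?_⟩
  have : ∀ i j k l : Fin 3, i ≠ j → k ≠ l → i = k ∨ i = l ∨ j = k ∨ j = l := by decide
  rcases this _ _ _ _ (hatt.ne hab) (hatt.ne hcd) with h | h | h | h <;> simp [h]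

/-- All ports of the one-vertex graph coincide, so it fits a vertex of any degree. This allows white
vertices of arbitrary degree in the first case. -/
lemma trivial_fits (att : N → Fin 3) : (PortedGraph.trivial.{w}).Fits att :=
  ⟨fun _ _ _ _ => rfl, fun _ _ _ _ _ _ => Or.inl rfl⟩

lemma trivial_connected : (PortedGraph.trivial.{w}).graph.Connected :=
  { preconnected := fun _ _ => SimpleGraph.Reachable.refl _, nonempty := ⟨PUnit.unit⟩ }

lemma trivial_gen (x : ℝ) : (PortedGraph.trivial.{w}).gen x = x := by
  have : Unique ((PortedGraph.trivial.{w}).graph.Path PUnit.unit PUnit.unit) :=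
    { default := SimpleGraph.Path.nil
      uniq := fun p => SimpleGraph.Path.loop_eq p }
  refine (finsum_unique (α := (PortedGraph.trivial.{w}).graph.Path PUnit.unit PUnit.unit)
    fun p => x ^ (p.1.length + 1)).trans ?_
  rw [SimpleGraph.Path.loop_eq default]
  simp

end PortedGraph

section Transform

variable {V : Type u} {G : SimpleGraph V} {χ : G.Coloring Bool} {U₁ U₂ : Type w}
  {φ₁ : PortedGraph U₁} {φ₂ : PortedGraph U₂} {att : (v : V) → G.neighborSet v → Fin 3}

/-- The generating function of the graph put in place of a vertex of the given colour. -/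
noncomputable def fiberGen (φ₁ : PortedGraph U₁) (φ₂ : PortedGraph U₂) : Bool → ℝ → ℝ
  | true => φ₁.gen
  | false => φ₂.gen

lemma transform_adj_fiber {v : V} {a b : Fiber U₁ U₂ (χ v)} :
    (transform χ φ₁ φ₂ att).Adj ⟨v, a⟩ ⟨v, b⟩ ↔ (fiberGraph φ₁ φ₂ (χ v)).Adj a b := by
  constructor
  · rintro (⟨v', a', b', h1, h2, h⟩ | ⟨h, -⟩)
    · cases h1
      obtain rfl : b = b' := by simpa using h2
      exact h
    · exact absurd rfl h.ne
  · exact fun h => Or.inl ⟨v, a, b, rfl, rfl, h⟩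

lemma sigma_fiber_injective (v : V) :
    Function.Injective fun a : Fiber U₁ U₂ (χ v) => (⟨v, a⟩ : TVertex χ U₁ U₂) := fun a b h => by
  simpa using h

/-- The embedding of a gadget into the transformed graph. -/
def fiberHom (v : V) : fiberGraph φ₁ φ₂ (χ v) →g transform χ φ₁ φ₂ att where
  toFun a := ⟨v, a⟩
  map_rel' h := transform_adj_fiber.2 h

lemma exists_code [Finite U₁] [Finite U₂] : ∃ (K : ℕ) (f : ∀ c, Fiber U₁ U₂ c → Fin K),
    ∀ c, Function.Injective (f c) := by
  obtain ⟨n, ⟨e⟩⟩ := Finite.exists_equiv_fin U₁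
  obtain ⟨m, ⟨e'⟩⟩ := Finite.exists_equiv_fin U₂
  refine ⟨n + m, fun c => match c with
    | true => fun a => Fin.castLE (by omega) (e a)
    | false => fun a => Fin.castLE (by omega) (e' a), fun c => ?_⟩
  cases c
  · exact (Fin.castLE_injective _).comp e'.injective
  · exact (Fin.castLE_injective _).comp e.injective

lemma fits_fiber {N : Type u} {at' : N → Fin 3} {c : Bool} (h₁ : c = true → φ₁.Fits at')
    (h₂ : c = false → φ₂.Fits at') :
    (∀ a b, a ≠ b → ∀ x, (fiberGraph φ₁ φ₂ c).pathSum (fiberPort φ₁ φ₂ c (at' a))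
      (fiberPort φ₁ φ₂ c (at' b)) x = fiberGen φ₁ φ₂ c x) ∧
    ∀ a b a' b', a ≠ b → a' ≠ b' →
      fiberPort φ₁ φ₂ c (at' a) = fiberPort φ₁ φ₂ c (at' a') ∨
      fiberPort φ₁ φ₂ c (at' a) = fiberPort φ₁ φ₂ c (at' b') ∨
      fiberPort φ₁ φ₂ c (at' b) = fiberPort φ₁ φ₂ c (at' a') ∨
      fiberPort φ₁ φ₂ c (at' b) = fiberPort φ₁ φ₂ c (at' b') := by
  cases c
  · exact ⟨(h₂ rfl).sum, (h₂ rfl).meet⟩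
  · exact ⟨(h₁ rfl).sum, (h₁ rfl).meet⟩

open Classical in
/-- The transformed graph is a decoration of the original one. -/
theorem exists_decoration [Finite U₁] [Finite U₂] (hc₁ : φ₁.graph.Connected)
    (hc₂ : φ₂.graph.Connected) (h₁ : ∀ v, χ v = true → φ₁.Fits (att v))
    (h₂ : ∀ v, χ v = false → φ₂.Fits (att v)) :
    ∃ (K : ℕ) (D : Decoration G χ (transform χ φ₁ φ₂ att) K), D.pr = Sigma.fst ∧
      D.HasGen (fiberGen φ₁ φ₂) := by
  obtain ⟨K, f, hf⟩ := exists_code (U₁ := U₁) (U₂ := U₂)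
  have hconn : ∀ c, (fiberGraph φ₁ φ₂ c).Connected := fun c => by
    cases c
    · exact hc₂
    · exact hc₁
  have hfin : ∀ c, Finite (Fiber U₁ U₂ c) := fun c => Finite.of_injective _ (hf c)
  let D : Decoration G χ (transform χ φ₁ φ₂ att) K :=
    { pr := Sigma.fst
      -- The label `0` for vertices that are not adjacent is a dummy: every condition on ports
      -- beyond `pr_port` concerns edges of `G`.
      port := fun v w =>
        ⟨v, fiberPort φ₁ φ₂ (χ v) (if h : G.Adj v w then att v ⟨w, h⟩ else 0)⟩
      code := fun p => f _ p.2
      color := fun {v w} h => by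
        have := χ.valid h
        revert this
        cases χ v <;> cases χ w <;> simp
      pr_port := fun _ _ => rfl
      code_inj := by
        rintro ⟨v, a⟩ ⟨w, b⟩ h1 h2
        obtain rfl : v = w := h1
        exact Sigma.ext rfl (heq_of_eq (hf _ h2))
      adj_port := fun {v w} h => Or.inr ⟨h, by simp [h], by simp [h.symm]⟩
      cross := by
        rintro p q (⟨v, a, b, rfl, rfl, h⟩ | ⟨h, h1, h2⟩) hne
        · exact absurd rfl hne
        · refine ⟨h, Sigma.ext rfl ?_, Sigma.ext rfl ?_⟩
          · simp [h, h1]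
          · simp [h.symm, h2]
      conn := by
        rintro ⟨v, a⟩ ⟨w, b⟩ h
        obtain rfl : v = w := h
        obtain ⟨p⟩ := (hconn (χ v)).preconnected a b
        refine ⟨(p.toPath.1.map (fiberHom v)).support, ?_, SimpleGraph.Walk.isChain_adj_support _,
          ?_, ?_, ?_⟩
        · rw [SimpleGraph.Walk.support_map]
          exact p.toPath.2.support_nodup.map (f := fiberHom v) (sigma_fiber_injective v)
        · rw [SimpleGraph.Walk.support_map]
          intro x hx
          obtain ⟨y, -, rfl⟩ := List.mem_map.1 hx
          rfl
        · rw [List.head?_eq_some_head (SimpleGraph.Walk.support_ne_nil _),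
            SimpleGraph.Walk.head_support]
          rfl
        · rw [List.getLast?_eq_some_getLast (SimpleGraph.Walk.support_ne_nil _),
            SimpleGraph.Walk.getLast_support]
          rfl
      meet := by
        intro v a b c d ha hb hc hd hab hcd
        simp only [ha, hb, hc, hd, dif_pos, Sigma.mk.injEq, heq_eq_eq, true_and]
        exact (fits_fiber (h₁ v) (h₂ v)).2 ⟨a, ha⟩ ⟨b, hb⟩ ⟨c, hc⟩ ⟨d, hd⟩
          (fun h => hab (congrArg Subtype.val h)) fun h => hcd (congrArg Subtype.val h) }
  refine ⟨K, D, rfl, fun x hx v a b ha hb hab => ?_⟩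
  set i := fiberPort φ₁ φ₂ (χ v) (att v ⟨a, ha⟩) with hi
  set j := fiberPort φ₁ φ₂ (χ v) (att v ⟨b, hb⟩) with hj
  have ei : D.port v a = ⟨v, i⟩ := by simp [D, ha, hi]
  have ej : D.port v b = ⟨v, j⟩ := by simp [D, hb, hj]
  have := hfin (χ v)
  have := (fiberGraph φ₁ φ₂ (χ v)).finite_path i j
  have := Fintype.ofFinite ((fiberGraph φ₁ φ₂ (χ v)).Path i j)
  change _ = ENNReal.ofReal (fiberGen φ₁ φ₂ (χ v) x)
  rw [← (fits_fiber (h₁ v) (h₂ v)).1 ⟨a, ha⟩ ⟨b, hb⟩ (fun h => hab (congrArg Subtype.val h)) x,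
    SimpleGraph.pathSum, finsum_eq_sum_of_fintype, ENNReal.ofReal_sum_of_nonneg
      fun p _ => pow_nonneg hx _]
  symm
  -- The traversals of the fiber of `v` are exactly the images of the paths of the gadget between
  -- the two outer vertices.
  refine Finset.sum_nbij (fun p => p.1.support.map (Sigma.mk v)) (fun p _ => ?_)
    (fun p _ q _ h => ?_) (fun P hP => ?_) fun p _ => ?_
  · rw [D.mem_seg]
    refine ⟨p.2.support_nodup.map sigma_mk_injective, ?_, ?_, ?_, ?_⟩
    · exact (List.isChain_map _).2 (p.1.isChain_adj_support.imp fun a b h =>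
        transform_adj_fiber.2 h)
    · intro x hx
      obtain ⟨y, -, rfl⟩ := List.mem_map.1 hx
      rfl
    · rw [ei, List.head?_map, List.head?_eq_some_head (SimpleGraph.Walk.support_ne_nil _),
        SimpleGraph.Walk.head_support]
      rfl
    · rw [ej, List.getLast?_map, List.getLast?_eq_some_getLast (SimpleGraph.Walk.support_ne_nil _),
        SimpleGraph.Walk.getLast_support]
      rfl
  · exact Subtype.ext (SimpleGraph.Walk.ext_support
      (List.map_injective_iff.2 (sigma_fiber_injective v) h))
  · obtain ⟨h1, h2, h3, h4, h5⟩ := D.mem_seg.1 hP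
    obtain ⟨Q, rfl⟩ : ∃ Q : List (Fiber U₁ U₂ (χ v)), P = Q.map (Sigma.mk v) := by
      clear h1 h2 h4 h5 hP
      induction P with
      | nil => exact ⟨[], rfl⟩
      | cons p P ih =>
        obtain ⟨Q, rfl⟩ := ih fun x hx => h3 x (List.mem_cons_of_mem _ hx)
        obtain ⟨v', y⟩ := p
        obtain rfl : v' = v := h3 _ List.mem_cons_self
        exact ⟨y :: Q, rfl⟩
    have hch : Q.IsChain (fiberGraph φ₁ φ₂ (χ v)).Adj := by
      rw [List.isChain_map] at h2
      exact h2.imp fun a b h => transform_adj_fiber.1 h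
    have hne : Q ≠ [] := by rintro rfl; simp at h4
    rw [ei, List.head?_map, List.head?_eq_some_head hne] at h4
    rw [ej, List.getLast?_map, List.getLast?_eq_some_getLast hne] at h5
    have e4 : Q.head hne = i := by simpa using h4
    have e5 : Q.getLast hne = j := by simpa using h5
    refine ⟨⟨(SimpleGraph.Walk.ofSupport Q hne hch).copy e4 e5, ?_⟩, Finset.mem_coe.2
      (Finset.mem_univ _), ?_⟩
    · rw [SimpleGraph.Walk.isPath_def, SimpleGraph.Walk.support_copy,
        SimpleGraph.Walk.support_ofSupport]
      exact List.Nodup.of_map _ h1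
    · simp [SimpleGraph.Walk.support_ofSupport]
  · rw [ENNReal.ofReal_pow hx]
    simp

end Transform

/-! ### Translates of the fundamental domain -/

section Translates

variable {V : Type u} {G : SimpleGraph V}

lemma dist_iso_le (hG : G.Connected) (α : G ≃g G) (a b : V) : G.dist (α a) (α b) ≤ G.dist a b := by
  obtain ⟨p, hp⟩ := hG.exists_walk_length_eq_dist a b
  rw [← hp, ← SimpleGraph.Walk.length_map α.toHom p]
  exact SimpleGraph.dist_le _

lemma IsFundamentalDomain.nonempty [Nonempty V] {χ : G.Coloring Bool} {W : Set V}
    (hW : IsFundamentalDomain χ W) : W.Nonempty := by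
  obtain ⟨α, -, h⟩ := hW.2 (Classical.arbitrary V)
  exact ⟨_, h⟩

/-- There are translates of the fundamental domain at arbitrarily large distances. -/
lemma IsFundamentalDomain.exists_translates [Infinite V] {χ : G.Coloring Bool} {W : Set V}
    (hW : IsFundamentalDomain χ W) (hf : ∀ v, (G.neighborSet v).Finite) (hG : G.Connected) :
    ∃ S : ℕ → Set V, (∀ k, S k ∈ colourTranslates χ W) ∧
      Tendsto (fun k => setDist G W (S k)) atTop atTop := by
  obtain ⟨w₀, hw₀⟩ := hW.nonempty
  obtain ⟨R, hR⟩ : ∃ R, ∀ a ∈ W, ∀ b ∈ W, G.dist a b ≤ R := by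
    obtain ⟨R, hR⟩ := ((hW.1.prod hW.1).image fun p => G.dist p.1 p.2).bddAbove
    exact ⟨R, fun a ha b hb => hR ⟨(a, b), ⟨ha, hb⟩, rfl⟩⟩
  -- The translate that contains `v k` will be used. Since `R` bounds the diameter of `W`, and so of
  -- its translates, the margin `2 * R` leaves a distance of at least `k` between the two sets.
  choose v hv using fun k => exists_dist_gt hf hG w₀ (k + 2 * R)
  choose α hα hαW using fun k => hW.2 (v k)
  refine ⟨fun k => (α k).symm '' W, fun k => ⟨(α k).symm, fun z => ?_, rfl⟩, ?_⟩
  · rw [← hα k, (α k).apply_symm_apply]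
  · refine tendsto_atTop_mono (fun k => ?_) tendsto_id
    obtain ⟨a, ha, b, ⟨b, hb, rfl⟩, e⟩ := exists_setDist_eq G ⟨w₀, hw₀⟩
      (show ((α k).symm '' W).Nonempty from ⟨_, w₀, hw₀, rfl⟩)
    rw [e, id]
    have h1 := hR w₀ hw₀ a ha
    have h2 := hR b hb _ (hαW k)
    have h3 := dist_iso_le hG (α k).symm b (α k (v k))
    rw [(α k).symm_apply_apply] at h3
    have h4 := hG.dist_triangle (u := w₀) (v := a) (w := v k)
    have h5 := hG.dist_triangle (u := a) (v := (α k).symm b) (w := v k)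
    have := hv k
    omega

end Translates

/-! ### Proof of the theorem -/

/-- The conclusions of the main theorem, for graphs `φ₁` and `φ₂` that fit the vertices that they
replace. -/
theorem transform_exponents {V : Type u} [Infinite V] {G : SimpleGraph V}
    (hf : ∀ v, (G.neighborSet v).Finite) (hconn : G.Connected) (χ : G.Coloring Bool)
    (hqt : ColourQuasiTransitive χ) {U₁ U₂ : Type w} {φ₁ : PortedGraph U₁} {φ₂ : PortedGraph U₂}
    [Finite U₁] [Finite U₂] (hc₁ : φ₁.graph.Connected) (hc₂ : φ₂.graph.Connected)
    {att : (v : V) → G.neighborSet v → Fin 3}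
    (h₁ : ∀ v, χ v = true → φ₁.Fits (att v)) (h₂ : ∀ v, χ v = false → φ₂.Fits (att v))
    {G' : SimpleGraph (TVertex χ U₁ U₂)} (hG' : G' = transform χ φ₁ φ₂ att) :
    ∃ μ μ' : ℝ, 0 < μ ∧ 0 < μ' ∧ IsConnectiveConstant G μ ∧ IsConnectiveConstant G' μ' ∧
      μ ^ (-2 : ℤ) = φ₁.gen μ'⁻¹ * φ₂.gen μ'⁻¹ ∧
      ∀ W : Set V, IsFundamentalDomain χ W →
      ∀ W' : Set (TVertex χ U₁ U₂), W' = liftSet χ U₁ U₂ W →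
        SameExponent (IsGamma G W μ) (IsGamma G' W' μ') ∧
        ((∃ η, IsEta G' W' (inducedTranslates χ U₁ U₂ W) μ' η) →
          SameExponent (IsEta G W (colourTranslates χ W) μ)
            (IsEta G' W' (inducedTranslates χ U₁ U₂ W) μ')) ∧
        (AutomorphismsLift χ G' → (∃ η, IsEta G' W' (autTranslates G' W') μ' η) →
          SameExponent (IsEta G W (colourTranslates χ W) μ)
            (IsEta G' W' (autTranslates G' W') μ')) ∧
        (∀ (γ : ℝ) (L : ℝ → ℝ), IsGamma G W μ γ → SlowlyVarying L →
          HasRegularGrowth G W μ γ L → HasRegularGrowth G' W' μ' γ L →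
          SameExponent (IsNu G W) (IsNu G' W')) := by
  subst hG'
  obtain ⟨W₀, hW₀, hW₀α⟩ := hqt
  obtain ⟨μ, hμ, hu, hl⟩ := exists_growth hf hconn hW₀ fun v => by
    obtain ⟨α, -, hα⟩ := hW₀α v
    exact ⟨α, hα⟩
  have hμ0 : 0 < μ := by linarith
  obtain ⟨K, D, hpr, hgen⟩ := exists_decoration hc₁ hc₂ h₁ h₂
  have hg : ∀ c, IsGenFun (fiberGen φ₁ φ₂ c) := fun c => by
    cases c
    · exact φ₂.graph.isGenFun_pathSum hc₂ _ _
    · exact φ₁.graph.isGenFun_pathSum hc₁ _ _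
  obtain ⟨x₀, hx0, hx1, hx⟩ := exists_critical hg hμ
  have hcrit : D.Critical (fiberGen φ₁ φ₂) μ x₀ := ⟨hμ, hg, hgen, hx0, hx1, hx⟩
  have hu' := D.upperGrowth hf hμ hu hg hgen hx0 hx1 hx
  have hl' := D.lowerGrowth hf hμ hl hg hgen hx0 hx1 hx hu'
  have hsurj : Function.Surjective D.pr := by
    intro v
    obtain ⟨a⟩ := hc₁.nonempty
    obtain ⟨b⟩ := hc₂.nonempty
    have hne : ∀ c, Nonempty (Fiber U₁ U₂ c) := fun c => by
      cases c
      · exact ⟨b⟩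
      · exact ⟨a⟩
    exact ⟨⟨v, (hne (χ v)).some⟩, by rw [hpr]⟩
  refine ⟨μ, x₀⁻¹, hμ0, inv_pos.2 hx0, isConnectiveConstant_of_growth hμ0 hu hl,
    isConnectiveConstant_of_growth (inv_pos.2 hx0) hu' hl', ?_, ?_⟩
  · rw [inv_inv, zpow_neg, ← inv_zpow]
    exact hx.symm
  · intro W hW W' hW'
    have hlift : ∀ S, liftSet χ U₁ U₂ S = D.pr ⁻¹' S := fun S => by rw [hpr]; rfl
    obtain rfl : W' = D.pr ⁻¹' W := hW'.trans (hlift W)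
    have hWne := hW.nonempty
    have hex := hW.exists_translates hf hconn
    have hSne : ∀ S ∈ colourTranslates χ W, S.Nonempty := by
      rintro _ ⟨α, -, rfl⟩
      exact hWne.image α
    refine ⟨hcrit.sameExponent_gamma hW.1, fun hη => ?_, fun haut hη => ?_,
      fun γ L _ hL hr hr' => hcrit.sameExponent_nu hconn hf hWne hW.1 hsurj hL hr hr'⟩
    · refine hcrit.sameExponent_eta hconn hWne hsurj (fun S hS => ⟨hSne S hS, ?_⟩) hex hη
      obtain ⟨α, hα, rfl⟩ := hS
      exact ⟨α, hα, (hlift _).symm⟩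
    · refine hcrit.sameExponent_eta hconn hWne hsurj (fun S hS => ⟨hSne S hS, ?_⟩) hex hη
      obtain ⟨α, hα, rfl⟩ := hS
      obtain ⟨β, hβ⟩ := haut α hα
      refine ⟨β, ?_⟩
      -- As `β` covers `α`, it maps the set over `W` onto the set over `α '' W`, which is thus a
      -- translate under an automorphism of the transformed graph.
      have hβ' : ∀ p, D.pr (β p) = α (D.pr p) := by rw [hpr]; exact hβ
      ext p
      constructor
      · rintro ⟨a, ha, hap⟩
        refine ⟨β.symm p, ?_, β.apply_symm_apply p⟩
        have h1 := hβ' (β.symm p)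
        rw [β.apply_symm_apply, ← hap] at h1
        change D.pr (β.symm p) ∈ W
        rwa [← α.injective h1]
      · rintro ⟨q, hq, rfl⟩
        exact ⟨D.pr q, hq, (hβ' q).symm⟩

theorem theorem3p5 {V : Type u} [Infinite V] (G : SimpleGraph V) [G.LocallyFinite]
    (hconn : G.Connected) (χ : G.Coloring Bool) (hqt : ColourQuasiTransitive χ) :
    -- every black vertex (colour `true`) is cubic and only the black class is transformed
    (∀ (U : Type w) (φ : PortedGraph U), φ.IsGadget →
      (∀ v, χ v = true → G.degree v = 3) →
      ∀ att : (v : V) → G.neighborSet v → Fin 3,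
      (∀ v, χ v = true → Function.Bijective (att v)) →
      ∀ G' : SimpleGraph (TVertex χ U PUnit.{w + 1}),
      G' = transform χ φ PortedGraph.trivial att →
      ∃ μ μ' : ℝ, 0 < μ ∧ 0 < μ' ∧ IsConnectiveConstant G μ ∧ IsConnectiveConstant G' μ' ∧
        μ ^ (-2 : ℤ) = μ'⁻¹ * φ.gen μ'⁻¹ ∧
        ∀ W : Set V, IsFundamentalDomain χ W →
        ∀ W' : Set (TVertex χ U PUnit.{w + 1}), W' = liftSet χ U PUnit W →
          SameExponent (IsGamma G W μ) (IsGamma G' W' μ') ∧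
          ((∃ η, IsEta G' W' (inducedTranslates χ U PUnit W) μ' η) →
            SameExponent (IsEta G W (colourTranslates χ W) μ)
              (IsEta G' W' (inducedTranslates χ U PUnit W) μ')) ∧
          (AutomorphismsLift χ G' → (∃ η, IsEta G' W' (autTranslates G' W') μ' η) →
            SameExponent (IsEta G W (colourTranslates χ W) μ)
              (IsEta G' W' (autTranslates G' W') μ')) ∧
          (∀ (γ : ℝ) (L : ℝ → ℝ), IsGamma G W μ γ → SlowlyVarying L →
            HasRegularGrowth G W μ γ L → HasRegularGrowth G' W' μ' γ L →
            SameExponent (IsNu G W) (IsNu G' W'))) ∧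
    -- all vertices are cubic and both classes are transformed
    (∀ (U₁ U₂ : Type w) (φ₁ : PortedGraph U₁) (φ₂ : PortedGraph U₂),
      φ₁.IsGadget → φ₂.IsGadget →
      (∀ v, G.degree v = 3) →
      ∀ att : (v : V) → G.neighborSet v → Fin 3,
      (∀ v, Function.Bijective (att v)) →
      ∀ G' : SimpleGraph (TVertex χ U₁ U₂), G' = transform χ φ₁ φ₂ att →
      ∃ μ μ' : ℝ, 0 < μ ∧ 0 < μ' ∧ IsConnectiveConstant G μ ∧ IsConnectiveConstant G' μ' ∧
        μ ^ (-2 : ℤ) = φ₁.gen μ'⁻¹ * φ₂.gen μ'⁻¹ ∧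
        ∀ W : Set V, IsFundamentalDomain χ W →
        ∀ W' : Set (TVertex χ U₁ U₂), W' = liftSet χ U₁ U₂ W →
          SameExponent (IsGamma G W μ) (IsGamma G' W' μ') ∧
          ((∃ η, IsEta G' W' (inducedTranslates χ U₁ U₂ W) μ' η) →
            SameExponent (IsEta G W (colourTranslates χ W) μ)
              (IsEta G' W' (inducedTranslates χ U₁ U₂ W) μ')) ∧
          (AutomorphismsLift χ G' → (∃ η, IsEta G' W' (autTranslates G' W') μ' η) →
            SameExponent (IsEta G W (colourTranslates χ W) μ)
              (IsEta G' W' (autTranslates G' W') μ')) ∧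
          (∀ (γ : ℝ) (L : ℝ → ℝ), IsGamma G W μ γ → SlowlyVarying L →
            HasRegularGrowth G W μ γ L → HasRegularGrowth G' W' μ' γ L →
            SameExponent (IsNu G W) (IsNu G' W'))) := by

  have hf : ∀ v, (G.neighborSet v).Finite := fun v => Set.toFinite _
  constructor
  · intro U φ hφ _ att hatt G' hG'
    have := hφ.finite
    -- The white vertices carry the one-vertex gadget, whose generating function `x` is the first
    -- factor of `h`.
    obtain ⟨μ, μ', h1, h2, h3, h4, h5, h6⟩ := transform_exponents hf hconn χ hqt hφ.connected
      PortedGraph.trivial_connected (fun v hv => hφ.fits (hatt v hv).injective)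
      (fun v _ => PortedGraph.trivial_fits (att v)) hG'
    rw [PortedGraph.trivial_gen, mul_comm] at h5
    exact ⟨μ, μ', h1, h2, h3, h4, h5, h6⟩
  · intro U₁ U₂ φ₁ φ₂ hφ₁ hφ₂ _ att hatt G' hG'
    have := hφ₁.finite
    have := hφ₂.finite
    exact transform_exponents hf hconn χ hqt hφ₁.connected hφ₂.connected
      (fun v _ => hφ₁.fits (hatt v).injective) (fun v _ => hφ₂.fits (hatt v).injective) hG'
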